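/- Let $M$ be a compact $n$-manifold without boundary, with a smooth Riemannian metric $\mathsf g$, Riemannian volume $\mu$ and Levi-Civita derivative $\nabla$. Let $e\colon(0,\infty)\times\mathbb R\to\mathbb R$ be smooth (internal energy), fix $s_0\in C^\infty(M)$ and the initial entropy density $\varsigma_0=s_0\mu$, and put $$P(\rho,\sigma)=\rho^2\frac{\partial e}{\partial\rho}(\rho,\sigma)+\sigma\rho\frac{\partial e}{\partial\sigma}(\rho,\sigma),\qquad \bar U(\rho,\sigma)=\int_M e(\rho,\sigma)\,\rho\,\mu .$$ For $\varphi\in\mathrm{Diff}(M)$ write $\rho_\varphi=\varphi_*\mu/\mu=\mathrm{Jac}(\varphi^{-1})$ and $\sigma_\varphi=\varphi_*\varsigma_0/\mu=(s_0\circ\varphi^{-1})\,\mathrm{Jac}(\varphi^{-1})$ (push-forward of densities, $\mathrm{Jac}>0$), let $U(\varphi)=\bar U(\rho_\varphi,\sigma_\varphi)$, and consider on $\mathrm{Diff}(M)$ the Lagrangian $$L(\varphi,\dot\varphi)=\frac12\int_M|\dot\varphi|^2\mu-\bar U(\rho_\varphi,\sigma_\varphi).$$ Let $\mathcal N=\mathrm{Diff}_\mu(M)\cap\mathrm{Diff}_{\varsigma_0}(M)$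 be the group of diffeomorphisms $\eta$ with $\eta_*\mu=\mu$, $\eta_*\varsigma_0=\varsigma_0$. Identify the smooth part of $T^*\mathrm{Diff}(M)$ with $\mathrm{Diff}(M)\times\mathfrak X^*(M)$, $\mathfrak X^*(M)=\Omega^1(M)\otimes\mu$, by $\langle\alpha\otimes\mu,\dot\varphi\rangle=\int_M\alpha(\dot\varphi\circ\varphi^{-1})\mu$; in this trivialization its canonical bracket at $m$ of functions with differentials $(\nu_i,v_i)$ is $\langle m,[v_1,v_2]\rangle-\langle\nu_1,v_2\rangle+\langle\nu_2,v_1\rangle$. Let $\mathfrak s_{(2)}=\mathfrak X(M)\ltimes C^\infty(M,\mathbb R^2)$, with smooth dual $\mathfrak s_{(2)}^*=\mathfrak X^*(M)\times C^\infty(M)^2\ni(m,\rho,\sigma)$ and the Lie-Poisson bracket $$\{F,G\}=\Big\langle m,\big[\tfrac{\delta F}{\delta m},\tfrac{\delta G}{\delta m}\big]\Big\rangle+\sum_{\tau\in\{\rho,\sigma\}}\int_M\tau\Big(\mathcal L_{\frac{\delta F}{\delta m}}\tfrac{\delta G}{\delta\tau}-\mathcal L_{\frac{\delta G}{\delta m}}\tfrac{\delta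 F}{\delta\tau}\Big)\mu ,$$ Hamilton's equations being $\dot F=\{H,F\}$. Let $H(m,\rho,\sigma)=\int_M\frac{1}{2\rho}|m|^2\mu+\bar U(\rho,\sigma)$ for $\rho>0$. All curves and families below are smooth (jointly in the parameters and in $x\in M$), and $J\subseteq\mathbb R$ is an open interval. Then: 1. $\mathcal N$ is a group, and $L(\varphi\circ\eta,\dot\varphi\circ\eta)=L(\varphi,\dot\varphi)$ for $\eta\in\mathcal N$. 2. The map $\Psi(\varphi,m)=(m,\rho_\varphi,\sigma_\varphi)$ takes values in $\mathfrak s^*_{(2)}$ with $\rho_\varphi>0$, and its fibres are exactly the orbits $\{(\varphi\circ\eta,m):\eta\in\mathcal N\}$, so that it induces an injection $T^*\mathrm{Diff}(M)/\mathcal N\hookrightarrow\mathfrak s_{(2)}^*$. It is a Poisson map: if $F,G$ have (smooth) variational derivatives at $\Psi(\varphi,m)$, then $F\circ\Psi$, $G\circ\Psi$ have differentials at $(\varphi,m)$ and $\{F\circ\Psi,G\circ\Psi\}(\varphi,m)=\{F,G\}(\Psi(\varphi,m))$. 3. The Legendre transform of $L$ sends $\dot\varphi=v\circ\varphi$ to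 $m=\rho_\varphi v^\flat\otimes\mu$, and $\langle m,\dot\varphi\rangle-L(\varphi,\dot\varphi)=H(\Psi(\varphi,m))$. 4. For a curve $(v,\rho,\sigma)$ on $J$ with $\rho>0$, the curve $(\rho v^\flat\otimes\mu,\rho,\sigma)$ solves the Lie-Poisson system of $H$ on $\mathfrak s_{(2)}^*$ if and only if $(v,\rho,\sigma)$ solves the fully compressible Euler system $$\dot v+\nabla_vv+\rho^{-1}\nabla P(\rho,\sigma)=0,\qquad \dot\rho+\operatorname{div}(\rho v)=0,\qquad \dot\sigma+\operatorname{div}(\sigma v)=0. \tag{E}$$ 5. For a curve $\varphi$ in $\mathrm{Diff}(M)$ on $J$, with $v=\dot\varphi\circ\varphi^{-1}$, the following are equivalent: (a) $\varphi$ is a critical point of the action $\int L(\varphi,\dot\varphi)\,dt$ on each compact subinterval of $J$, for variations with fixed endpoints; (b) $\varphi$ solves Newton's equations $\nabla_{\dot\varphi}\dot\varphi=-\nabla^{\mathsf G}U(\varphi)$, $\nabla^{\mathsf G}$ being the gradient of the $L^2$-metric $\mathsf G_\varphi(\dot\varphi,\dot\varphi)=\int_M|\dot\varphi|^2\mu$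 and $\nabla_{\dot\varphi}\dot\varphi$ its covariant derivative, i.e. the pointwise one on $M$; (c) $\Psi(\varphi,\rho_\varphi v^\flat\otimes\mu)$ solves the Lie-Poisson system of $H$ on $\mathfrak s_{(2)}^*$; (d) $(v,\rho_\varphi,\sigma_\varphi)$ solves (E). 6. If $(v,\rho,\sigma)$ solves (E) on $J$, if $\varphi$ is a curve in $\mathrm{Diff}(M)$ with $\dot\varphi=v\circ\varphi$, and if $\rho=\rho_\varphi$, $\sigma=\sigma_\varphi$ at one time of $J$, then $\rho=\rho_\varphi$, $\sigma=\sigma_\varphi$ on all of $J$, and $\varphi$ solves Newton's equations. -/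

import Mathlib

open Set Bundle MeasureTheory
open scoped Manifold ContDiff Topology

namespace FullEuler

noncomputable section

/-- The model space `ℝⁿ`. -/
abbrev Vec (n : ℕ) : Type := EuclideanSpace ℝ (Fin n)

section Objects

variable (n : ℕ) (M : Type*) [TopologicalSpace M] [ChartedSpace (Vec n) M]
  [IsManifold (𝓡 n) ∞ M]

/-- Smooth Riemannian metrics on the `n`-manifold `M`. -/
abbrev RMetric :=
  ContMDiffRiemannianMetric (𝓡 n) ∞ (Vec n) (fun x : M => TangentSpace (𝓡 n) x)

/-- Smooth vector fields `𝔛(M)`. -/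
abbrev VField := Cₛ^∞⟮𝓡 n; Vec n, fun x : M => TangentSpace (𝓡 n) x⟯

/-- Smooth real functions `C^∞(M)`. -/
abbrev SFun := C^∞⟮𝓡 n, M; ℝ⟯

/-- The group `Diff(M)` of smooth diffeomorphisms (`η.trans φ` is `φ ∘ η`). -/
abbrev Diff := M ≃ₘ^∞⟮𝓡 n, 𝓡 n⟯ M

/-- A family of covectors on `M`; it is a 1-form when it is smooth, see `SmoothForm`. -/
abbrev Covec := (x : M) → (TangentSpace (𝓡 n) x →L[ℝ] ℝ)

end Objects

section Geometry

variable {n : ℕ} {M : Type*} [TopologicalSpace M] [ChartedSpace (Vec n) M]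
  [IsManifold (𝓡 n) ∞ M]

/-! ### Riemannian volume, Levi-Civita derivative, gradient and divergence -/

/-- The preferred chart at `x`. Mathlib identifies `T_x M` with `ℝⁿ` through this chart. -/
abbrev chart (x : M) := extChartAt (𝓡 n) x

/-- The tangent vector at `chart_x⁻¹(z)` whose coordinates in the chart at `x` are `w`. -/
def coordVec (x : M) (z w : Vec n) : TangentSpace (𝓡 n) ((chart (n := n) x).symm z) :=
  mfderiv 𝓘(ℝ, Vec n) (𝓡 n) (chart (n := n) x).symm z w

/-- The coordinate representation of a vector field in the chart at `x`. -/
def fieldCoord (x : M) (v : (y : M) → TangentSpace (𝓡 n) y) (z : Vec n) : Vec n :=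
  mfderiv (𝓡 n) 𝓘(ℝ, Vec n) (chart (n := n) x) ((chart (n := n) x).symm z)
    (v ((chart (n := n) x).symm z))

/-- The coordinate representation of the metric in the chart at `x`. -/
def metricCoord (g : RMetric n M) (x : M) (z u w : Vec n) : ℝ :=
  g.inner ((chart (n := n) x).symm z) (coordVec x z u) (coordVec x z w)

/-- The density `√(det g_ij)` of the Riemannian volume in the chart at `x`. -/
def volDensity (g : RMetric n M) (x : M) (z : Vec n) : ℝ :=
  √(Matrix.det (Matrix.of fun i j : Fin n =>
    metricCoord g x z (EuclideanSpace.single i 1) (EuclideanSpace.single j 1)))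

/-- `√(det g_ij)` at the point `x` itself, in the preferred chart at `x`. -/
def volDensityAt (g : RMetric n M) (x : M) : ℝ := volDensity g x (chart (n := n) x x)

/-- The measure `√(det g_ij) dz` on the domain of the chart at `x`, extended by zero to `M`. -/
def chartVolume [MeasurableSpace M] (g : RMetric n M) (x : M) : Measure M :=
  (((volume : Measure (Vec n)).restrict (chart (n := n) x).target).withDensity
    (fun z => ENNReal.ofReal (volDensity g x z))).map (chart (n := n) x).symm

/-- The Riemannian volume measure `μ`. The chart volumes agree on overlaps of charts, so their
supremum in the lattice of measures is the measure that restricts to each of them. -/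
def riemVol [MeasurableSpace M] (g : RMetric n M) : Measure M := ⨆ x : M, chartVolume g x

/-- `α^♯`, the unique `u ∈ T_x M` with `g(u, ·) = α`. -/
def sharp (g : RMetric n M) (x : M) (α : TangentSpace (𝓡 n) x →L[ℝ] ℝ) : TangentSpace (𝓡 n) x :=
  Function.invFun (fun u : TangentSpace (𝓡 n) x => g.inner x u) α

/-- The derivative `u f` of the function `f` in the direction `u ∈ T_x M`. -/
def dirDeriv (f : M → ℝ) (x : M) (u : TangentSpace (𝓡 n) x) : ℝ :=
  mfderiv (𝓡 n) 𝓘(ℝ, ℝ) f x u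

/-- The Riemannian gradient of a function. -/
def grad (g : RMetric n M) (f : M → ℝ) (x : M) : TangentSpace (𝓡 n) x :=
  sharp g x (mfderiv (𝓡 n) 𝓘(ℝ, ℝ) f x)

/-- The derivative `∂_a (g(w, z))` of the metric coefficients at `x` in the chart at `x`. -/
def dMetric (g : RMetric n M) (x : M) (a w z : Vec n) : ℝ :=
  fderiv ℝ (fun p => metricCoord g x p w z) (chart (n := n) x x) a

/-- The Christoffel symbol `Γ_x(u, w)` of the Levi-Civita connection at `x`, in the chart at `x`:
the unique vector with
`g_x(Γ_x(u, w), z) = (∂_u g(w, z) + ∂_w g(u, z) - ∂_z g(u, w)) / 2` for all `z`. -/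
def christoffel (g : RMetric n M) (x : M) (u w : TangentSpace (𝓡 n) x) : TangentSpace (𝓡 n) x :=
  Function.invFun
    (fun (y : TangentSpace (𝓡 n) x) (z : TangentSpace (𝓡 n) x) => g.inner x y z)
    (fun z => (dMetric g x u w z + dMetric g x w u z - dMetric g x z u w) / 2)

/-- The Levi-Civita covariant derivative `∇_u v` at `x`. -/
def covDeriv (g : RMetric n M) (u v : (y : M) → TangentSpace (𝓡 n) y) (x : M) :
    TangentSpace (𝓡 n) x :=
  let Dv : TangentSpace (𝓡 n) x := fderiv ℝ (fieldCoord x v) (chart (n := n) x x) (u x)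
  Dv + christoffel g x (u x) (v x)

/-- The velocity `ċ(t)` of a curve in `M`. -/
def curveVel (c : ℝ → M) (t : ℝ) : TangentSpace (𝓡 n) (c t) :=
  mfderiv 𝓘(ℝ, ℝ) (𝓡 n) c t (1 : ℝ)

/-- The covariant acceleration `∇_ċ ċ` of a curve in `M` at time `t`. -/
def curveAccel (g : RMetric n M) (c : ℝ → M) (t : ℝ) : TangentSpace (𝓡 n) (c t) :=
  let a : Vec n := iteratedDeriv 2 (fun s => chart (n := n) (c t) (c s)) t
  let c₂ : TangentSpace (𝓡 n) (c t) := a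
  c₂ + christoffel g (c t) (curveVel c t) (curveVel c t)

/-- The divergence `div v = (det g)^{-1/2} ∑ᵢ ∂ᵢ((det g)^{1/2} vⁱ)`. -/
def divergence (g : RMetric n M) (v : (y : M) → TangentSpace (𝓡 n) y) (x : M) : ℝ :=
  (volDensityAt g x)⁻¹ * ∑ i : Fin n,
    fderiv ℝ (fun z => volDensity g x z * fieldCoord x v z i) (chart (n := n) x x)
      (EuclideanSpace.single i 1)

/-! ### Diffeomorphisms and densities -/

/-- The derivative of `φ` at `x`, in the preferred charts at `x` and at `φ x`. -/
def derivMap (φ : Diff n M) (x : M) : Vec n →ₗ[ℝ] Vec n :=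
  (mfderiv (𝓡 n) (𝓡 n) φ x : TangentSpace (𝓡 n) x →L[ℝ] TangentSpace (𝓡 n) (φ x)).toLinearMap

/-- The Jacobian `Jac(φ)` with respect to the Riemannian density `μ`: `φ^* μ = Jac(φ) μ`. -/
def Jac (g : RMetric n M) (φ : Diff n M) (x : M) : ℝ :=
  |LinearMap.det (derivMap φ x)| * volDensityAt g (φ x) / volDensityAt g x

/-- The push-forward `φ_*(f μ) / μ` of the density `f μ`, so that `push g φ 1 = Jac(φ⁻¹)`. -/
def push (g : RMetric n M) (φ : Diff n M) (f : M → ℝ) (y : M) : ℝ :=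
  f (φ.symm y) * Jac g φ.symm y

/-- The mass density `ρ = φ_* μ / μ = Jac(φ⁻¹)`. -/
def density (g : RMetric n M) (φ : Diff n M) : M → ℝ := push g φ 1

/-- `𝒩 = Diff_μ(M) ∩ Diff_{ς₀}(M)`: the diffeomorphisms that preserve the densities `μ`
and `ς₀ = s₀ μ`. -/
def symmetryGroup (g : RMetric n M) (s₀ : SFun n M) : Set (Diff n M) :=
  {η | push g η 1 = 1} ∩ {η | push g η s₀ = s₀}

/-! ### Smooth curves -/

/-- A family `α_p`, `p ∈ S`, of covector fields is smooth in `(p, x)`. -/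
def SmoothFormOn {P : Type*} [NormedAddCommGroup P] [NormedSpace ℝ P] (S : Set P)
    (α : P → Covec n M) : Prop :=
  ContMDiffOn (𝓘(ℝ, P).prod (𝓡 n)) ((𝓡 n).prod 𝓘(ℝ, Vec n →L[ℝ] ℝ)) ∞
    (fun p : P × M => TotalSpace.mk' (Vec n →L[ℝ] ℝ)
      (E := fun x : M => TangentSpace (𝓡 n) x →L[ℝ] ℝ) p.2 (α p.1 p.2)) (S ×ˢ univ)

/-- A family `v_p`, `p ∈ S`, of vector fields is smooth in `(p, x)`. -/
def SmoothFieldOn {P : Type*} [NormedAddCommGroup P] [NormedSpace ℝ P] (S : Set P)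
    (v : P → (x : M) → TangentSpace (𝓡 n) x) : Prop :=
  ContMDiffOn (𝓘(ℝ, P).prod (𝓡 n)) (𝓡 n).tangent ∞
    (fun p : P × M => (⟨p.2, v p.1 p.2⟩ : TangentBundle (𝓡 n) M)) (S ×ˢ univ)

variable (n) in
/-- A family `f_p`, `p ∈ S`, of functions is smooth in `(p, x)`. -/
def SmoothFunOn {P : Type*} [NormedAddCommGroup P] [NormedSpace ℝ P] (S : Set P)
    (f : P → M → ℝ) : Prop :=
  ContMDiffOn (𝓘(ℝ, P).prod (𝓡 n)) 𝓘(ℝ, ℝ) ∞ (fun p : P × M => f p.1 p.2) (S ×ˢ univ)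

/-- A family `φ_p`, `p ∈ S`, of diffeomorphisms is smooth: `(p, x) ↦ (p, φ_p(x))` is a
diffeomorphism of `S × M`, i.e. `φ_p(x)` and `φ_p⁻¹(x)` are smooth in `(p, x)`. -/
def SmoothDiffOn {P : Type*} [NormedAddCommGroup P] [NormedSpace ℝ P] (S : Set P)
    (φ : P → Diff n M) : Prop :=
  ContMDiffOn (𝓘(ℝ, P).prod (𝓡 n)) (𝓡 n) ∞ (fun p : P × M => φ p.1 p.2) (S ×ˢ univ) ∧
  ContMDiffOn (𝓘(ℝ, P).prod (𝓡 n)) (𝓡 n) ∞ (fun p : P × M => (φ p.1).symm p.2) (S ×ˢ univ)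

/-- The velocity `φ̇_t ∈ T_{φ_t} Diff(M)`, a vector field along `φ_t`. -/
def lagVel (φ : ℝ → Diff n M) (t : ℝ) (x : M) : TangentSpace (𝓡 n) (φ t x) :=
  curveVel (fun s => φ s x) t

/-- The Eulerian velocity `v_t = φ̇_t ∘ φ_t⁻¹`. -/
def eulVel (φ : ℝ → Diff n M) (t : ℝ) (y : M) : TangentSpace (𝓡 n) y :=
  lagVel φ t ((φ t).symm y)

/-! ### Lagrangian and Newton's equations on `Diff(M)` -/

section Newton

variable [MeasurableSpace M]

/-- The potential `Ū(ρ, σ) = ∫ e(ρ, σ) ρ μ`. -/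
def Ubar (g : RMetric n M) (e : ℝ → ℝ → ℝ) (ρ σ : M → ℝ) : ℝ :=
  ∫ x, e (ρ x) (σ x) * ρ x ∂riemVol g

/-- The potential `U(φ) = Ū(Jac(φ⁻¹), φ_* ς₀ / μ)` on `Diff(M)`. -/
def potential (g : RMetric n M) (e : ℝ → ℝ → ℝ) (s₀ : SFun n M) (φ : Diff n M) : ℝ :=
  Ubar g e (density g φ) (push g φ s₀)

/-- The Lagrangian `L(φ, φ̇) = ½ ∫ |φ̇|² μ - Ū(ρ, σ)`, `φ̇ = ξ` a vector field along `φ`. -/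
def lagrangian (g : RMetric n M) (e : ℝ → ℝ → ℝ) (s₀ : SFun n M) (φ : Diff n M)
    (ξ : (x : M) → TangentSpace (𝓡 n) (φ x)) : ℝ :=
  (1 / 2) * ∫ x, g.inner (φ x) (ξ x) (ξ x) ∂riemVol g - potential g e s₀ φ

/-- Newton's equations for the Lagrangian `L`, as Hamilton's principle: on each compact
subinterval of `J` the curve `φ` is a critical point of the action `∫ L(φ, φ̇) dt` among the
curves in `Diff(M)` with the same endpoints. -/
def IsCriticalCurve (g : RMetric n M) (e : ℝ → ℝ → ℝ) (s₀ : SFun n M) (J : Set ℝ)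
    (φ : ℝ → Diff n M) : Prop :=
  ∀ t₀ t₁ : ℝ, t₀ ≤ t₁ → Icc t₀ t₁ ⊆ J → ∀ δ : ℝ, 0 < δ → ∀ Φ : ℝ → ℝ → Diff n M,
    SmoothDiffOn (Ioo (-δ) δ ×ˢ J) (fun p : ℝ × ℝ => Φ p.1 p.2) →
    (∀ t ∈ J, Φ 0 t = φ t) →
    (∀ ε ∈ Ioo (-δ) δ, Φ ε t₀ = φ t₀ ∧ Φ ε t₁ = φ t₁) →
    HasDerivAt (fun ε => ∫ t in t₀..t₁, lagrangian g e s₀ (Φ ε t) (lagVel (Φ ε) t)) 0 0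

/-- `w ∘ φ` is the gradient at `φ` of `U : Diff(M) → ℝ` for the `L²`-metric
`𝖦_φ(ξ, ξ) = ∫ |ξ|² μ`. -/
def HasL2Gradient (g : RMetric n M) (U : Diff n M → ℝ) (φ : Diff n M) (w : VField n M) : Prop :=
  ∀ δ : ℝ, 0 < δ → ∀ ψ : ℝ → Diff n M, SmoothDiffOn (Ioo (-δ) δ) ψ → ψ 0 = φ →
    HasDerivAt (fun ε => U (ψ ε))
      (∫ x, g.inner (ψ 0 x) (w (ψ 0 x)) (lagVel ψ 0 x) ∂riemVol g) 0

/-- Newton's equations `∇_φ̇ φ̇ = -∇^𝖦 U(φ)` on `J`; the covariant derivative of the `L²`-metric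
is the pointwise covariant derivative of `M`. -/
def IsNewtonCurve (g : RMetric n M) (e : ℝ → ℝ → ℝ) (s₀ : SFun n M) (J : Set ℝ)
    (φ : ℝ → Diff n M) : Prop :=
  ∀ t ∈ J, ∃ w : VField n M, HasL2Gradient g (potential g e s₀) (φ t) w ∧
    ∀ x : M, curveAccel g (fun s => φ s x) t = -w (φ t x)

end Newton

end Geometry

/-! ### The Lie-Poisson space of `𝔰₍₂₎ = 𝔛(M) ⋉ C^∞(M, ℝ²)` -/

section LiePoisson

variable (n : ℕ) (M : Type*) [TopologicalSpace M] [ChartedSpace (Vec n) M]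
  [IsManifold (𝓡 n) ∞ M]

/-- The Lie algebra `𝔰₍₂₎ = 𝔛(M) ⋉ C^∞(M, ℝ²)`. -/
structure SAlg where
  /-- the vector field -/
  v : VField n M
  /-- the first function -/
  a : SFun n M
  /-- the second function -/
  b : SFun n M

/-- Points `(m, ρ, σ)`, `m = α ⊗ μ`, of the dual `𝔰₍₂₎^* = 𝔛^*(M) × C^∞(M)²`. Smoothness is kept
apart, in `SDual.Smooth` and `SDual.SmoothOn`; functionals on `𝔰₍₂₎^*` are only ever
differentiated along smooth curves of smooth points. -/
@[ext]
structure SDual where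
  /-- the 1-form `α` of the momentum `m = α ⊗ μ` -/
  α : Covec n M
  /-- the mass density -/
  ρ : M → ℝ
  /-- the entropy density -/
  σ : M → ℝ

/-- Cotangent vectors `(ν ⊗ μ, v)` of `T^* Diff(M) ≅ Diff(M) × 𝔛^*(M)` at a point, where
`T^*_φ Diff(M)` is identified with `𝔛^*(M)` by `⟨ν ⊗ μ, φ̇⟩ = ∫ ν(φ̇ ∘ φ⁻¹) μ`. -/
structure TCovec where
  /-- the 1-form -/
  ν : Covec n M
  /-- the vector field -/
  v : VField n M

end LiePoisson

section LiePoisson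

variable {n : ℕ} {M : Type*} [TopologicalSpace M] [ChartedSpace (Vec n) M]
  [IsManifold (𝓡 n) ∞ M]

/-- A smooth 1-form. -/
def SmoothForm (α : Covec n M) : Prop := SmoothFormOn (univ : Set ℝ) (fun _ => α)

/-- Smooth curves in `𝔰₍₂₎^*`, parametrized by `J`. -/
def SDual.SmoothOn (J : Set ℝ) (γ : ℝ → SDual n M) : Prop :=
  SmoothFormOn J (fun t => (γ t).α) ∧ SmoothFunOn n J (fun t => (γ t).ρ) ∧
    SmoothFunOn n J (fun t => (γ t).σ)

/-- Smooth points of `𝔰₍₂₎^*`. -/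
def SDual.Smooth (ξ : SDual n M) : Prop := SDual.SmoothOn univ (fun _ => ξ)

/-- The velocity of a curve in `𝔰₍₂₎^*`. -/
def SDual.vel (γ : ℝ → SDual n M) (t : ℝ) : SDual n M where
  α x := deriv (fun s => (γ s).α x) t
  ρ x := deriv (fun s => (γ s).ρ x) t
  σ x := deriv (fun s => (γ s).σ x) t

/-- The directional derivative of a smooth function along a smooth vector field. -/
def lieFun (v : VField n M) (f : SFun n M) : SFun n M :=
  ⟨fun x => dirDeriv f x (v x), by
    have h := (f.contMDiff.contMDiff_tangentMap (m := ∞) (by simp)).comp v.contMDiff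
    intro x
    exact (contMDiff_snd_tangentBundle_modelSpace ℝ 𝓘(ℝ, ℝ)).contMDiffAt.comp x (h x)⟩

/-- The commutator `[v, u] = 𝓛_v u` of smooth vector fields. -/
def lieField (v u : VField n M) : VField n M :=
  ⟨fun x => VectorField.mlieBracket (𝓡 n) v u x, fun x => by
    have : IsManifold (𝓡 n) (minSmoothness ℝ 2) M :=
      IsManifold.of_le (n := ∞) (by
        simp only [minSmoothness_of_isRCLikeNormedField]; exact ENat.LEInfty.out)
    have : IsManifold (𝓡 n) (((⊤ : ℕ∞) : WithTop ℕ∞) + 1) M :=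
      IsManifold.of_le (n := ∞) (by simp)
    exact ContMDiffAt.mlieBracket_vectorField (m := ⊤) (n := ⊤) (v.contMDiff x)
      (u.contMDiff x) (by simp only [minSmoothness_of_isRCLikeNormedField]; exact le_rfl)⟩

/-- The commutator `ad_{(v,a,b)} (u,c,d) = (-𝓛_v u, 𝓛_u a - 𝓛_v c, 𝓛_u b - 𝓛_v d)` of `𝔰₍₂₎`. -/
def SAlg.ad (X Y : SAlg n M) : SAlg n M where
  v := -lieField X.v Y.v
  a := lieFun Y.v X.a - lieFun X.v Y.a
  b := lieFun Y.v X.b - lieFun X.v Y.b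

variable [MeasurableSpace M]

/-- The pairing of `𝔰₍₂₎^*` with `𝔰₍₂₎`. -/
def pairing (g : RMetric n M) (ξ : SDual n M) (X : SAlg n M) : ℝ :=
  ∫ x, (ξ.α x (X.v x) + ξ.ρ x * X.a x + ξ.σ x * X.b x) ∂riemVol g

/-- `X = (δF/δm, δF/δρ, δF/δσ)` are the variational derivatives at `ξ` of a functional `F` on
`𝔰₍₂₎^*`: the derivative of `F` along each smooth curve through `ξ` is the pairing of the velocity
with `X`. -/
def HasVarDeriv (g : RMetric n M) (F : SDual n M → ℝ) (ξ : SDual n M) (X : SAlg n M) : Prop :=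
  ∀ δ : ℝ, 0 < δ → ∀ γ : ℝ → SDual n M, SDual.SmoothOn (Ioo (-δ) δ) γ → γ 0 = ξ →
    HasDerivAt (fun ε => F (γ ε)) (pairing g (SDual.vel γ 0) X) 0

/-- The Lie-Poisson bracket `{F, G}(ξ)` on `𝔰₍₂₎^*`, of functionals with the variational
derivatives `dF`, `dG` at `ξ`, in the sign convention in which `Ḟ = {H, F}` are Hamilton's
equations. -/
def liePoisson (g : RMetric n M) (ξ : SDual n M) (dF dG : SAlg n M) : ℝ :=
  -pairing g ξ (SAlg.ad dF dG)

/-- The curve `γ` in `𝔰₍₂₎^*` is a smooth solution on `J` of the Lie-Poisson system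
`Ḟ = {H, F}` with the Hamiltonian `H`. -/
def IsLiePoissonSolution (g : RMetric n M) (H : SDual n M → ℝ) (J : Set ℝ)
    (γ : ℝ → SDual n M) : Prop :=
  SDual.SmoothOn J γ ∧ ∀ t ∈ J, ∃ dH : SAlg n M, HasVarDeriv g H (γ t) dH ∧
    ∀ (F : SDual n M → ℝ) (dF : SAlg n M), HasVarDeriv g F (γ t) dF →
      HasDerivAt (fun s => F (γ s)) (liePoisson g (γ t) dH dF) t

/-- The Hamiltonian `H(m, ρ, σ) = ∫ |m|² / (2ρ) μ + Ū(ρ, σ)`, meaningful where `ρ > 0`. -/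
def hamiltonian (g : RMetric n M) (e : ℝ → ℝ → ℝ) (ξ : SDual n M) : ℝ :=
  (∫ x, (1 / (2 * ξ.ρ x)) * ξ.α x (sharp g x (ξ.α x)) ∂riemVol g) + Ubar g e ξ.ρ ξ.σ

/-! ### The cotangent bundle `T^* Diff(M) ≅ Diff(M) × 𝔛^*(M)` -/

/-- `D` is the differential at `(φ, α ⊗ μ)` of a function `F` on `T^* Diff(M)`. -/
def HasCotDeriv (g : RMetric n M) (F : Diff n M → Covec n M → ℝ) (φ : Diff n M) (α : Covec n M)
    (D : TCovec n M) : Prop :=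
  ∀ δ : ℝ, 0 < δ → ∀ (ψ : ℝ → Diff n M) (β : ℝ → Covec n M),
    SmoothDiffOn (Ioo (-δ) δ) ψ → SmoothFormOn (Ioo (-δ) δ) β → ψ 0 = φ → β 0 = α →
    HasDerivAt (fun ε => F (ψ ε) (β ε))
      (∫ x, (D.ν x (eulVel ψ 0 x) + deriv (fun ε => β ε x) 0 (D.v x)) ∂riemVol g) 0

/-- The canonical Poisson bracket of `T^* Diff(M)` at a point with momentum `α ⊗ μ`, in the right
trivialization and in the sign convention `Ḟ = {H, F}`:
`⟨m, [v₁, v₂]⟩ - ⟨ν₁, v₂⟩ + ⟨ν₂, v₁⟩`. -/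
def canonicalBracket (g : RMetric n M) (α : Covec n M) (D₁ D₂ : TCovec n M) : ℝ :=
  ∫ x, (α x (lieField D₁.v D₂.v x) - D₁.ν x (D₂.v x) + D₂.ν x (D₁.v x)) ∂riemVol g

/-! ### The embedding, the Legendre transform and the Euler system -/

/-- The map `T^* Diff(M) → 𝔰₍₂₎^*`, `(φ, m) ↦ (m, φ_* μ / μ, φ_* ς₀ / μ)`. -/
def embed (g : RMetric n M) (s₀ : SFun n M) (φ : Diff n M) (α : Covec n M) : SDual n M where
  α := α
  ρ := density g φ
  σ := push g φ s₀

/-- The momentum `m = ρ v^♭ ⊗ μ` of the velocity field `v`. -/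
def legendre (g : RMetric n M) (ρ : M → ℝ) (v : (x : M) → TangentSpace (𝓡 n) x) : Covec n M :=
  fun x => ρ x • g.inner x (v x)

/-- The pressure `P(ρ, σ) = ρ² ∂e/∂ρ + σ ρ ∂e/∂σ`. -/
def pressure (e : ℝ → ℝ → ℝ) (r s : ℝ) : ℝ :=
  r ^ 2 * deriv (fun r' => e r' s) r + s * r * deriv (fun s' => e r s') s

/-- `(v, ρ, σ)` is a smooth solution on `J` of the fully compressible Euler system
`v̇ + ∇_v v + ρ⁻¹ ∇P(ρ, σ) = 0`, `ρ̇ + div(ρ v) = 0`, `σ̇ + div(σ v) = 0`. -/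
def IsEulerSolution (g : RMetric n M) (P : ℝ → ℝ → ℝ) (J : Set ℝ)
    (v : ℝ → (x : M) → TangentSpace (𝓡 n) x) (ρ σ : ℝ → M → ℝ) : Prop :=
  SmoothFieldOn J v ∧ SmoothFunOn n J ρ ∧ SmoothFunOn n J σ ∧ ∀ t ∈ J, ∀ x : M,
    deriv (fun s => v s x) t + covDeriv g (v t) (v t) x
        + (ρ t x)⁻¹ • grad g (fun y => P (ρ t y) (σ t y)) x = 0 ∧
    deriv (fun s => ρ s x) t + divergence g (fun y => ρ t y • v t y) x = 0 ∧
    deriv (fun s => σ s x) t + divergence g (fun y => σ t y • v t y) x = 0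

end LiePoisson

end

end FullEuler

/-!
The theorem says that the compressible Euler system is Newton's equation on
`Diff(M)`, reduced by the symmetry group of the pair of densities `(μ, s₀ μ)`. Everything follows
from four facts about the Riemannian measure `μ` and the densities `φ_* (s μ)`.

* The density `φ_* (s μ) / μ` depends smoothly on `φ` (`SmoothDiffOn.push`), and integrals against it
  are integrals over the source of `φ` (`integral_mul_push`). The Riemannian measure is defined as a
  supremum of measures in charts; it is the chart volume in every chart (`riemVol_apply_of_subset`),
  so the change of variables formula of `ℝⁿ` applies.
* The divergence theorem (`integral_mul_divergence`), which is integration by parts in `ℝⁿ` summed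
  over a partition of unity. It also shows that the coordinate formula for the divergence does not
  depend on the chart.
* The continuity equation for `φ_{t*} (s μ)` (`integral_mul_deriv_push` in weak form,
  `deriv_push_add_divergence` pointwise), obtained by differentiating the change of variables formula
  against a fixed test function.
* Two pointwise identities of Riemannian geometry, both computed in the chart at the point:
  `metricAt_lieField`, which turns the commutator of vector fields into the covariant derivative, and
  `fderiv_famInner`, the first variation of the kinetic energy.

Symmetry and Poisson map. The densities of `φ ∘ η` are those of `φ` exactly when `η` preserves `μ`
and `s₀ μ`, which is the description of the fibres (`embed_eq_iff`). The differential of `F ∘ embed`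
at `(φ, m)` is read off from the weak continuity equation: with `(v, a, b)` the variational
derivative of `F` it is `(ρ da + σ db, v)` (`hasCotDeriv_comp_embed`), and for such differentials the
canonical bracket is the Lie-Poisson bracket, already under the integral sign
(`canonicalBracket_cotDeriv`).

Lie-Poisson and Euler. The variational derivative of the Hamiltonian at `(ρ v^♭, ρ, σ)` is
`(v, ∂E/∂ρ - |v|² / 2, ∂E/∂σ)` with `E = ρ e` (`hasVarDeriv_hamiltonian`). Integrating by parts and
using `metricAt_lieField` and the Gibbs-Duhem relation `dP = ρ d(∂E/∂ρ) + σ d(∂E/∂σ)`, Hamilton's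
equation for the linear functional of `(X, a, b)` becomes the Euler system integrated against
`(X, a, b)` (`pairing_vel_sub_liePoisson`). Linear functionals have variational derivatives, and
variational derivatives are unique (`HasVarDeriv.unique`); so the Lie-Poisson system and the Euler
system are equivalent (`isLiePoissonSolution_iff_isEulerSolution`).

Newton and Euler. The acceleration of `t ↦ φ_t x` is the material derivative of the Eulerian velocity
(`SmoothDiffOn.curveAccel_eq`), and the `L²`-gradient of the potential is `ρ⁻¹ ∇P`, by the weak
continuity equation and Gibbs-Duhem (`hasL2Gradient_potential`). Gradients are tested against
velocities of families of diffeomorphisms only. There are enough of these: without flows of vector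
fields, perturbations `z ↦ z + κ sin(s) c(z)` of the identity in a chart, inverted by the contraction
principle, give every coordinate vector at a point times a bump function
(`exists_diff_family_chart`, `eq_zero_of_forall_variation`). Hence the gradient is unique
(`HasL2Gradient.unique`).

Critical curves. By `fderiv_famInner` and an integration by parts in time, the first variation of the
action is minus the time integral of the residual of Newton's equations paired with the variation
(`hasDerivAt_action`). A variation `θ_{ε f(t)} ∘ φ_t`, with `f` a quadratic polynomial that vanishes
at the ends of a short interval, detects the sign of the residual at one time; `f` need not have
compact support, because only the endpoints are fixed.

The last part is uniqueness for the continuity equation with a given flow: the integral of a solution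
against a function transported by the flow is constant in time (`integral_transport_eq`,
`eq_push_of_continuity`).

Smoothness of vector fields and forms is expressed in preferred charts by `toCoord` and `ofCoord`.
The tangent space of `M` at a point is by definition `Vec n`; pointwise identities are therefore
proved for elements of `Vec n` and carried over by definitional equality, which is what the local
statements called `alg` are for.
-/

open Set Bundle MeasureTheory
open scoped Manifold ContDiff Topology

namespace FullEuler

noncomputable section

set_option linter.unusedSectionVars false
set_option linter.unusedVariables false

variable {n : ℕ} {M : Type*} [TopologicalSpace M] [ChartedSpace (Vec n) M]
  [IsManifold (𝓡 n) ∞ M]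

/-! ### Coordinates -/

instance isManifold_one : IsManifold (𝓡 n) 1 M := IsManifold.of_le (n := ∞) (by simp)

/-- The coordinates, in the chart at `x`, of a tangent vector at `y`. -/
def toCoord (x y : M) : Vec n →L[ℝ] Vec n :=
  (mfderiv (𝓡 n) 𝓘(ℝ, Vec n) (chart (n := n) x) y : TangentSpace (𝓡 n) y →L[ℝ] Vec n)

/-- The tangent vector at `y` with given coordinates in the chart at `x`. -/
def ofCoord (x y : M) : Vec n →L[ℝ] Vec n :=
  (mfderiv 𝓘(ℝ, Vec n) (𝓡 n) (chart (n := n) x).symm (chart (n := n) x y) : Vec n →L[ℝ] Vec n)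

lemma toCoord_ofCoord {x y : M} (hy : y ∈ (chart (n := n) x).source) (w : Vec n) :
    toCoord x y (ofCoord x y w) = w := by
  have := mfderiv_extChartAt_comp_mfderivWithin_extChartAt_symm' (I := 𝓡 n) hy
  simp only [modelWithCornersSelf_coe, range_id, mfderivWithin_univ] at this
  exact congrArg (fun f : Vec n →L[ℝ] Vec n => f w) this

lemma ofCoord_toCoord {x y : M} (hy : y ∈ (chart (n := n) x).source) (w : Vec n) :
    ofCoord x y (toCoord x y w) = w := by
  have := mfderivWithin_extChartAt_symm_comp_mfderiv_extChartAt' (I := 𝓡 n) hy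
  simp only [modelWithCornersSelf_coe, range_id, mfderivWithin_univ] at this
  exact congrArg (fun f : Vec n →L[ℝ] Vec n => f w) this

lemma toCoord_self (x : M) : toCoord (n := n) x x = ContinuousLinearMap.id ℝ _ :=
  mfderiv_extChartAt_self (I := 𝓡 n)

lemma ofCoord_self (x : M) : ofCoord (n := n) x x = ContinuousLinearMap.id ℝ _ := by
  have := mfderivWithin_range_extChartAt_symm (I := 𝓡 n) (x := x)
  simp only [modelWithCornersSelf_coe, range_id, mfderivWithin_univ] at this
  exact this

lemma coordVec_eq {x : M} {z : Vec n} (hz : z ∈ (chart (n := n) x).target) (w : Vec n) :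
    coordVec x z w = ofCoord x ((chart (n := n) x).symm z) w := by
  let D : Vec n → Vec n →L[ℝ] Vec n :=
    fun z' => mfderiv 𝓘(ℝ, Vec n) (𝓡 n) (chart (n := n) x).symm z'
  exact congrArg (fun z' => D z' w) ((chart (n := n) x).right_inv hz).symm

lemma fieldCoord_eq (x : M) (v : (y : M) → TangentSpace (𝓡 n) y) (z : Vec n) :
    fieldCoord x v z = toCoord x ((chart (n := n) x).symm z) (v ((chart (n := n) x).symm z)) := rfl

/-- The metric at `y`, as a bilinear form on `ℝⁿ`. -/
def metricAt (g : RMetric n M) (y : M) : Vec n →L[ℝ] Vec n →L[ℝ] ℝ := g.inner y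

lemma metricAt_symm (g : RMetric n M) (y : M) (u w : Vec n) :
    metricAt g y u w = metricAt g y w u := g.symm y u w

lemma metricAt_pos (g : RMetric n M) (y : M) {u : Vec n} (hu : u ≠ 0) :
    0 < metricAt g y u u := g.pos y u hu

/-- The metric in the chart at `x`, as a bilinear form on `ℝⁿ` depending on the coordinates. -/
def metricL (g : RMetric n M) (x : M) (z : Vec n) : Vec n →L[ℝ] Vec n →L[ℝ] ℝ :=
  (metricAt g ((chart (n := n) x).symm z)).bilinearComp
    (ofCoord x ((chart (n := n) x).symm z)) (ofCoord x ((chart (n := n) x).symm z))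

lemma metricCoord_eq (g : RMetric n M) {x : M} {z : Vec n} (hz : z ∈ (chart (n := n) x).target)
    (u w : Vec n) : metricCoord g x z u w = metricL g x z u w := by
  simp only [metricCoord, coordVec_eq hz]
  rfl

section Criteria

variable {EN : Type*} [NormedAddCommGroup EN] [NormedSpace ℝ EN] {HN : Type*}
  [TopologicalSpace HN] {IN : ModelWithCorners ℝ EN HN} {N : Type*} [TopologicalSpace N]
  [ChartedSpace HN N] {b : N → M} {q₀ : N}

/-- A family of linear maps on `ℝⁿ` is smooth as soon as its values on vectors are. -/
lemma contMDiffAt_clm {F : Type*} [NormedAddCommGroup F] [NormedSpace ℝ F]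
    {L : N → Vec n →L[ℝ] F} (h : ∀ w, ContMDiffAt IN 𝓘(ℝ, F) ∞ (fun q => L q w) q₀) :
    ContMDiffAt IN 𝓘(ℝ, Vec n →L[ℝ] F) ∞ L q₀ := by
  have : L = fun q => ∑ i : Fin n, (ContinuousLinearMap.smulRightL ℝ (Vec n) F
      (EuclideanSpace.proj i)) (L q (EuclideanSpace.single i 1)) := by
    funext q
    ext w
    have hw : w = ∑ i, w i • EuclideanSpace.single i (1 : ℝ) := by
      ext j; simp [Finset.sum_apply, Pi.single_apply]
    conv_lhs => rw [hw]
    simp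
  rw [this]
  refine ContMDiffAt.sum fun i _ => ?_
  exact (ContinuousLinearMap.smulRightL ℝ (Vec n) F
    (EuclideanSpace.proj i)).contMDiff.contMDiffAt.comp q₀ (h _)

/-- Smoothness of a vector field along a map, in coordinates. -/
lemma contMDiffAt_field_iff {V : N → Vec n} :
    ContMDiffAt IN (𝓡 n).tangent ∞ (fun q => (⟨b q, V q⟩ : TangentBundle (𝓡 n) M)) q₀ ↔
      ContMDiffAt IN (𝓡 n) ∞ b q₀ ∧
        ContMDiffAt IN 𝓘(ℝ, Vec n) ∞ (fun q => toCoord (b q₀) (b q) (V q)) q₀ := by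
  rw [ModelWithCorners.tangent, contMDiffAt_totalSpace]
  refine and_congr_right fun hb => Filter.EventuallyEq.contMDiffAt_iff ?_
  have : b ⁻¹' (chartAt (Vec n) (b q₀)).source ∈ 𝓝 q₀ :=
    hb.continuousAt.preimage_mem_nhds ((chartAt (Vec n) (b q₀)).open_source.mem_nhds
      (mem_chart_source _ _))
  filter_upwards [this] with q hq
  have h := TangentBundle.continuousLinearMapAt_trivializationAt (I := 𝓡 n) hq
  have h2 := congrArg (fun f : Vec n →L[ℝ] Vec n => f (V q)) h
  refine Eq.trans ?_ h2
  exact (Bundle.Trivialization.continuousLinearMapAt_apply_of_mem (R := ℝ)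
    (trivializationAt (Vec n) (TangentSpace (𝓡 n)) (b q₀)) hq (V q)).symm

/-- Smoothness of a covector field along a map, in coordinates. -/
lemma contMDiffAt_form_iff {α : N → Vec n →L[ℝ] ℝ} :
    ContMDiffAt IN ((𝓡 n).prod 𝓘(ℝ, Vec n →L[ℝ] ℝ)) ∞ (fun q => TotalSpace.mk' (Vec n →L[ℝ] ℝ)
      (E := fun x : M => TangentSpace (𝓡 n) x →L[ℝ] ℝ) (b q) (α q)) q₀ ↔
      ContMDiffAt IN (𝓡 n) ∞ b q₀ ∧
        ∀ w, ContMDiffAt IN 𝓘(ℝ, ℝ) ∞ (fun q => α q (ofCoord (b q₀) (b q) w)) q₀ := by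
  rw [contMDiffAt_hom_bundle]
  refine and_congr_right fun hb => ?_
  have : b ⁻¹' (chartAt (Vec n) (b q₀)).source ∈ 𝓝 q₀ :=
    hb.continuousAt.preimage_mem_nhds ((chartAt (Vec n) (b q₀)).open_source.mem_nhds
      (mem_chart_source _ _))
  have key : (fun q => ContinuousLinearMap.inCoordinates (Vec n) (TangentSpace (𝓡 n))
      ℝ (Bundle.Trivial M ℝ) (b q₀) (b q) (b q₀) (b q) (α q)) =ᶠ[𝓝 q₀]
      fun q => (α q).comp (ofCoord (b q₀) (b q)) := by
    filter_upwards [this] with q hq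
    have h := TangentBundle.symmL_trivializationAt (I := 𝓡 n) hq
    simp only [modelWithCornersSelf_coe, range_id, mfderivWithin_univ] at h
    ext w
    simp only [ContinuousLinearMap.inCoordinates]
    have h2 := congrArg (fun f : Vec n →L[ℝ] Vec n => α q (f w)) h
    refine Eq.trans ?_ h2
    simp
    rfl
  refine (Filter.EventuallyEq.contMDiffAt_iff key).trans ?_
  constructor
  · intro h w
    exact (ContinuousLinearMap.apply ℝ ℝ w).contMDiff.contMDiffAt.comp q₀ h
  · intro h
    exact contMDiffAt_clm h

lemma contMDiffAt_form_apply {α : N → Vec n →L[ℝ] ℝ} {V : N → Vec n}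
    (hα : ContMDiffAt IN ((𝓡 n).prod 𝓘(ℝ, Vec n →L[ℝ] ℝ)) ∞
      (fun q => TotalSpace.mk' (Vec n →L[ℝ] ℝ)
      (E := fun x : M => TangentSpace (𝓡 n) x →L[ℝ] ℝ) (b q) (α q)) q₀)
    (hV : ContMDiffAt IN (𝓡 n).tangent ∞ (fun q => (⟨b q, V q⟩ : TangentBundle (𝓡 n) M)) q₀) :
    ContMDiffAt IN 𝓘(ℝ, ℝ) ∞ (fun q => α q (V q)) q₀ := by
  have := ContMDiffAt.clm_bundle_apply (F₁ := Vec n) (F₂ := ℝ) (E₁ := TangentSpace (𝓡 n))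
    (E₂ := Bundle.Trivial M ℝ) hα hV
  rw [contMDiffAt_totalSpace] at this
  exact this.2

lemma contMDiffAt_flat (g : RMetric n M) {V : N → Vec n}
    (hV : ContMDiffAt IN (𝓡 n).tangent ∞ (fun q => (⟨b q, V q⟩ : TangentBundle (𝓡 n) M)) q₀) :
    ContMDiffAt IN ((𝓡 n).prod 𝓘(ℝ, Vec n →L[ℝ] ℝ)) ∞
      (fun q => TotalSpace.mk' (Vec n →L[ℝ] ℝ)
      (E := fun x : M => TangentSpace (𝓡 n) x →L[ℝ] ℝ) (b q) (metricAt g (b q) (V q))) q₀ := by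
  have hb := (contMDiffAt_field_iff.1 hV).1
  exact ContMDiffAt.clm_bundle_apply (F₁ := Vec n) (F₂ := Vec n →L[ℝ] ℝ)
    (E₁ := TangentSpace (𝓡 n)) (E₂ := fun x : M => TangentSpace (𝓡 n) x →L[ℝ] ℝ)
    ((g.contMDiff (b q₀)).comp q₀ hb) hV

lemma contMDiffAt_metric (g : RMetric n M) {V W : N → Vec n}
    (hV : ContMDiffAt IN (𝓡 n).tangent ∞ (fun q => (⟨b q, V q⟩ : TangentBundle (𝓡 n) M)) q₀)
    (hW : ContMDiffAt IN (𝓡 n).tangent ∞ (fun q => (⟨b q, W q⟩ : TangentBundle (𝓡 n) M)) q₀) :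
    ContMDiffAt IN 𝓘(ℝ, ℝ) ∞ (fun q => metricAt g (b q) (V q) (W q)) q₀ :=
  contMDiffAt_form_apply (contMDiffAt_flat g hV) hW

variable [IsManifold IN 1 N]

/-- The partial derivative, along a smooth vector field, of a smooth family of maps between manifolds
is a smooth vector field along the image. -/
lemma contMDiffAt_mfderiv_along {EA HA A EB HB B : Type*}
    [NormedAddCommGroup EA] [NormedSpace ℝ EA] [TopologicalSpace HA]
    {IA : ModelWithCorners ℝ EA HA} [TopologicalSpace A] [ChartedSpace HA A] [IsManifold IA 1 A]
    [NormedAddCommGroup EB] [NormedSpace ℝ EB] [TopologicalSpace HB]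
    {IB : ModelWithCorners ℝ EB HB} [TopologicalSpace B] [ChartedSpace HB B] [IsManifold IB 1 B]
    {f : N → A → B} {a : N → A} {V : (q : N) → TangentSpace IA (a q)}
    (hf : ContMDiffAt (IN.prod IA) IB ∞ (Function.uncurry f) (q₀, a q₀))
    (hV : ContMDiffAt IN IA.tangent ∞ (fun q => (⟨a q, V q⟩ : TangentBundle IA A)) q₀) :
    ContMDiffAt IN IB.tangent ∞
      (fun q => (⟨f q (a q), mfderiv IA IB (f q) (a q) (V q)⟩ : TangentBundle IB B)) q₀ := by
  have ha : ContMDiffAt IN IA ∞ a q₀ := (contMDiffAt_totalSpace.1 hV).1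
  exact ContMDiffAt.clm_apply_of_inCoordinates (hf.mfderiv f a ha (by simp)) hV
    (hf.comp q₀ (contMDiffAt_id.prodMk ha))

lemma contMDiffAt_tangent_vectorSpace {E : Type*} [NormedAddCommGroup E] [NormedSpace ℝ E]
    {a V : N → E} : ContMDiffAt IN 𝓘(ℝ, E).tangent ∞
      (fun q => (⟨a q, V q⟩ : TangentBundle 𝓘(ℝ, E) E)) q₀ ↔
      ContMDiffAt IN 𝓘(ℝ, E) ∞ a q₀ ∧ ContMDiffAt IN 𝓘(ℝ, E) ∞ V q₀ := by
  rw [ModelWithCorners.tangent, contMDiffAt_totalSpace]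
  simp

/-- The coordinate fields of the chart at `x` are smooth. -/
lemma contMDiffAt_frame {x : M} (hb : ContMDiffAt IN (𝓡 n) ∞ b q₀)
    (hx : b q₀ ∈ (chart (n := n) x).source) (w : Vec n) :
    ContMDiffAt IN (𝓡 n).tangent ∞
      (fun q => (⟨b q, ofCoord x (b q) w⟩ : TangentBundle (𝓡 n) M)) q₀ := by
  have h1 : ContMDiffAt 𝓘(ℝ, Vec n) (𝓡 n) ∞ (chart (n := n) x).symm (chart (n := n) x (b q₀)) :=
    (contMDiffOn_extChartAt_symm x).contMDiffAt
      (extChartAt_target_mem_nhds' ((chart (n := n) x).map_source hx))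
  have h2 : ContMDiffAt IN 𝓘(ℝ, Vec n) ∞ (fun q => chart (n := n) x (b q)) q₀ :=
    (contMDiffAt_extChartAt' (by rwa [extChartAt_source] at hx)).comp q₀ hb
  have h3 := contMDiffAt_mfderiv_along (IN := IN) (IB := 𝓡 n) (q₀ := q₀)
    (f := fun _ => (chart (n := n) x).symm)
    (a := fun q => chart (n := n) x (b q)) (V := fun _ => w)
    (ContMDiffAt.comp (q₀, chart (n := n) x (b q₀)) h1 contMDiffAt_snd)
    (contMDiffAt_tangent_vectorSpace.2 ⟨h2, contMDiffAt_const⟩)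
  refine h3.congr_of_eventuallyEq ?_
  have : b ⁻¹' (chart (n := n) x).source ∈ 𝓝 q₀ :=
    hb.continuousAt.preimage_mem_nhds ((isOpen_extChartAt_source x).mem_nhds hx)
  filter_upwards [this] with q hq
  have : ∀ y : M, y = b q → (⟨b q, ofCoord x (b q) w⟩ : TangentBundle (𝓡 n) M) =
      ⟨y, ofCoord x (b q) w⟩ := by rintro y rfl; rfl
  exact this _ ((chart (n := n) x).left_inv hq)

/-- Smoothness of a vector field along a map, in the coordinates of any chart. -/
lemma contMDiffAt_field_iff' {V : N → Vec n} {x : M} (hx : b q₀ ∈ (chart (n := n) x).source) :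
    ContMDiffAt IN (𝓡 n).tangent ∞ (fun q => (⟨b q, V q⟩ : TangentBundle (𝓡 n) M)) q₀ ↔
      ContMDiffAt IN (𝓡 n) ∞ b q₀ ∧
        ContMDiffAt IN 𝓘(ℝ, Vec n) ∞ (fun q => toCoord x (b q) (V q)) q₀ := by
  constructor
  · intro h
    have hb := (contMDiffAt_field_iff.1 h).1
    refine ⟨hb, ?_⟩
    have h2 := contMDiffAt_mfderiv_along (IN := IN) (IA := 𝓡 n) (q₀ := q₀)
      (f := fun _ => chart (n := n) x) (a := b) (V := V) (IB := 𝓘(ℝ, Vec n))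
      (ContMDiffAt.comp (q₀, b q₀)
        (contMDiffAt_extChartAt' (by rwa [extChartAt_source] at hx)) contMDiffAt_snd) h
    exact (contMDiffAt_tangent_vectorSpace.1 h2).2
  · rintro ⟨hb, h⟩
    refine contMDiffAt_field_iff.2 ⟨hb, ?_⟩
    have hT : ContMDiffAt IN 𝓘(ℝ, Vec n →L[ℝ] Vec n) ∞
        (fun q => (toCoord (b q₀) (b q)).comp (ofCoord x (b q))) q₀ :=
      contMDiffAt_clm fun w => (contMDiffAt_field_iff.1 (contMDiffAt_frame hb hx w)).2
    refine (hT.clm_apply h).congr_of_eventuallyEq ?_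
    have : b ⁻¹' (chart (n := n) x).source ∈ 𝓝 q₀ :=
      hb.continuousAt.preimage_mem_nhds ((isOpen_extChartAt_source x).mem_nhds hx)
    filter_upwards [this] with q hq
    simp [ofCoord_toCoord hq]

end Criteria

/-! ### The metric -/

lemma metricAt_injective (g : RMetric n M) (y : M) : Function.Injective (metricAt g y) := by
  intro u w h
  by_contra hne
  have := metricAt_pos g y (sub_ne_zero.2 hne)
  simp [h] at this

lemma metricAt_surjective (g : RMetric n M) (y : M) : Function.Surjective (metricAt g y) := by
  have h := LinearMap.injective_iff_surjective_of_finrank_eq_finrank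
    (f := (metricAt g y).toLinearMap) (by
      have := (LinearMap.toContinuousLinearMap (𝕜 := ℝ) (E := Vec n) (F' := ℝ)).finrank_eq
      rw [← this]
      exact (Subspace.dual_finrank_eq (K := ℝ) (V := Vec n)).symm)
  exact h.1 (metricAt_injective g y)

lemma metricAt_sharp (g : RMetric n M) (y : M) (α : Vec n →L[ℝ] ℝ) :
    metricAt g y (sharp g y α) = α :=
  Function.invFun_eq (f := metricAt g y) (metricAt_surjective g y α)

/-- `α^♯` as a map between model spaces. -/
def sharpV (g : RMetric n M) (y : M) (α : Vec n →L[ℝ] ℝ) : Vec n := sharp g y α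

lemma metricAt_sharpV (g : RMetric n M) (y : M) (α : Vec n →L[ℝ] ℝ) :
    metricAt g y (sharpV g y α) = α := metricAt_sharp g y α

lemma sharp_metricAt (g : RMetric n M) (y : M) (u : Vec n) : sharp g y (metricAt g y u) = u :=
  metricAt_injective g y (metricAt_sharp g y _)

lemma sharp_smul (g : RMetric n M) (y : M) (r : ℝ) (α : Vec n →L[ℝ] ℝ) :
    sharp g y (r • α) = r • sharp g y α := by
  refine metricAt_injective g y ?_
  have := metricAt_sharp g y α
  rw [metricAt_sharp]
  exact ((metricAt g y).map_smul r (sharp g y α)).trans (by rw [this]) |>.symm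

section

variable {EN : Type*} [NormedAddCommGroup EN] [NormedSpace ℝ EN] {HN : Type*}
  [TopologicalSpace HN] {IN : ModelWithCorners ℝ EN HN} {N : Type*} [TopologicalSpace N]
  [ChartedSpace HN N] [IsManifold IN 1 N] {b : N → M} {q₀ : N}

/-- The vector field dual to a smooth covector field is smooth. -/
lemma contMDiffAt_sharp (g : RMetric n M) {α : N → Vec n →L[ℝ] ℝ}
    (hα : ContMDiffAt IN ((𝓡 n).prod 𝓘(ℝ, Vec n →L[ℝ] ℝ)) ∞
      (fun q => TotalSpace.mk' (Vec n →L[ℝ] ℝ)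
      (E := fun x : M => TangentSpace (𝓡 n) x →L[ℝ] ℝ) (b q) (α q)) q₀) :
    ContMDiffAt IN (𝓡 n).tangent ∞
      (fun q => (⟨b q, sharp g (b q) (α q)⟩ : TangentBundle (𝓡 n) M)) q₀ := by
  have hb := (contMDiffAt_form_iff.1 hα).1
  refine contMDiffAt_field_iff.2 ⟨hb, ?_⟩
  have hx := mem_extChartAt_source (I := 𝓡 n) (b q₀)
  -- in coordinates, `α^♯` is the inverse of the matrix of the metric applied to `α`
  let B : N → Vec n →L[ℝ] Vec n →L[ℝ] ℝ := fun q =>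
    (metricAt g (b q)).bilinearComp (ofCoord (b q₀) (b q)) (ofCoord (b q₀) (b q))
  have hB : ContMDiffAt IN 𝓘(ℝ, Vec n →L[ℝ] Vec n →L[ℝ] ℝ) ∞ B q₀ :=
    contMDiffAt_clm fun u => contMDiffAt_clm fun w =>
      contMDiffAt_metric g (contMDiffAt_frame hb hx u) (contMDiffAt_frame hb hx w)
  have ha : ContMDiffAt IN 𝓘(ℝ, Vec n →L[ℝ] ℝ) ∞
      (fun q => (α q).comp (ofCoord (b q₀) (b q))) q₀ :=
    contMDiffAt_clm fun w => (contMDiffAt_form_iff.1 hα).2 w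
  have hinv : ∀ q, b q ∈ (chart (n := n) (b q₀)).source →
      ∃ e : Vec n ≃L[ℝ] (Vec n →L[ℝ] ℝ), (e : Vec n →L[ℝ] (Vec n →L[ℝ] ℝ)) = B q := by
    intro q hq
    have hinj : Function.Injective (B q) := by
      intro u w h
      by_contra hne
      have h1 : ofCoord (b q₀) (b q) (u - w) ≠ 0 := by
        intro h0
        have := toCoord_ofCoord hq (u - w)
        rw [h0, map_zero] at this
        exact hne (sub_eq_zero.1 this.symm)
      have h2 := metricAt_pos g (b q) h1
      have h3 : B q (u - w) (u - w) = 0 := by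
          rw [(B q).map_sub u w, h, sub_self]; rfl
      exact h2.ne' h3
    have hfin : Module.finrank ℝ (Vec n) = Module.finrank ℝ (Vec n →L[ℝ] ℝ) := by
      rw [← (LinearMap.toContinuousLinearMap (𝕜 := ℝ) (E := Vec n) (F' := ℝ)).finrank_eq]
      exact (Subspace.dual_finrank_eq (K := ℝ) (V := Vec n)).symm
    exact ⟨(LinearEquiv.ofInjectiveOfFinrankEq (B q).toLinearMap hinj hfin).toContinuousLinearEquiv,
      by ext; rfl⟩
  have hi : ContMDiffAt IN 𝓘(ℝ, (Vec n →L[ℝ] ℝ) →L[ℝ] Vec n) ∞ (fun q => (B q).inverse) q₀ := by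
    obtain ⟨e, he⟩ := hinv q₀ hx
    have := contDiffAt_map_inverse (𝕜 := ℝ) (n := ∞) e
    rw [he] at this
    exact this.contMDiffAt.comp q₀ hB
  refine (hi.clm_apply ha).congr_of_eventuallyEq ?_
  have : b ⁻¹' (chart (n := n) (b q₀)).source ∈ 𝓝 q₀ :=
    hb.continuousAt.preimage_mem_nhds ((isOpen_extChartAt_source (b q₀)).mem_nhds hx)
  filter_upwards [this] with q hq
  obtain ⟨e, he⟩ := hinv q hq
  rw [← he, ContinuousLinearMap.inverse_equiv]
  symm
  refine (e.symm_apply_eq (y := toCoord (b q₀) (b q) (sharpV g (b q) (α q)))).2 ?_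
  ext w
  have h4 : e (toCoord (b q₀) (b q) (sharpV g (b q) (α q))) =
    B q (toCoord (b q₀) (b q) (sharpV g (b q) (α q))) := by rw [← he]; rfl
  rw [h4]
  simp only [B, ContinuousLinearMap.bilinearComp_apply]
  rw [ofCoord_toCoord hq, metricAt_sharpV]
  rfl

end

/-! ### Smooth families -/

section Families

variable {P : Type*} [NormedAddCommGroup P] [NormedSpace ℝ P] {S : Set P}

lemma smoothFunOn_iff (hS : IsOpen S) {f : P → M → ℝ} :
    SmoothFunOn n S f ↔ ∀ p ∈ S, ∀ x : M, ContMDiffAt (𝓘(ℝ, P).prod (𝓡 n)) 𝓘(ℝ, ℝ) ∞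
      (fun q : P × M => f q.1 q.2) (p, x) :=
  ⟨fun h p hp x => h.contMDiffAt ((hS.prod isOpen_univ).mem_nhds ⟨hp, mem_univ x⟩),
    fun h q hq => (h q.1 hq.1 q.2).contMDiffWithinAt⟩

lemma smoothFieldOn_iff (hS : IsOpen S) {v : P → (x : M) → TangentSpace (𝓡 n) x} :
    SmoothFieldOn S v ↔ ∀ p ∈ S, ∀ x : M, ContMDiffAt (𝓘(ℝ, P).prod (𝓡 n)) (𝓡 n).tangent ∞
      (fun q : P × M => (⟨q.2, v q.1 q.2⟩ : TangentBundle (𝓡 n) M)) (p, x) :=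
  ⟨fun h p hp x => h.contMDiffAt ((hS.prod isOpen_univ).mem_nhds ⟨hp, mem_univ x⟩),
    fun h q hq => (h q.1 hq.1 q.2).contMDiffWithinAt⟩

lemma smoothFormOn_iff (hS : IsOpen S) {α : P → Covec n M} :
    SmoothFormOn S α ↔ ∀ p ∈ S, ∀ x : M,
      ContMDiffAt (𝓘(ℝ, P).prod (𝓡 n)) ((𝓡 n).prod 𝓘(ℝ, Vec n →L[ℝ] ℝ)) ∞
      (fun q : P × M => TotalSpace.mk' (Vec n →L[ℝ] ℝ)
        (E := fun x : M => TangentSpace (𝓡 n) x →L[ℝ] ℝ) q.2 (α q.1 q.2)) (p, x) :=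
  ⟨fun h p hp x => h.contMDiffAt ((hS.prod isOpen_univ).mem_nhds ⟨hp, mem_univ x⟩),
    fun h q hq => (h q.1 hq.1 q.2).contMDiffWithinAt⟩

lemma smoothDiffOn_iff (hS : IsOpen S) {φ : P → Diff n M} :
    SmoothDiffOn S φ ↔ ∀ p ∈ S, ∀ x : M, ContMDiffAt (𝓘(ℝ, P).prod (𝓡 n)) (𝓡 n) ∞
      (fun q : P × M => φ q.1 q.2) (p, x) ∧ ContMDiffAt (𝓘(ℝ, P).prod (𝓡 n)) (𝓡 n) ∞
      (fun q : P × M => (φ q.1).symm q.2) (p, x) :=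
  ⟨fun h p hp x => ⟨h.1.contMDiffAt ((hS.prod isOpen_univ).mem_nhds ⟨hp, mem_univ x⟩),
    h.2.contMDiffAt ((hS.prod isOpen_univ).mem_nhds ⟨hp, mem_univ x⟩)⟩,
    fun h => ⟨fun q hq => (h q.1 hq.1 q.2).1.contMDiffWithinAt,
      fun q hq => (h q.1 hq.1 q.2).2.contMDiffWithinAt⟩⟩

lemma smoothFunOn_const (S : Set P) (f : SFun n M) : SmoothFunOn n S (fun _ : P => (f : M → ℝ)) :=
  (f.contMDiff.comp contMDiff_snd).contMDiffOn

lemma smoothFieldOn_const (S : Set P) (v : VField n M) : SmoothFieldOn S (fun _ : P => v) :=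
  (v.contMDiff.comp contMDiff_snd).contMDiffOn

lemma SmoothFunOn.continuousOn {f : P → M → ℝ} (h : SmoothFunOn n S f) :
    ContinuousOn (Function.uncurry f) (S ×ˢ univ) := ContMDiffOn.continuousOn h

/-- Reparametrization of families. -/
lemma SmoothFunOn.comp {Q : Type*} [NormedAddCommGroup Q] [NormedSpace ℝ Q] {T : Set Q}
    {f : P → M → ℝ} (h : SmoothFunOn n S f) {k : Q → P} (hk : ContDiff ℝ ∞ k)
    (hm : MapsTo k T S) : SmoothFunOn n T (fun q => f (k q)) := by
  have hk' : ContMDiff (𝓘(ℝ, Q).prod (𝓡 n)) (𝓘(ℝ, P).prod (𝓡 n)) ∞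
      (fun q : Q × M => (k q.1, q.2)) := (hk.contMDiff.comp contMDiff_fst).prodMk contMDiff_snd
  exact ContMDiffOn.comp (f := fun q : Q × M => (k q.1, q.2)) h hk'.contMDiffOn
    fun q hq => ⟨hm hq.1, hq.2⟩

lemma SmoothFormOn.comp {Q : Type*} [NormedAddCommGroup Q] [NormedSpace ℝ Q] {T : Set Q}
    {f : P → Covec n M} (h : SmoothFormOn S f) {k : Q → P}
    (hk : ContDiff ℝ ∞ k) (hm : MapsTo k T S) : SmoothFormOn T (fun q => f (k q)) := by
  have hk' : ContMDiff (𝓘(ℝ, Q).prod (𝓡 n)) (𝓘(ℝ, P).prod (𝓡 n)) ∞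
      (fun q : Q × M => (k q.1, q.2)) := (hk.contMDiff.comp contMDiff_fst).prodMk contMDiff_snd
  exact ContMDiffOn.comp (f := fun q : Q × M => (k q.1, q.2)) h hk'.contMDiffOn
    fun q hq => ⟨hm hq.1, hq.2⟩

lemma SmoothDiffOn.comp {Q : Type*} [NormedAddCommGroup Q] [NormedSpace ℝ Q] {T : Set Q}
    {f : P → Diff n M} (h : SmoothDiffOn S f) {k : Q → P}
    (hk : ContDiff ℝ ∞ k) (hm : MapsTo k T S) : SmoothDiffOn T (fun q => f (k q)) := by
  have hk' : ContMDiff (𝓘(ℝ, Q).prod (𝓡 n)) (𝓘(ℝ, P).prod (𝓡 n)) ∞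
      (fun q : Q × M => (k q.1, q.2)) := (hk.contMDiff.comp contMDiff_fst).prodMk contMDiff_snd
  exact ⟨ContMDiffOn.comp (f := fun q : Q × M => (k q.1, q.2)) h.1 hk'.contMDiffOn
      fun q hq => ⟨hm hq.1, hq.2⟩,
    ContMDiffOn.comp (f := fun q : Q × M => (k q.1, q.2)) h.2 hk'.contMDiffOn
      fun q hq => ⟨hm hq.1, hq.2⟩⟩

lemma SmoothFunOn.sfun {f : P → M → ℝ} (h : SmoothFunOn n S f) {p : P} (hp : p ∈ S) :
    ContMDiff (𝓡 n) 𝓘(ℝ, ℝ) ∞ (f p) := by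
  have h1 : ContMDiff (𝓡 n) (𝓘(ℝ, P).prod (𝓡 n)) ∞ (fun x : M => (p, x)) :=
    contMDiff_const.prodMk contMDiff_id
  exact contMDiffOn_univ.1
    (ContMDiffOn.comp (f := fun x : M => (p, x)) h h1.contMDiffOn fun x _ => ⟨hp, mem_univ x⟩)

lemma SmoothFieldOn.vfield {v : P → (x : M) → TangentSpace (𝓡 n) x} (h : SmoothFieldOn S v)
    {p : P} (hp : p ∈ S) :
    ContMDiff (𝓡 n) (𝓡 n).tangent ∞ (fun x => (⟨x, v p x⟩ : TangentBundle (𝓡 n) M)) := by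
  have h1 : ContMDiff (𝓡 n) (𝓘(ℝ, P).prod (𝓡 n)) ∞ (fun x : M => (p, x)) :=
    contMDiff_const.prodMk contMDiff_id
  exact contMDiffOn_univ.1
    (ContMDiffOn.comp (f := fun x : M => (p, x)) h h1.contMDiffOn fun x _ => ⟨hp, mem_univ x⟩)

lemma SmoothFunOn.add {f₁ f₂ : P → M → ℝ} (h₁ : SmoothFunOn n S f₁) (h₂ : SmoothFunOn n S f₂) :
    SmoothFunOn n S (fun p x => f₁ p x + f₂ p x) := ContMDiffOn.add h₁ h₂

lemma SmoothFunOn.sub {f₁ f₂ : P → M → ℝ} (h₁ : SmoothFunOn n S f₁) (h₂ : SmoothFunOn n S f₂) :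
    SmoothFunOn n S (fun p x => f₁ p x - f₂ p x) := ContMDiffOn.sub h₁ h₂

lemma SmoothFunOn.mul {f₁ f₂ : P → M → ℝ} (h₁ : SmoothFunOn n S f₁) (h₂ : SmoothFunOn n S f₂) :
    SmoothFunOn n S (fun p x => f₁ p x * f₂ p x) := ContMDiffOn.mul h₁ h₂

/-- The function `F(f₁, f₂)` of two smooth families is a smooth family. -/
lemma SmoothFunOn.comp₂ (hS : IsOpen S) {f₁ f₂ : P → M → ℝ} (h₁ : SmoothFunOn n S f₁)
    (h₂ : SmoothFunOn n S f₂) {F : ℝ × ℝ → ℝ} {U : Set (ℝ × ℝ)} (hU : IsOpen U)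
    (hF : ContDiffOn ℝ ∞ F U) (hm : ∀ p ∈ S, ∀ x, (f₁ p x, f₂ p x) ∈ U) :
    SmoothFunOn n S (fun p x => F (f₁ p x, f₂ p x)) := by
  rw [smoothFunOn_iff hS] at *
  intro p hp x
  have h3 : ContDiffAt ℝ ∞ F (f₁ p x, f₂ p x) := hF.contDiffAt (hU.mem_nhds (hm p hp x))
  exact ContMDiffAt.comp (p, x) (g := F)
    (f := fun q : P × M => (f₁ q.1 q.2, f₂ q.1 q.2)) h3.contMDiffAt
    ((h₁ p hp x).prodMk_space (h₂ p hp x))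

lemma SmoothFunOn.inv (hS : IsOpen S) {f : P → M → ℝ} (h : SmoothFunOn n S f)
    (h0 : ∀ p ∈ S, ∀ x, f p x ≠ 0) : SmoothFunOn n S (fun p x => (f p x)⁻¹) :=
  h.comp₂ hS h (F := fun r => r.1⁻¹) (U := {r | r.1 ≠ 0})
    (isOpen_ne_fun continuous_fst continuous_const)
    (fun _ hr => (contDiffAt_fst.inv hr).contDiffWithinAt) h0

lemma SmoothFunOn.comp_diff {f : P → M → ℝ} (h : SmoothFunOn n S f)
    {b : P → M → M} (hb : ContMDiffOn (𝓘(ℝ, P).prod (𝓡 n)) (𝓡 n) ∞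
      (fun q : P × M => b q.1 q.2) (S ×ˢ univ)) : SmoothFunOn n S (fun p x => f p (b p x)) :=
  ContMDiffOn.comp (g := fun q : P × M => f q.1 q.2) (f := fun q : P × M => (q.1, b q.1 q.2)) h
    (contMDiffOn_fst.prodMk hb) fun q hq => ⟨hq.1, mem_univ _⟩

/-- The derivative of a smooth family of functions in the parameter is a smooth family. -/
lemma SmoothFunOn.fderiv (hS : IsOpen S) {f : P → M → ℝ} (h : SmoothFunOn n S f) (v : P) :
    SmoothFunOn n S (fun p x => fderiv ℝ (fun p' => f p' x) p v) := by
  rw [smoothFunOn_iff hS] at *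
  intro p hp x
  have h1 : ContMDiffAt ((𝓘(ℝ, P).prod (𝓡 n)).prod 𝓘(ℝ, P)) 𝓘(ℝ, ℝ) ∞
      (Function.uncurry fun (q : P × M) (p' : P) => f p' q.2) ((p, x), p) :=
    ContMDiffAt.comp (g := fun q : P × M => f q.1 q.2) (f := fun q : (P × M) × P => (q.2, q.1.2))
      ((p, x), p) (h p hp x)
      (contMDiffAt_snd.prodMk (contMDiffAt_snd.comp _ contMDiffAt_fst))
  have h2 := contMDiffAt_mfderiv_along (IN := 𝓘(ℝ, P).prod (𝓡 n)) (IA := 𝓘(ℝ, P))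
    (IB := 𝓘(ℝ, ℝ)) (q₀ := (p, x)) (f := fun (q : P × M) (p' : P) => f p' q.2)
    (a := fun q : P × M => q.1) (V := fun _ => v) h1
    (contMDiffAt_tangent_vectorSpace.2 ⟨contMDiffAt_fst, contMDiffAt_const⟩)
  have h3 := (contMDiffAt_tangent_vectorSpace.1 h2).2
  simp only [mfderiv_eq_fderiv] at h3
  exact h3

lemma SmoothFunOn.contDiffAt (hS : IsOpen S) {f : P → M → ℝ} (h : SmoothFunOn n S f)
    {p : P} (hp : p ∈ S) (x : M) : ContDiffAt ℝ ∞ (fun p' => f p' x) p :=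
  (ContMDiffAt.comp (g := fun q : P × M => f q.1 q.2) (f := fun p' : P => (p', x))
    p ((smoothFunOn_iff hS).1 h p hp x) (contMDiffAt_id.prodMk contMDiffAt_const)).contDiffAt

lemma SmoothFunOn.deriv {J : Set ℝ} (hJ : IsOpen J) {f : ℝ → M → ℝ} (h : SmoothFunOn n J f) :
    SmoothFunOn n J (fun t x => deriv (fun s => f s x) t) :=
  h.fderiv hJ 1

lemma SmoothFunOn.hasDerivAt {J : Set ℝ} (hJ : IsOpen J) {f : ℝ → M → ℝ} (h : SmoothFunOn n J f)
    {t : ℝ} (ht : t ∈ J) (x : M) :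
    HasDerivAt (fun s => f s x) (_root_.deriv (fun s => f s x) t) t :=
  ((h.contDiffAt hJ ht x).differentiableAt (by simp)).hasDerivAt

lemma SmoothFieldOn.metric (hS : IsOpen S) (g : RMetric n M)
    {v w : P → (x : M) → TangentSpace (𝓡 n) x}
    (hv : SmoothFieldOn S v) (hw : SmoothFieldOn S w) :
    SmoothFunOn n S (fun p x => g.inner x (v p x) (w p x)) := by
  rw [smoothFunOn_iff hS]
  rw [smoothFieldOn_iff hS] at *
  exact fun p hp x => contMDiffAt_metric g (hv p hp x) (hw p hp x)

lemma SmoothFormOn.apply (hS : IsOpen S) {α : P → Covec n M}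
    {v : P → (x : M) → TangentSpace (𝓡 n) x} (hα : SmoothFormOn S α) (hv : SmoothFieldOn S v) :
    SmoothFunOn n S (fun p x => α p x (v p x)) := by
  rw [smoothFunOn_iff hS]
  rw [smoothFieldOn_iff hS] at *
  rw [smoothFormOn_iff hS] at *
  exact fun p hp x => contMDiffAt_form_apply (hα p hp x) (hv p hp x)

lemma SmoothFormOn.sharp (hS : IsOpen S) (g : RMetric n M) {α : P → Covec n M}
    (hα : SmoothFormOn S α) : SmoothFieldOn S (fun p x => sharp g x (α p x)) := by
  rw [smoothFieldOn_iff hS]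
  rw [smoothFormOn_iff hS] at *
  exact fun p hp x => contMDiffAt_sharp g (hα p hp x)

lemma SmoothFieldOn.flat (hS : IsOpen S) (g : RMetric n M)
    {v : P → (x : M) → TangentSpace (𝓡 n) x} (hv : SmoothFieldOn S v) :
    SmoothFormOn S (fun p x => g.inner x (v p x)) := by
  rw [smoothFormOn_iff hS]
  rw [smoothFieldOn_iff hS] at *
  exact fun p hp x => contMDiffAt_flat g (hv p hp x)

lemma SmoothFieldOn.smul (hS : IsOpen S) {f : P → M → ℝ} (hf : SmoothFunOn n S f)
    {v : P → (x : M) → TangentSpace (𝓡 n) x} (hv : SmoothFieldOn S v) :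
    SmoothFieldOn S (fun p x => f p x • v p x) := by
  rw [smoothFunOn_iff hS] at *
  rw [smoothFieldOn_iff hS] at *
  intro p hp x
  refine contMDiffAt_field_iff.2 ⟨contMDiffAt_snd, ?_⟩
  refine ((hf p hp x).smul (contMDiffAt_field_iff.1 (hv p hp x)).2).congr_of_eventuallyEq
    (Filter.Eventually.of_forall fun q => ?_)
  exact (toCoord x q.2).map_smul (f q.1 q.2) (v q.1 q.2)

lemma SmoothFormOn.smul (hS : IsOpen S) {f : P → M → ℝ} (hf : SmoothFunOn n S f)
    {α : P → Covec n M} (hα : SmoothFormOn S α) :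
    SmoothFormOn S (fun p x => f p x • α p x) := by
  rw [smoothFunOn_iff hS] at *
  rw [smoothFormOn_iff hS] at *
  intro p hp x
  exact contMDiffAt_form_iff.2 ⟨contMDiffAt_snd, fun w =>
    (hf p hp x).smul ((contMDiffAt_form_iff.1 (hα p hp x)).2 w)⟩

lemma SmoothFormOn.add (hS : IsOpen S) {α β : P → Covec n M} (hα : SmoothFormOn S α)
    (hβ : SmoothFormOn S β) : SmoothFormOn S (fun p x => α p x + β p x) := by
  rw [smoothFormOn_iff hS] at *
  intro p hp x
  exact contMDiffAt_form_iff.2 ⟨contMDiffAt_snd, fun w =>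
    ((contMDiffAt_form_iff.1 (hα p hp x)).2 w).add ((contMDiffAt_form_iff.1 (hβ p hp x)).2 w)⟩

end Families

/-- The differential of a smooth function is a smooth covector field. -/
lemma smoothForm_mfderiv (f : SFun n M) :
    SmoothForm (fun x => mfderiv (𝓡 n) 𝓘(ℝ, ℝ) f x : Covec n M) := by
  refine (smoothFormOn_iff isOpen_univ).2 fun p _ x => ?_
  refine contMDiffAt_form_iff.2 ⟨contMDiffAt_snd, fun w => ?_⟩
  have h := contMDiffAt_mfderiv_along (IN := 𝓘(ℝ, ℝ).prod (𝓡 n)) (IA := 𝓡 n) (IB := 𝓘(ℝ, ℝ))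
    (q₀ := (p, x)) (f := fun (_ : ℝ × M) => (f : M → ℝ)) (a := fun q => q.2)
    (V := fun q => ofCoord x q.2 w)
    (f.contMDiff.contMDiffAt.comp ((p, x), x) contMDiffAt_snd)
    (contMDiffAt_frame (b := fun q : ℝ × M => q.2) contMDiffAt_snd
      (mem_extChartAt_source (I := 𝓡 n) x) w)
  exact (contMDiffAt_tangent_vectorSpace.1 h).2

/-- The smooth vector field dual to a smooth covector field. -/
def SmoothForm.sharpField (g : RMetric n M) {α : Covec n M} (h : SmoothForm α) : VField n M :=
  ⟨fun x => sharp g x (α x), (SmoothFormOn.sharp isOpen_univ g h).vfield (mem_univ (0 : ℝ))⟩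

/-! ### The Riemannian density and the Jacobian -/

/-- The standard basis of `ℝⁿ`. -/
def stdBasis (n : ℕ) : Module.Basis (Fin n) ℝ (Vec n) := (EuclideanSpace.basisFun (Fin n) ℝ).toBasis

lemma stdBasis_apply (i : Fin n) : stdBasis n i = EuclideanSpace.single i (1 : ℝ) := by
  simp [stdBasis]

/-- A continuous bilinear form on `ℝⁿ` as an algebraic bilinear form. -/
def toBilin (B : Vec n →L[ℝ] Vec n →L[ℝ] ℝ) : LinearMap.BilinForm ℝ (Vec n) :=
  LinearMap.mk₂ ℝ (fun u w => B u w) (by simp) (by simp) (by simp) (by simp)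

/-- The matrix of the coefficients of a bilinear form. -/
def gramMatrix (B : Vec n →L[ℝ] Vec n →L[ℝ] ℝ) : Matrix (Fin n) (Fin n) ℝ :=
  Matrix.of fun i j => B (EuclideanSpace.single i 1) (EuclideanSpace.single j 1)

lemma gramMatrix_eq (B : Vec n →L[ℝ] Vec n →L[ℝ] ℝ) :
    gramMatrix B = LinearMap.BilinForm.toMatrix (stdBasis n) (toBilin B) := by
  ext i j
  simp [gramMatrix, LinearMap.BilinForm.toMatrix_apply, stdBasis_apply, toBilin]

lemma det_gramMatrix_comp (B : Vec n →L[ℝ] Vec n →L[ℝ] ℝ) (A : Vec n →L[ℝ] Vec n) :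
    (gramMatrix (B.bilinearComp A A)).det = A.det ^ 2 * (gramMatrix B).det := by
  have h : toBilin (B.bilinearComp A A) = (toBilin B).comp A.toLinearMap A.toLinearMap := by
    ext u w; rfl
  rw [gramMatrix_eq, gramMatrix_eq, h,
    LinearMap.BilinForm.toMatrix_comp (stdBasis n) (stdBasis n), Matrix.det_mul, Matrix.det_mul,
    Matrix.det_transpose, LinearMap.det_toMatrix]
  simp only [ContinuousLinearMap.det]
  ring

lemma det_gramMatrix_pos {B : Vec n →L[ℝ] Vec n →L[ℝ] ℝ} (hs : ∀ u w, B u w = B w u)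
    (hp : ∀ u, u ≠ 0 → 0 < B u u) : 0 < (gramMatrix B).det := by
  refine Matrix.PosDef.det_pos ?_
  refine Matrix.PosDef.of_dotProduct_mulVec_pos (by ext i j; simp [gramMatrix, hs]) fun x hx => ?_
  have h1 := hp (WithLp.toLp 2 x) (by simpa using hx)
  have hw : WithLp.toLp 2 x = ∑ i, x i • EuclideanSpace.single i (1 : ℝ) := by
    ext j; simp [Finset.sum_apply, Pi.single_apply]
  rw [hw] at h1
  simp only [map_sum, map_smul, sum_apply, smul_eq_mul, smul_apply, Finset.mul_sum] at h1
  rw [Finset.sum_comm] at h1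
  simpa [Matrix.mulVec, dotProduct, gramMatrix, Finset.mul_sum, mul_comm, mul_left_comm] using h1

lemma volDensity_eq_gram (g : RMetric n M) {x : M} {z : Vec n}
    (hz : z ∈ (chart (n := n) x).target) :
    volDensity g x z = √(gramMatrix (metricL g x z)).det := by
  simp only [volDensity, metricCoord_eq g hz, gramMatrix]

lemma volDensityAt_eq_gram (g : RMetric n M) (y : M) :
    volDensityAt g y = √(gramMatrix (metricAt g y)).det := by
  rw [volDensityAt, volDensity_eq_gram g (mem_extChartAt_target y)]
  simp [metricL, ofCoord_self, ContinuousLinearMap.bilinearComp]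

lemma volDensityAt_pos (g : RMetric n M) (y : M) : 0 < volDensityAt g y := by
  rw [volDensityAt_eq_gram]
  exact Real.sqrt_pos.2 (det_gramMatrix_pos (metricAt_symm g y) fun u hu => metricAt_pos g y hu)

lemma volDensity_eq (g : RMetric n M) {x y : M} (hy : y ∈ (chart (n := n) x).source) :
    volDensity g x (chart (n := n) x y) = |(ofCoord (n := n) x y).det| * volDensityAt g y := by
  rw [volDensity_eq_gram g ((chart (n := n) x).map_source hy), metricL,
    (chart (n := n) x).left_inv hy, det_gramMatrix_comp, Real.sqrt_mul (sq_nonneg _),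
    Real.sqrt_sq_eq_abs, volDensityAt_eq_gram]

lemma det_toCoord_mul_det_ofCoord {x y : M} (hy : y ∈ (chart (n := n) x).source) :
    (toCoord (n := n) x y).det * (ofCoord (n := n) x y).det = 1 := by
  have h : (toCoord (n := n) x y).toLinearMap ∘ₗ (ofCoord (n := n) x y).toLinearMap =
      LinearMap.id := by
    ext1 w; exact toCoord_ofCoord hy w
  have := congrArg LinearMap.det h
  rwa [LinearMap.det_comp, LinearMap.det_id] at this

lemma volDensity_pos (g : RMetric n M) {x : M} {z : Vec n}
    (hz : z ∈ (chart (n := n) x).target) : 0 < volDensity g x z := by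
  have hy := (chart (n := n) x).map_target hz
  rw [← (chart (n := n) x).right_inv hz, volDensity_eq g hy]
  refine mul_pos (abs_pos.2 fun h => ?_) (volDensityAt_pos g _)
  have := det_toCoord_mul_det_ofCoord hy
  rw [h, mul_zero] at this
  exact zero_ne_one this

lemma contDiffOn_metricL (g : RMetric n M) (x : M) :
    ContDiffOn ℝ ∞ (metricL g x) (chart (n := n) x).target := by
  intro z hz
  have hz' := extChartAt_target_mem_nhds' (I := 𝓡 n) hz
  have hb : ContMDiffAt 𝓘(ℝ, Vec n) (𝓡 n) ∞ (chart (n := n) x).symm z :=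
    (contMDiffOn_extChartAt_symm x).contMDiffAt hz'
  have h : ∀ w, _ := fun w => contMDiffAt_frame hb ((chart (n := n) x).map_target hz) w
  have h2 : ContMDiffAt 𝓘(ℝ, Vec n) 𝓘(ℝ, Vec n →L[ℝ] Vec n →L[ℝ] ℝ) ∞ (metricL g x) z :=
    contMDiffAt_clm fun u => contMDiffAt_clm fun w => contMDiffAt_metric g (h u) (h w)
  exact h2.contDiffAt.contDiffWithinAt

lemma contDiffOn_volDensity (g : RMetric n M) (x : M) :
    ContDiffOn ℝ ∞ (volDensity g x) (chart (n := n) x).target := by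
  have h1 : ContDiffOn ℝ ∞ (fun z => (gramMatrix (metricL g x z)).det) (chart (n := n) x).target := by
    simp only [Matrix.det_apply]
    refine ContDiffOn.sum fun σ _ => ContDiffOn.const_smul _ (contDiffOn_prod fun i _ => ?_)
    exact ((contDiffOn_metricL g x).clm_apply contDiffOn_const).clm_apply contDiffOn_const
  refine (h1.sqrt fun z hz => ?_).congr fun z hz => volDensity_eq_gram g hz
  intro h0
  have := volDensity_pos g hz
  rw [volDensity_eq_gram g hz, h0, Real.sqrt_zero] at this
  exact lt_irrefl _ this

/-- The representation of a map in the charts at `x` and `x'`. -/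
def chartRep (φ : M → M) (x x' : M) (z : Vec n) : Vec n :=
  chart (n := n) x' (φ ((chart (n := n) x).symm z))

/-- The derivative of `φ` at `y`, as a continuous linear map of `ℝⁿ`. -/
def derivL (φ : Diff n M) (y : M) : Vec n →L[ℝ] Vec n :=
  (mfderiv (𝓡 n) (𝓡 n) φ y : TangentSpace (𝓡 n) y →L[ℝ] TangentSpace (𝓡 n) (φ y))

lemma Jac_eq (g : RMetric n M) (φ : Diff n M) (y : M) :
    Jac g φ y = |(derivL φ y).det| * volDensityAt g (φ y) / volDensityAt g y := rfl

lemma hasFDerivAt_chartRep (φ : Diff n M) {x x' y : M} (hy : y ∈ (chart (n := n) x).source)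
    (hy' : φ y ∈ (chart (n := n) x').source) :
    HasFDerivAt (chartRep φ x x') ((toCoord x' (φ y)).comp ((derivL φ y).comp (ofCoord x y)))
      (chart (n := n) x y) := by
  have h1 : HasMFDerivAt 𝓘(ℝ, Vec n) (𝓡 n) (chart (n := n) x).symm (chart (n := n) x y)
      (mfderiv 𝓘(ℝ, Vec n) (𝓡 n) (chart (n := n) x).symm (chart (n := n) x y)) := by
    refine MDifferentiableAt.hasMFDerivAt ?_
    exact ((contMDiffOn_extChartAt_symm (n := ∞) x).contMDiffAt
      (extChartAt_target_mem_nhds' ((chart (n := n) x).map_source hy))).mdifferentiableAt (by simp)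
  have e := (chart (n := n) x).left_inv hy
  have h2 : HasMFDerivAt (𝓡 n) (𝓡 n) φ y (mfderiv (𝓡 n) (𝓡 n) φ y) :=
    (φ.contMDiff.mdifferentiable (by simp) y).hasMFDerivAt
  have h3 : HasMFDerivAt (𝓡 n) 𝓘(ℝ, Vec n) (chart (n := n) x') (φ y)
      (mfderiv (𝓡 n) 𝓘(ℝ, Vec n) (chart (n := n) x') (φ y)) := by
    refine (mdifferentiableAt_extChartAt ?_).hasMFDerivAt
    rwa [extChartAt_source] at hy'
  have h4 : ∀ y', y' = y → HasMFDerivAt (𝓡 n) 𝓘(ℝ, Vec n) (chart (n := n) x' ∘ φ) y'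
      ((toCoord x' (φ y)).comp (derivL φ y) : Vec n →L[ℝ] Vec n) := by
    rintro _ rfl; exact h3.comp _ h2
  exact ((h4 _ e).comp _ h1).hasFDerivAt

/-- The transformation law of the Riemannian density under a diffeomorphism, in charts. -/
lemma Jac_mul_volDensity (g : RMetric n M) (φ : Diff n M) {x x' y : M}
    (hy : y ∈ (chart (n := n) x).source) (hy' : φ y ∈ (chart (n := n) x').source) :
    Jac g φ y * volDensity g x (chart (n := n) x y) =
      |((toCoord x' (φ y)).comp ((derivL φ y).comp (ofCoord x y))).det| *
        volDensity g x' (chart (n := n) x' (φ y)) := by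
  rw [volDensity_eq g hy, volDensity_eq g hy', Jac_eq]
  have h1 : ((toCoord x' (φ y)).comp ((derivL φ y).comp (ofCoord x y))).det =
      (toCoord (n := n) x' (φ y)).det * ((derivL φ y).det * (ofCoord (n := n) x y).det) := by
    simp only [ContinuousLinearMap.det, ContinuousLinearMap.toLinearMap_comp, LinearMap.det_comp]
  have h2 := det_toCoord_mul_det_ofCoord hy'
  have h3 : |(toCoord (n := n) x' (φ y)).det| * |(ofCoord (n := n) x' (φ y)).det| = 1 := by
    rw [← abs_mul, h2, abs_one]
  rw [h1, abs_mul, abs_mul]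
  have h4 := (volDensityAt_pos g y).ne'
  field_simp
  linear_combination (-|(derivL φ y).det| * |(ofCoord (n := n) x y).det|  * volDensityAt g (φ y)) * h3

lemma derivL_refl (y : M) : derivL (Diffeomorph.refl (𝓡 n) M ∞) y = ContinuousLinearMap.id ℝ _ :=
  mfderiv_id

lemma derivL_trans (η φ : Diff n M) (y : M) :
    derivL (η.trans φ) y = (derivL φ (η y)).comp (derivL η y) :=
  mfderiv_comp (I' := 𝓡 n) y (φ.contMDiff.mdifferentiable (by simp) (η y))
    (η.contMDiff.mdifferentiable (by simp) y)

lemma Jac_refl (g : RMetric n M) (y : M) : Jac g (Diffeomorph.refl (𝓡 n) M ∞) y = 1 := by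
  rw [Jac_eq, derivL_refl]
  have := (volDensityAt_pos g y).ne'
  simp [ContinuousLinearMap.det, this]

lemma Jac_trans (g : RMetric n M) (η φ : Diff n M) (y : M) :
    Jac g (η.trans φ) y = Jac g φ (η y) * Jac g η y := by
  rw [Jac_eq, Jac_eq, Jac_eq, derivL_trans]
  have h : ((derivL φ (η y)).comp (derivL η y)).det = (derivL φ (η y)).det * (derivL η y).det := by
    simp only [ContinuousLinearMap.det, ContinuousLinearMap.toLinearMap_comp, LinearMap.det_comp]
  have h1 := (volDensityAt_pos g y).ne'
  have h2 := (volDensityAt_pos g (η y)).ne'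
  rw [h, abs_mul, Diffeomorph.coe_trans, Function.comp_apply]
  field_simp

lemma Jac_symm_mul (g : RMetric n M) (φ : Diff n M) (y : M) :
    Jac g φ.symm (φ y) * Jac g φ y = 1 := by
  rw [← Jac_trans, Diffeomorph.self_trans_symm, Jac_refl]

lemma Jac_nonneg (g : RMetric n M) (φ : Diff n M) (y : M) : 0 ≤ Jac g φ y :=
  div_nonneg (mul_nonneg (abs_nonneg _) (volDensityAt_pos g _).le) (volDensityAt_pos g _).le

lemma Jac_pos (g : RMetric n M) (φ : Diff n M) (y : M) : 0 < Jac g φ y :=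
  (Jac_nonneg g φ y).lt_of_ne' (right_ne_zero_of_mul_eq_one (Jac_symm_mul g φ y))

/-! ### Push-forward of densities -/

lemma density_eq (g : RMetric n M) (φ : Diff n M) (y : M) : density g φ y = Jac g φ.symm y := by
  simp [density, push]

lemma density_pos (g : RMetric n M) (φ : Diff n M) (y : M) : 0 < density g φ y := by
  rw [density_eq]; exact Jac_pos g _ _

lemma push_refl (g : RMetric n M) (f : M → ℝ) : push g (Diffeomorph.refl (𝓡 n) M ∞) f = f := by
  funext y
  have : Jac g (Diffeomorph.refl (𝓡 n) M ∞).symm y = 1 := Jac_refl g y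
  rw [push, this, mul_one]
  rfl

lemma push_trans (g : RMetric n M) (η φ : Diff n M) (f : M → ℝ) :
    push g (η.trans φ) f = push g φ (push g η f) := by
  funext y
  have h : Jac g (η.trans φ).symm y = Jac g η.symm (φ.symm y) * Jac g φ.symm y :=
    Jac_trans g φ.symm η.symm y
  have h2 : (η.trans φ).symm y = η.symm (φ.symm y) := rfl
  simp only [push, h, h2]
  ring

lemma push_symm_push (g : RMetric n M) (φ : Diff n M) (f : M → ℝ) :
    push g φ.symm (push g φ f) = f := by
  rw [← push_trans, Diffeomorph.self_trans_symm, push_refl]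

/-! ### Smoothness of the Jacobian -/

lemma contDiff_det : ContDiff ℝ ∞ (fun L : Vec n →L[ℝ] Vec n => L.det) := by
  have : (fun L : Vec n →L[ℝ] Vec n => L.det) = fun L : Vec n →L[ℝ] Vec n =>
      (Matrix.of fun i j : Fin n => L (EuclideanSpace.single j 1) i).det := by
    funext L
    rw [ContinuousLinearMap.det, ← LinearMap.det_toMatrix (stdBasis n)]
    congr 1
  rw [this]
  simp only [Matrix.det_apply]
  refine ContDiff.sum fun σ _ => ContDiff.const_smul _ (contDiff_prod fun i _ => ?_)
  exact (EuclideanSpace.proj (𝕜 := ℝ) (σ i) : Vec n →L[ℝ] ℝ).contDiff.comp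
    (ContinuousLinearMap.apply ℝ (Vec n) (EuclideanSpace.single i (1 : ℝ))).contDiff

/-- The Jacobian depends smoothly on the diffeomorphism and on the point. Its coordinate expression
contains `|det|`, which is smooth because the determinant of a diffeomorphism does not vanish. -/
lemma smoothFunOn_Jac {P : Type*} [NormedAddCommGroup P] [NormedSpace ℝ P] {S : Set P}
    (hS : IsOpen S) (g : RMetric n M) {φ : P → Diff n M}
    (hφ : ContMDiffOn (𝓘(ℝ, P).prod (𝓡 n)) (𝓡 n) ∞ (fun p : P × M => φ p.1 p.2) (S ×ˢ univ)) :
    SmoothFunOn n S (fun p y => Jac g (φ p) y) := by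
  refine (smoothFunOn_iff hS).2 fun p hp y₀ => ?_
  have hb : ContMDiffAt (𝓘(ℝ, P).prod (𝓡 n)) (𝓡 n) ∞ (fun p : P × M => φ p.1 p.2) (p, y₀) :=
    hφ.contMDiffAt ((hS.prod isOpen_univ).mem_nhds ⟨hp, mem_univ _⟩)
  obtain ⟨x', hx'⟩ : ∃ x', x' = φ p y₀ := ⟨_, rfl⟩
  have h0 := mem_extChartAt_source (I := 𝓡 n) y₀
  have h0' : φ p y₀ ∈ (chart (n := n) x').source := hx' ▸ mem_extChartAt_source (I := 𝓡 n) x'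
  -- the matrix of the derivative of `φ` in the charts at `y₀` and at `φ p y₀`
  let L : P × M → Vec n →L[ℝ] Vec n := fun q =>
    (toCoord x' (φ q.1 q.2)).comp ((derivL (φ q.1) q.2).comp (ofCoord y₀ q.2))
  have hL : ContMDiffAt (𝓘(ℝ, P).prod (𝓡 n)) 𝓘(ℝ, Vec n →L[ℝ] Vec n) ∞ L (p, y₀) := by
    refine contMDiffAt_clm fun w => ?_
    have h1 := contMDiffAt_mfderiv_along (IN := 𝓘(ℝ, P).prod (𝓡 n)) (IA := 𝓡 n) (IB := 𝓡 n)
      (q₀ := (p, y₀)) (f := fun (q : P × M) y => φ q.1 y) (a := fun q => q.2)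
      (V := fun q => ofCoord y₀ q.2 w)
      (ContMDiffAt.comp (g := fun p : P × M => φ p.1 p.2)
        (f := fun q : (P × M) × M => (q.1.1, q.2)) ((p, y₀), y₀) hb
        ((contMDiffAt_fst.comp _ contMDiffAt_fst).prodMk contMDiffAt_snd))
      (contMDiffAt_frame (b := fun q : P × M => q.2) contMDiffAt_snd h0 w)
    exact ((contMDiffAt_field_iff' (b := fun q : P × M => φ q.1 q.2) h0').1 h1).2
  have hd : ContMDiffAt (𝓘(ℝ, P).prod (𝓡 n)) 𝓘(ℝ, ℝ) ∞ (fun q => (L q).det) (p, y₀) :=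
    contDiff_det.contMDiff.contMDiffAt.comp _ hL
  have hv : ContMDiffAt (𝓘(ℝ, P).prod (𝓡 n)) 𝓘(ℝ, ℝ) ∞
      (fun q : P × M => volDensity g y₀ (chart (n := n) y₀ q.2)) (p, y₀) := by
    refine ContMDiffAt.comp (p, y₀) (g := volDensity g y₀)
      ((contDiffOn_volDensity g y₀).contDiffAt (extChartAt_target_mem_nhds y₀)).contMDiffAt ?_
    exact (contMDiffAt_extChartAt (I := 𝓡 n)).comp (p, y₀) contMDiffAt_snd
  have hv' : ContMDiffAt (𝓘(ℝ, P).prod (𝓡 n)) 𝓘(ℝ, ℝ) ∞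
      (fun q : P × M => volDensity g x' (chart (n := n) x' (φ q.1 q.2))) (p, y₀) := by
    refine ContMDiffAt.comp (p, y₀) (g := volDensity g x')
      ((contDiffOn_volDensity g x').contDiffAt
        (extChartAt_target_mem_nhds' ((chart (n := n) x').map_source h0'))).contMDiffAt ?_
    exact ContMDiffAt.comp (p, y₀) (g := chart (n := n) x')
      (contMDiffAt_extChartAt' (by rwa [extChartAt_source] at h0')) hb
  have hmul : ∀ q : P × M, q.2 ∈ (chart (n := n) y₀).source →
      φ q.1 q.2 ∈ (chart (n := n) x').source →
      Jac g (φ q.1) q.2 = |(L q).det| * volDensity g x' (chart (n := n) x' (φ q.1 q.2)) /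
        volDensity g y₀ (chart (n := n) y₀ q.2) := by
    intro q h1 h2
    rw [eq_div_iff (volDensity_pos g ((chart (n := n) y₀).map_source h1)).ne']
    exact Jac_mul_volDensity g (φ q.1) h1 h2
  -- `|·|` is smooth away from zero
  have hne : (L (p, y₀)).det ≠ 0 := by
    intro h
    have := hmul (p, y₀) h0 h0'
    rw [h, abs_zero, zero_mul, zero_div] at this
    exact (Jac_pos g (φ p) y₀).ne' this
  have habs : ContMDiffAt (𝓘(ℝ, P).prod (𝓡 n)) 𝓘(ℝ, ℝ) ∞ (fun q => |(L q).det|) (p, y₀) :=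
    (contDiffAt_abs hne).contMDiffAt.comp (p, y₀) hd
  have hfin := (habs.mul hv').div₀ hv (volDensity_pos g (mem_extChartAt_target y₀)).ne'
  refine hfin.congr_of_eventuallyEq ?_
  filter_upwards [continuousAt_snd.preimage_mem_nhds ((isOpen_extChartAt_source y₀).mem_nhds h0),
    hb.continuousAt.preimage_mem_nhds ((isOpen_extChartAt_source x').mem_nhds h0')] with q h1 h2
  exact hmul q h1 h2

lemma SmoothDiffOn.push {P : Type*} [NormedAddCommGroup P] [NormedSpace ℝ P] {S : Set P}
    (hS : IsOpen S) (g : RMetric n M) {φ : P → Diff n M} (hφ : SmoothDiffOn S φ)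
    {f : M → ℝ} (hf : ContMDiff (𝓡 n) 𝓘(ℝ, ℝ) ∞ f) :
    SmoothFunOn n S (fun p => push g (φ p) f) :=
  SmoothFunOn.mul (ContMDiffOn.comp (t := univ) hf.contMDiffOn hφ.2 fun _ _ => mem_univ _)
    (smoothFunOn_Jac (φ := fun p => (φ p).symm) hS g hφ.2)

lemma SmoothDiffOn.density {P : Type*} [NormedAddCommGroup P] [NormedSpace ℝ P] {S : Set P}
    (hS : IsOpen S) (g : RMetric n M) {φ : P → Diff n M} (hφ : SmoothDiffOn S φ) :
    SmoothFunOn n S (fun p => density g (φ p)) :=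
  hφ.push hS g (f := 1) contMDiff_const

lemma smoothDiffOn_const {P : Type*} [NormedAddCommGroup P] [NormedSpace ℝ P] (S : Set P)
    (φ : Diff n M) : SmoothDiffOn S (fun _ : P => φ) :=
  ⟨(φ.contMDiff.comp contMDiff_snd).contMDiffOn, (φ.symm.contMDiff.comp contMDiff_snd).contMDiffOn⟩

lemma contMDiff_push (g : RMetric n M) (φ : Diff n M) {f : M → ℝ}
    (hf : ContMDiff (𝓡 n) 𝓘(ℝ, ℝ) ∞ f) : ContMDiff (𝓡 n) 𝓘(ℝ, ℝ) ∞ (push g φ f) :=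
  ((smoothDiffOn_const (univ : Set ℝ) φ).push isOpen_univ g hf).sfun (mem_univ 0)

lemma contMDiff_density (g : RMetric n M) (φ : Diff n M) :
    ContMDiff (𝓡 n) 𝓘(ℝ, ℝ) ∞ (density g φ) :=
  contMDiff_push g φ (f := 1) contMDiff_const

lemma continuous_Jac (g : RMetric n M) (φ : Diff n M) : Continuous (Jac g φ) := by
  have := (contMDiff_density g φ.symm).continuous
  exact this.congr fun y => by rw [density_eq]; rfl

/-! ### The Riemannian measure -/

section Volume

variable [MeasurableSpace M] [BorelSpace M]

lemma measurableSet_source (x : M) : MeasurableSet (chart (n := n) x).source :=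
  (isOpen_extChartAt_source x).measurableSet

lemma isOpen_target (x : M) : IsOpen (chart (n := n) x).target := isOpen_extChartAt_target x

lemma aemeasurable_chart_symm (g : RMetric n M) (x : M) :
    AEMeasurable (chart (n := n) x).symm
      (((volume : Measure (Vec n)).restrict (chart (n := n) x).target).withDensity
        (fun z => ENNReal.ofReal (volDensity g x z))) :=
  ((continuousOn_extChartAt_symm x).aemeasurable (isOpen_target x).measurableSet).mono_ac
    (withDensity_absolutelyContinuous _ _)

lemma aemeasurable_volDensity (g : RMetric n M) (x : M) :
    AEMeasurable (fun z => ENNReal.ofReal (volDensity g x z))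
      ((volume : Measure (Vec n)).restrict (chart (n := n) x).target) :=
  ((contDiffOn_volDensity g x).continuousOn.aemeasurable
    (isOpen_target x).measurableSet).ennreal_ofReal

lemma measurableSet_preimage_chart_symm {x : M} {s : Set M} (hs : MeasurableSet s) :
    MeasurableSet ((chart (n := n) x).target ∩ (chart (n := n) x).symm ⁻¹' s) := by
  have h : Measurable ((chart (n := n) x).target.domRestrict (chart (n := n) x).symm) :=
    (continuousOn_iff_continuous_domRestrict.1 (continuousOn_extChartAt_symm x)).measurable
  have := (isOpen_target x).measurableSet.subtype_image (h hs)
  convert this using 1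
  ext z
  constructor
  · rintro ⟨hz, hzs⟩
    exact ⟨⟨z, hz⟩, hzs, rfl⟩
  · rintro ⟨⟨z, hz⟩, hzs, rfl⟩
    exact ⟨hz, hzs⟩

lemma lintegral_chartVolume (g : RMetric n M) (x : M) {s : Set M} (hs : MeasurableSet s)
    {f : M → ENNReal} (hf : Measurable f) :
    ∫⁻ y in s, f y ∂chartVolume g x =
      ∫⁻ z in (chart (n := n) x).target ∩ (chart (n := n) x).symm ⁻¹' s,
        ENNReal.ofReal (volDensity g x z) * f ((chart (n := n) x).symm z) := by
  have hm := aemeasurable_chart_symm g x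
  rw [← lintegral_indicator hs, chartVolume, lintegral_map' (hf.indicator hs).aemeasurable hm,
    lintegral_withDensity_eq_lintegral_mul₀ (aemeasurable_volDensity g x)
      (g := fun z => s.indicator f ((chart (n := n) x).symm z)) ((hf.indicator hs).comp_aemeasurable
      ((continuousOn_extChartAt_symm x).aemeasurable (isOpen_target x).measurableSet))]
  have h2 := measurableSet_preimage_chart_symm (n := n) (x := x) hs
  rw [← lintegral_indicator (isOpen_target x).measurableSet, ← lintegral_indicator h2]
  congr 1
  funext z
  by_cases h1 : z ∈ (chart (n := n) x).target <;>
    by_cases h3 : (chart (n := n) x).symm z ∈ s <;>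
    simp only [indicator, Pi.mul_apply, mem_inter_iff, mem_preimage, h1, h3, if_true, if_false,
      and_true, and_false, mul_zero]

lemma chartVolume_apply (g : RMetric n M) (x : M) {s : Set M} (hs : MeasurableSet s) :
    chartVolume g x s = ∫⁻ z in (chart (n := n) x).target ∩ (chart (n := n) x).symm ⁻¹' s,
        ENNReal.ofReal (volDensity g x z) := by
  have := lintegral_chartVolume g x hs (f := fun _ => 1) measurable_const
  simpa using this

/-- The transformation law of the chart volumes under a diffeomorphism. -/
lemma chartVolume_image (g : RMetric n M) (φ : Diff n M) {x x' : M} {E : Set M}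
    (hE : MeasurableSet E) (h1 : E ⊆ (chart (n := n) x).source)
    (h2 : φ '' E ⊆ (chart (n := n) x').source) :
    chartVolume g x' (φ '' E) = ∫⁻ y in E, ENNReal.ofReal (Jac g φ y) ∂chartVolume g x := by
  have hφE : MeasurableSet (φ '' E) := φ.toHomeomorph.measurableEmbedding.measurableSet_image.2 hE
  rw [chartVolume_apply g x' hφE,
    lintegral_chartVolume g x hE (continuous_Jac g φ).measurable.ennreal_ofReal]
  set A := (chart (n := n) x).target ∩ (chart (n := n) x).symm ⁻¹' E with hA
  have hAm : MeasurableSet A := measurableSet_preimage_chart_symm hE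
  have himg : (chart (n := n) x').target ∩ (chart (n := n) x').symm ⁻¹' (φ '' E) =
      chartRep φ x x' '' A := by
    ext z
    constructor
    · rintro ⟨hz, y, hy, hyz⟩
      refine ⟨chart (n := n) x y, ⟨(chart (n := n) x).map_source (h1 hy), ?_⟩, ?_⟩
      · rwa [mem_preimage, (chart (n := n) x).left_inv (h1 hy)]
      · rw [chartRep, (chart (n := n) x).left_inv (h1 hy), hyz, (chart (n := n) x').right_inv hz]
    · rintro ⟨w, ⟨hw, hwE⟩, rfl⟩
      have h3 := h2 (mem_image_of_mem φ hwE)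
      refine ⟨(chart (n := n) x').map_source h3, _, hwE, ?_⟩
      rw [chartRep, (chart (n := n) x').left_inv h3]
  have hinj : InjOn (chartRep (n := n) φ x x') A := by
    rintro w ⟨hw, hwE⟩ w' ⟨hw', hwE'⟩ h
    have h3 := (chart (n := n) x').injOn (h2 (mem_image_of_mem φ hwE))
      (h2 (mem_image_of_mem φ hwE')) h
    exact (chart (n := n) x).symm.injOn hw hw' (φ.injective h3)
  have hder : ∀ z ∈ A, HasFDerivWithinAt (chartRep (n := n) φ x x')
      ((toCoord x' (φ ((chart (n := n) x).symm z))).comp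
        ((derivL φ ((chart (n := n) x).symm z)).comp (ofCoord x ((chart (n := n) x).symm z)))) A z := by
    rintro z ⟨hz, hzE⟩
    have := hasFDerivAt_chartRep φ ((chart (n := n) x).map_target hz)
      (h2 (mem_image_of_mem φ hzE))
    rw [(chart (n := n) x).right_inv hz] at this
    exact this.hasFDerivWithinAt
  rw [himg, lintegral_image_eq_lintegral_abs_det_fderiv_mul volume hAm hder hinj]
  refine setLIntegral_congr_fun hAm ?_
  rintro z ⟨hz, hzE⟩
  have hJ := Jac_mul_volDensity g φ ((chart (n := n) x).map_target hz)
    (h2 (mem_image_of_mem φ hzE))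
  rw [(chart (n := n) x).right_inv hz] at hJ
  simp only [chartRep]
  rw [← ENNReal.ofReal_mul (abs_nonneg _), ← hJ, ← ENNReal.ofReal_mul (volDensity_pos g hz).le,
    mul_comm]

lemma chartVolume_eq (g : RMetric n M) {x x' : M} {E : Set M} (hE : MeasurableSet E)
    (h1 : E ⊆ (chart (n := n) x).source) (h2 : E ⊆ (chart (n := n) x').source) :
    chartVolume g x' E = chartVolume g x E := by
  have := chartVolume_image g (Diffeomorph.refl (𝓡 n) M ∞) hE h1 (x' := x') (by simpa using h2)
  simpa [Jac_refl] using this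

lemma chartVolume_inter_source (g : RMetric n M) (x : M) {E : Set M} (hE : MeasurableSet E) :
    chartVolume g x E = chartVolume g x (E ∩ (chart (n := n) x).source) := by
  rw [chartVolume_apply g x hE, chartVolume_apply g x (hE.inter (measurableSet_source x))]
  congr 2
  ext z
  constructor
  · rintro ⟨h1, h2⟩
    exact ⟨h1, h2, (chart (n := n) x).map_target h1⟩
  · rintro ⟨h1, h2, _⟩
    exact ⟨h1, h2⟩

variable [CompactSpace M]

variable (n M) in
/-- A finite set of charts that cover `M`. -/
lemma exists_finite_chart_cover :
    ∃ t : Finset M, ∀ y : M, ∃ x ∈ t, y ∈ (chart (n := n) x).source := by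
  obtain ⟨t, ht⟩ := isCompact_univ.elim_finite_subcover
    (fun x : M => (chart (n := n) x).source) (fun x => isOpen_extChartAt_source x)
    (fun y _ => mem_iUnion.2 ⟨y, mem_extChartAt_source y⟩)
  exact ⟨t, fun y => by simpa using ht (mem_univ y)⟩

/-- On the domain of a chart, the Riemannian measure is the chart volume: a finite cover by charts
is made disjoint, and the sum of the restricted chart volumes is the supremum of all of them. -/
lemma riemVol_apply_of_subset (g : RMetric n M) {x : M} {E : Set M} (hE : MeasurableSet E)
    (h : E ⊆ (chart (n := n) x).source) : riemVol g E = chartVolume g x E := by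
  obtain ⟨t, ht⟩ := exists_finite_chart_cover n M
  obtain ⟨L, hL⟩ : ∃ L : List M, ∀ y : M, ∃ x ∈ L, y ∈ (chart (n := n) x).source :=
    ⟨t.toList, by simpa using ht⟩
  -- `disjointed U` is a partition of `M` into pieces of chart domains; `ν` glues the chart volumes
  let U : ℕ → Set M := fun i => if h : i < L.length then (chart (n := n) L[i]).source else ∅
  let c : ℕ → M := fun i => if h : i < L.length then L[i] else x
  have hUo : ∀ i, MeasurableSet (U i) := by
    intro i
    by_cases h : i < L.length
    · simp only [U, h, dite_true]; exact measurableSet_source _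
    · simp [U, h]
  have hUc : ∀ i, U i ⊆ (chart (n := n) (c i)).source := by
    intro i
    by_cases h : i < L.length <;> simp [U, c, h]
  have hcov : ⋃ i, U i = univ := by
    refine eq_univ_of_forall fun y => ?_
    obtain ⟨x', hx', hy⟩ := hL y
    obtain ⟨i, hi, rfl⟩ := List.getElem_of_mem hx'
    exact mem_iUnion.2 ⟨i, by simpa [U, hi] using hy⟩
  let ν : Measure M := Measure.sum fun i => (chartVolume g (c i)).restrict (disjointed U i)
  have hdm : ∀ i, MeasurableSet (disjointed U i) := fun i => MeasurableSet.disjointed hUo i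
  have hdis : Pairwise (Function.onFun Disjoint (disjointed U)) := disjoint_disjointed U
  have hdU : ⋃ i, disjointed U i = univ := by rw [iUnion_disjointed, hcov]
  have hsplit : ∀ (κ : Measure M) {A : Set M}, MeasurableSet A →
      κ A = ∑' i, κ (A ∩ disjointed U i) := by
    intro κ A hA
    rw [← measure_iUnion (fun i j hij => (hdis hij).mono inter_subset_right inter_subset_right)
      fun i => hA.inter (hdm i), ← inter_iUnion, hdU, inter_univ]
  have hν : ∀ A, MeasurableSet A → ν A = ∑' i, chartVolume g (c i) (A ∩ disjointed U i) := by
    intro A hA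
    simp only [ν, Measure.sum_apply _ hA, Measure.restrict_apply hA]
  have hνx : ∀ (x' : M) {A : Set M}, MeasurableSet A → A ⊆ (chart (n := n) x').source →
      ν A = chartVolume g x' A := by
    intro x' A hA hAx
    rw [hν A hA, hsplit (chartVolume g x') hA]
    refine tsum_congr fun i => ?_
    exact chartVolume_eq g (hA.inter (hdm i)) (inter_subset_left.trans hAx)
      (inter_subset_right.trans ((disjointed_subset U i).trans (hUc i)))
  have hsup : riemVol g = ν := by
    refine le_antisymm (iSup_le fun x' => ?_) ?_
    · refine Measure.le_iff.2 fun A hA => ?_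
      rw [chartVolume_inter_source g x' hA,
        ← hνx x' (hA.inter (measurableSet_source x')) inter_subset_right]
      exact measure_mono inter_subset_left
    · refine Measure.le_iff.2 fun A hA => ?_
      rw [hν A hA, hsplit (riemVol g) hA]
      exact ENNReal.tsum_le_tsum fun i => le_iSup (fun x => chartVolume g x) (c i) _
  rw [hsup, hνx x hE h]

lemma riemVol_restrict_source (g : RMetric n M) (x : M) :
    (riemVol g).restrict (chart (n := n) x).source = chartVolume g x := by
  refine Measure.ext fun A hA => ?_
  rw [Measure.restrict_apply hA, riemVol_apply_of_subset g (hA.inter (measurableSet_source x))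
    inter_subset_right, ← chartVolume_inter_source g x hA]

/-- Integration over `M` of a function supported in the domain of a chart. -/
lemma integral_riemVol_of_subset (g : RMetric n M) {x : M} {f : M → ℝ} (hf : Continuous f)
    (h : Function.support f ⊆ (chart (n := n) x).source) :
    ∫ y, f y ∂riemVol g = ∫ z in (chart (n := n) x).target,
      volDensity g x z * f ((chart (n := n) x).symm z) := by
  rw [← setIntegral_eq_integral_of_forall_compl_eq_zero (s := (chart (n := n) x).source)
    (fun y hy => by by_contra h0; exact hy (h h0)), riemVol_restrict_source, chartVolume,
    integral_map (aemeasurable_chart_symm g x) hf.measurable.aestronglyMeasurable,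
    integral_withDensity_eq_integral_toReal_smul₀ (aemeasurable_volDensity g x) (by simp)]
  refine setIntegral_congr_fun (isOpen_target x).measurableSet fun z hz => ?_
  simp [ENNReal.toReal_ofReal (volDensity_pos g hz).le]

instance isFiniteMeasure_riemVol (g : RMetric n M) : IsFiniteMeasure (riemVol g) := by
  suffices IsLocallyFiniteMeasure (riemVol g) from inferInstance
  refine ⟨fun x => ?_⟩
  have h0 := extChartAt_target_mem_nhds (I := 𝓡 n) x
  obtain ⟨K, hK, hKt, hKc⟩ := local_compact_nhds h0
  have hc : ContinuousAt (chart (n := n) x) x := continuousAt_extChartAt x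
  refine ⟨(chart (n := n) x).source ∩ chart (n := n) x ⁻¹' interior K, ?_, ?_⟩
  · exact Filter.inter_mem (extChartAt_source_mem_nhds x)
      (hc.preimage_mem_nhds (interior_mem_nhds.2 hK))
  · have ho : IsOpen ((chart (n := n) x).source ∩ chart (n := n) x ⁻¹' interior K) :=
      (continuousOn_extChartAt x).isOpen_inter_preimage (isOpen_extChartAt_source x) isOpen_interior
    rw [riemVol_apply_of_subset g ho.measurableSet inter_subset_left,
      chartVolume_apply g x ho.measurableSet]
    have hcont : ContinuousOn (volDensity g x) K :=
      (contDiffOn_volDensity g x).continuousOn.mono hKt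
    obtain ⟨C, hC⟩ := hKc.exists_bound_of_continuousOn hcont
    refine (lintegral_mono_set (t := K) ?_).trans_lt ?_
    · rintro z ⟨hz, h1, h2⟩
      rw [mem_preimage, (chart (n := n) x).right_inv hz] at h2
      exact interior_subset h2
    · refine (setLIntegral_lt_top_of_isCompact (μ := (volume : Measure (Vec n)))
        hKc.measure_lt_top.ne hKc
        (f := fun z => Real.toNNReal (C)) continuous_const).trans_le' ?_
      refine setLIntegral_mono' hKc.measurableSet fun z hz => ?_
      exact ENNReal.ofReal_le_ofReal ((le_abs_self _).trans (hC z hz))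

instance isOpenPosMeasure_riemVol (g : RMetric n M) : (riemVol g).IsOpenPosMeasure := by
  refine ⟨fun U hU ⟨x, hx⟩ h0 => ?_⟩
  have ho : IsOpen ((chart (n := n) x).source ∩ U) := (isOpen_extChartAt_source x).inter hU
  have h1 : riemVol g ((chart (n := n) x).source ∩ U) = 0 := measure_mono_null inter_subset_right h0
  rw [riemVol_apply_of_subset g ho.measurableSet inter_subset_left,
    chartVolume_apply g x ho.measurableSet] at h1
  have hW : IsOpen ((chart (n := n) x).target ∩ (chart (n := n) x).symm ⁻¹'
      ((chart (n := n) x).source ∩ U)) :=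
    (continuousOn_extChartAt_symm x).isOpen_inter_preimage (isOpen_target x) ho
  have hmem : chart (n := n) x x ∈ (chart (n := n) x).target ∩ (chart (n := n) x).symm ⁻¹'
      ((chart (n := n) x).source ∩ U) := by
    refine ⟨mem_extChartAt_target x, ?_⟩
    rw [mem_preimage, extChartAt_to_inv]
    exact ⟨mem_extChartAt_source x, hx⟩
  have h2 := (setLIntegral_eq_zero_iff' hW.measurableSet
    ((aemeasurable_volDensity g x).mono_measure (Measure.restrict_mono inter_subset_left le_rfl))).1 h1
  have h3 : volume ((chart (n := n) x).target ∩ (chart (n := n) x).symm ⁻¹'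
      ((chart (n := n) x).source ∩ U)) = 0 := by
    refine measure_mono_null ?_ h2
    intro z hz h4
    have := h4 hz
    rw [ENNReal.ofReal_eq_zero] at this
    exact absurd (volDensity_pos g hz.1) (not_lt.2 this)
  exact hW.measure_ne_zero volume ⟨_, hmem⟩ h3

end Volume

/-! ### Differentiation under the integral sign -/

/-- Differentiation under the integral over a compact set, for a continuous derivative. -/
lemma hasDerivAt_setIntegral_of_continuousOn {X : Type*} [TopologicalSpace X] [MeasurableSpace X]
    [OpensMeasurableSpace X] {ν : Measure X} {K : Set X} (hK : IsCompact K)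
    (hKm : MeasurableSet K) (hν : ν K < ⊤) {J : Set ℝ} (hJ : IsOpen J) {f f' : ℝ → X → ℝ}
    (hf : ContinuousOn (Function.uncurry f) (J ×ˢ K))
    (hf' : ContinuousOn (Function.uncurry f') (J ×ˢ K))
    (hd : ∀ t ∈ J, ∀ x ∈ K, HasDerivAt (fun s => f s x) (f' t x) t) {t : ℝ} (ht : t ∈ J) :
    HasDerivAt (fun s => ∫ x in K, f s x ∂ν) (∫ x in K, f' t x ∂ν) t := by
  obtain ⟨r, hr, hrJ⟩ := Metric.nhds_basis_closedBall.mem_iff.1 (hJ.mem_nhds ht)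
  have hslice : ∀ {F : ℝ → X → ℝ}, ContinuousOn (Function.uncurry F) (J ×ˢ K) → ∀ s ∈ J,
      ContinuousOn (F s) K := fun hF s hs =>
    hF.comp (f := fun x => (s, x)) (by fun_prop) fun x hx => ⟨hs, hx⟩
  have hcpt : IsCompact (Metric.closedBall t r ×ˢ K) := (isCompact_closedBall t r).prod hK
  obtain ⟨C, hC⟩ := hcpt.exists_bound_of_continuousOn (hf'.mono (prod_mono hrJ le_rfl))
  have : IsFiniteMeasure (ν.restrict K) := ⟨by simpa using hν⟩
  refine (hasDerivAt_integral_of_dominated_loc_of_deriv_le (bound := fun _ => C)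
    (Metric.closedBall_mem_nhds t hr) ?_ ?_ ?_ ?_ (integrable_const C) ?_).2
  · filter_upwards [hJ.mem_nhds ht] with s hs
    exact (hslice hf s hs).aestronglyMeasurable_of_isCompact hK hKm
  · obtain ⟨C', hC'⟩ := hK.exists_bound_of_continuousOn (hslice hf t ht)
    refine Integrable.of_bound ((hslice hf t ht).aestronglyMeasurable_of_isCompact hK hKm) C' ?_
    filter_upwards [ae_restrict_mem hKm] with x hx using hC' x hx
  · exact (hslice hf' t ht).aestronglyMeasurable_of_isCompact hK hKm
  · filter_upwards [ae_restrict_mem hKm] with x hx s hs using hC (s, x) ⟨hs, hx⟩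
  · filter_upwards [ae_restrict_mem hKm] with x hx s hs using hd s (hrJ hs) x hx

section Volume

variable [CompactSpace M] [T2Space M] [MeasurableSpace M] [BorelSpace M]

lemma hasDerivAt_integral_family (g : RMetric n M) {J : Set ℝ} (hJ : IsOpen J) {f : ℝ → M → ℝ}
    (hf : SmoothFunOn n J f) {t : ℝ} (ht : t ∈ J) :
    HasDerivAt (fun s => ∫ x, f s x ∂riemVol g)
      (∫ x, deriv (fun s => f s x) t ∂riemVol g) t := by
  have := hasDerivAt_setIntegral_of_continuousOn (ν := riemVol g) isCompact_univ
    MeasurableSet.univ (measure_lt_top _ _) hJ hf.continuousOn (hf.deriv hJ).continuousOn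
    (fun t ht x _ => hf.hasDerivAt hJ ht x) ht
  simpa using this

lemma continuousOn_integral_family {P : Type*} [NormedAddCommGroup P] [NormedSpace ℝ P] {S : Set P}
    (g : RMetric n M) {f : P → M → ℝ} (hf : SmoothFunOn n S f) :
    ContinuousOn (fun p => ∫ x, f p x ∂riemVol g) S :=
  continuousOn_integral_of_compact_support isCompact_univ hf.continuousOn
    fun _ x _ hx => absurd (mem_univ x) hx

lemma integrable_riemVol (g : RMetric n M) {f : M → ℝ} (hf : Continuous f) :
    Integrable f (riemVol g) := by
  have := hf.continuousOn.integrableOn_compact (μ := riemVol g) isCompact_univ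
  simpa using this

/-! ### Change of variables -/

/-- The Riemannian measure of an image, from the change of variables in charts: the two sides are
measures that agree on a finite cover by sets that `φ` maps from one chart into another. -/
lemma riemVol_image (g : RMetric n M) (φ : Diff n M) {E : Set M} (hE : MeasurableSet E) :
    riemVol g (φ '' E) = ∫⁻ y in E, ENNReal.ofReal (Jac g φ y) ∂riemVol g := by
  have himg : ∀ A : Set M, φ '' A = φ.symm ⁻¹' A := fun A => φ.toEquiv.image_eq_preimage_symm A
  have hms : Measurable φ.symm := φ.symm.continuous.measurable
  -- both sides are measures of `E`
  let ν₁ : Measure M := (riemVol g).map φ.symm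
  let ν₂ : Measure M := (riemVol g).withDensity fun y => ENNReal.ofReal (Jac g φ y)
  have h₁ : ∀ A, MeasurableSet A → ν₁ A = riemVol g (φ '' A) := fun A hA => by
    rw [himg]; exact Measure.map_apply hms hA
  have h₂ : ∀ A, MeasurableSet A → ν₂ A = ∫⁻ y in A, ENNReal.ofReal (Jac g φ y) ∂riemVol g :=
    fun A hA => withDensity_apply _ hA
  -- on `W x` the map `φ` goes from the chart at `x` to the chart at `φ x`
  let W : M → Set M := fun x => (chart (n := n) x).source ∩ φ ⁻¹' (chart (n := n) (φ x)).source
  have hW : ∀ x, IsOpen (W x) := fun x =>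
    (isOpen_extChartAt_source x).inter ((isOpen_extChartAt_source _).preimage φ.continuous)
  obtain ⟨t, ht⟩ := isCompact_univ.elim_finite_subcover W hW fun y _ => mem_iUnion.2
    ⟨y, mem_extChartAt_source y, mem_extChartAt_source (φ y)⟩
  have hcov : ⋃ i : t, W i = univ := eq_univ_of_forall fun y => by
    obtain ⟨x, hx, hy⟩ := mem_iUnion₂.1 (ht (mem_univ y))
    exact mem_iUnion.2 ⟨⟨x, hx⟩, hy⟩
  have hν : ν₁ = ν₂ := by
    refine (Measure.ext_iff_of_iUnion_eq_univ hcov).2 fun i => Measure.ext fun A hA => ?_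
    rw [Measure.restrict_apply hA, Measure.restrict_apply hA]
    have hAW := hA.inter (hW i).measurableSet
    have hs1 : A ∩ W i ⊆ (chart (n := n) (i : M)).source := inter_subset_right.trans inter_subset_left
    have hs2 : φ '' (A ∩ W i) ⊆ (chart (n := n) (φ i)).source := by
      rintro _ ⟨y, hy, rfl⟩; exact hy.2.2
    have hφm : MeasurableSet (φ '' (A ∩ W i)) :=
      φ.toHomeomorph.measurableEmbedding.measurableSet_image.2 hAW
    rw [h₁ _ hAW, h₂ _ hAW, riemVol_apply_of_subset g hφm hs2,
      chartVolume_image g φ hAW hs1 hs2, ← riemVol_restrict_source, Measure.restrict_restrict hAW,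
      inter_eq_left.2 hs1]
  rw [← h₁ E hE, hν, h₂ E hE]

/-- Change of variables: `∫ h (φ_* (s μ)) = ∫ (h ∘ φ) s μ`, for arbitrary functions `h` and `s`. -/
lemma integral_mul_push (g : RMetric n M) (φ : Diff n M) (h s : M → ℝ) :
    ∫ y, h y * push g φ s y ∂riemVol g = ∫ x, h (φ x) * s x ∂riemVol g := by
  -- `μ` is the push-forward by `φ⁻¹` of `Jac(φ⁻¹) μ`
  have hmap : riemVol g = ((riemVol g).withDensity
      fun y => ENNReal.ofReal (Jac g φ.symm y)).map φ.symm := by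
    refine Measure.ext fun A hA => ?_
    have hA' : MeasurableSet (φ.symm ⁻¹' A) := φ.symm.continuous.measurable hA
    rw [Measure.map_apply φ.symm.continuous.measurable hA, withDensity_apply _ hA',
      ← riemVol_image g φ.symm hA']
    exact congrArg _ (image_preimage_eq A φ.symm.surjective).symm
  conv_rhs => rw [hmap]
  have hemb : MeasurableEmbedding φ.symm := φ.symm.toHomeomorph.measurableEmbedding
  rw [hemb.integral_map, integral_withDensity_eq_integral_toReal_smul
    (continuous_Jac g φ.symm).measurable.ennreal_ofReal (by simp)]
  refine integral_congr_ae (Filter.Eventually.of_forall fun y => ?_)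
  simp [push, ENNReal.toReal_ofReal (Jac_nonneg g φ.symm y)]
  ring

lemma integral_mul_density (g : RMetric n M) (φ : Diff n M) (h : M → ℝ) :
    ∫ y, h y * density g φ y ∂riemVol g = ∫ x, h (φ x) ∂riemVol g := by
  simpa [density] using integral_mul_push g φ h 1

/-! ### The fundamental lemma of the calculus of variations -/

lemma eq_zero_of_integral_sq_eq_zero (g : RMetric n M) {F : M → ℝ} (hF : Continuous F)
    (hn : ∀ x, 0 ≤ F x) (h : ∫ x, F x ∂riemVol g = 0) (x : M) : F x = 0 := by
  have h1 := (integral_eq_zero_iff_of_nonneg hn (integrable_riemVol g hF)).1 h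
  have h2 := (Measure.eq_of_ae_eq (μ := riemVol g) (f := F) (g := fun _ => (0 : ℝ)) h1 hF
    continuous_const)
  exact congrFun h2 x

/-- A continuous function on an open set that integrates to zero against all smooth functions
supported there vanishes there. -/
lemma eqOn_zero_of_forall_integral_mul (g : RMetric n M) {U : Set M} (hU : IsOpen U)
    {F : M → ℝ} (hF : ContinuousOn F U)
    (h : ∀ f : SFun n M, tsupport f ⊆ U → ∫ x, f x * F x ∂riemVol g = 0) : ∀ x ∈ U, F x = 0 := by
  have hsec : SecondCountableTopology M := ChartedSpace.secondCountable_of_sigmaCompact (Vec n) M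
  have hloc : LocallyIntegrableOn F U (riemVol g) := hF.locallyIntegrableOn hU.measurableSet
  have h1 := hU.ae_eq_zero_of_integral_contMDiff_smul_eq_zero (𝓡 n) hloc
    fun f hf _ hs => h ⟨f, hf⟩ hs
  have h2 := Measure.eqOn_open_of_ae_eq (μ := riemVol g) (f := F) (g := fun _ => (0 : ℝ))
    ((ae_restrict_iff' hU.measurableSet).2 h1) hU hF continuousOn_const
  exact h2

lemma eq_zero_of_forall_integral_mul (g : RMetric n M) {F : M → ℝ} (hF : Continuous F)
    (h : ∀ f : SFun n M, ∫ x, f x * F x ∂riemVol g = 0) (x : M) : F x = 0 :=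
  eqOn_zero_of_forall_integral_mul g isOpen_univ hF.continuousOn (fun f _ => h f) x (mem_univ x)

end Volume

/-! ### Derivatives of functions along vectors -/

/-- The differential of a function, as a linear form on `ℝⁿ`. -/
def dL (f : M → ℝ) (y : M) : Vec n →L[ℝ] ℝ :=
  (mfderiv (𝓡 n) 𝓘(ℝ, ℝ) f y : TangentSpace (𝓡 n) y →L[ℝ] ℝ)

lemma hasFDerivAt_comp_chart_symm {f : M → ℝ} {x y : M} (hy : y ∈ (chart (n := n) x).source)
    (hf : MDifferentiableAt (𝓡 n) 𝓘(ℝ, ℝ) f y) :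
    HasFDerivAt (fun z => f ((chart (n := n) x).symm z)) ((dL f y).comp (ofCoord x y))
      (chart (n := n) x y) := by
  have h1 : HasMFDerivAt 𝓘(ℝ, Vec n) (𝓡 n) (chart (n := n) x).symm (chart (n := n) x y)
      (mfderiv 𝓘(ℝ, Vec n) (𝓡 n) (chart (n := n) x).symm (chart (n := n) x y)) := by
    refine MDifferentiableAt.hasMFDerivAt ?_
    exact ((contMDiffOn_extChartAt_symm (n := ∞) x).contMDiffAt
      (extChartAt_target_mem_nhds' ((chart (n := n) x).map_source hy))).mdifferentiableAt (by simp)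
  have h4 : ∀ y', y' = y → HasMFDerivAt (𝓡 n) 𝓘(ℝ, ℝ) f y' (dL f y : Vec n →L[ℝ] ℝ) := by
    rintro _ rfl; exact hf.hasMFDerivAt
  exact ((h4 _ ((chart (n := n) x).left_inv hy)).comp _ h1).hasFDerivAt

/-- The derivative along a vector field in coordinates. -/
lemma dL_eq_fderiv {f : M → ℝ} {x : M} {z : Vec n} (hz : z ∈ (chart (n := n) x).target)
    (hf : ContMDiff (𝓡 n) 𝓘(ℝ, ℝ) ∞ f) (v : (y : M) → TangentSpace (𝓡 n) y) :
    dL f ((chart (n := n) x).symm z) (v ((chart (n := n) x).symm z)) =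
      fderiv ℝ (fun z => f ((chart (n := n) x).symm z)) z (fieldCoord x v z) := by
  have hy := (chart (n := n) x).map_target hz
  have h := hasFDerivAt_comp_chart_symm hy (hf.mdifferentiable (by simp) _)
  rw [(chart (n := n) x).right_inv hz] at h
  rw [h.fderiv]
  exact (congrArg (dL f _) (ofCoord_toCoord hy (v _))).symm

lemma contDiffOn_comp_chart_symm {f : M → ℝ} (x : M) (hf : ContMDiff (𝓡 n) 𝓘(ℝ, ℝ) ∞ f) :
    ContDiffOn ℝ ∞ (fun z => f ((chart (n := n) x).symm z)) (chart (n := n) x).target :=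
  ((hf.contMDiffOn (s := univ)).comp (contMDiffOn_extChartAt_symm x)
    fun _ _ => mem_univ _).contDiffOn

lemma contDiffOn_fieldCoord (x : M) (v : VField n M) :
    ContDiffOn ℝ ∞ (fieldCoord x v) (chart (n := n) x).target := by
  intro z hz
  have hb : ContMDiffAt 𝓘(ℝ, Vec n) (𝓡 n) ∞ (chart (n := n) x).symm z :=
    (contMDiffOn_extChartAt_symm x).contMDiffAt (extChartAt_target_mem_nhds' (I := 𝓡 n) hz)
  have h := (contMDiffAt_field_iff' (V := fun z => v ((chart (n := n) x).symm z))
    ((chart (n := n) x).map_target hz)).1 ((v.contMDiff _).comp z hb)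
  exact h.2.contDiffAt.contDiffWithinAt

lemma dL_eq_zero_of_notMem_tsupport {f : M → ℝ} {y : M} (h : y ∉ tsupport f) :
    dL (n := n) f y = 0 := by
  have h1 : f =ᶠ[𝓝 y] fun _ => 0 := notMem_tsupport_iff_eventuallyEq.1 h
  have := h1.mfderiv_eq (I := 𝓡 n) (I' := 𝓘(ℝ, ℝ))
  rw [dL]
  exact this.trans mfderiv_const

/-! ### The divergence -/

/-- The coordinate expression of the divergence in the chart at `x`, at the point with coordinates
`z`. -/
def divCoord (g : RMetric n M) (x : M) (v : (y : M) → TangentSpace (𝓡 n) y) (z : Vec n) : ℝ :=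
  (volDensity g x z)⁻¹ * ∑ i : Fin n,
    fderiv ℝ (fun z => volDensity g x z * fieldCoord x v z i) z (EuclideanSpace.single i 1)

lemma divergence_eq (g : RMetric n M) (v : (y : M) → TangentSpace (𝓡 n) y) (x : M) :
    divergence g v x = divCoord g x v (chart (n := n) x x) := rfl

lemma contDiffOn_density_field (g : RMetric n M) (x : M) (v : VField n M) (i : Fin n) :
    ContDiffOn ℝ ∞ (fun z => volDensity g x z * fieldCoord x v z i) (chart (n := n) x).target :=
  (contDiffOn_volDensity g x).mul
    ((EuclideanSpace.proj (𝕜 := ℝ) i : Vec n →L[ℝ] ℝ).contDiff.comp_contDiffOn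
      (contDiffOn_fieldCoord x v))

lemma continuousOn_divCoord (g : RMetric n M) (x : M) (v : VField n M) :
    ContinuousOn (divCoord g x v) (chart (n := n) x).target := by
  refine ((contDiffOn_volDensity g x).continuousOn.inv₀ fun z hz => (volDensity_pos g hz).ne').mul
    (continuousOn_finsetSum _ fun i _ => ?_)
  exact ((contDiffOn_density_field g x v i).continuousOn_fderiv_of_isOpen
    (isOpen_extChartAt_target x)
    (by simp)).clm_apply continuousOn_const

lemma continuousOn_divCoord_chart (g : RMetric n M) (x : M) (v : VField n M) :
    ContinuousOn (fun y => divCoord g x v (chart (n := n) x y)) (chart (n := n) x).source :=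
  (continuousOn_divCoord g x v).comp (continuousOn_extChartAt x) (chart (n := n) x).mapsTo

lemma dL_add {f h : M → ℝ} {y : M} (hf : MDifferentiableAt (𝓡 n) 𝓘(ℝ, ℝ) f y)
    (hh : MDifferentiableAt (𝓡 n) 𝓘(ℝ, ℝ) h y) : dL (n := n) (f + h) y = dL f y + dL h y :=
  (hf.hasMFDerivAt.add hh.hasMFDerivAt).mfderiv

lemma dL_sum {ι : Type*} (s : Finset ι) (F : ι → SFun n M) (y : M) (w : Vec n) :
    dL (∑ i ∈ s, (F i : M → ℝ)) y w = ∑ i ∈ s, dL (n := n) (F i) y w := by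
  classical
  induction s using Finset.induction_on with
  | empty =>
    have : dL (n := n) (0 : M → ℝ) y = 0 := mfderiv_const (c := (0 : ℝ))
    simp only [Finset.sum_empty, this, _root_.zero_apply]
  | insert i s hi IH =>
    have hs : ContMDiff (𝓡 n) 𝓘(ℝ, ℝ) ∞ (∑ i ∈ s, (F i : M → ℝ)) := by
      have := contMDiff_finsetSum (I := 𝓘(ℝ, ℝ)) (I' := 𝓡 n) (n := ∞) (t := s) (f := fun i => (F i : M → ℝ))
        fun i _ => (F i).contMDiff
      convert this using 1
      funext y; rw [Finset.sum_apply]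
    rw [Finset.sum_insert hi, Finset.sum_insert hi, ← IH,
      dL_add ((F i).contMDiff.mdifferentiable (by simp) y) (hs.mdifferentiable (by simp) y),
      _root_.add_apply]

section Volume

variable [CompactSpace M] [T2Space M] [MeasurableSpace M] [BorelSpace M]

lemma continuous_dL (f : SFun n M) (v : VField n M) : Continuous fun y => dL f y (v y) :=
  (lieFun v f).contMDiff.continuous

/-- The divergence theorem in a chart, from integration by parts in `ℝⁿ`. -/
lemma integral_mul_divCoord (g : RMetric n M) (x : M) (v : VField n M) (f : SFun n M)
    (hf : tsupport f ⊆ (chart (n := n) x).source) :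
    ∫ y, f y * divCoord g x v (chart (n := n) x y) ∂riemVol g =
      -∫ y, dL f y (v y) ∂riemVol g := by
  have hU := isOpen_extChartAt_source (I := 𝓡 n) x
  have hT := isOpen_target (n := n) x
  have hc1 : Continuous fun y => f y * divCoord g x v (chart (n := n) x y) :=
    (f.contMDiff.continuous.continuousOn.mul
      (continuousOn_divCoord_chart g x v)).continuous_of_tsupport_subset hU
      ((tsupport_mul_subset_left).trans hf)
  have hs1 : Function.support (fun y => f y * divCoord g x v (chart (n := n) x y)) ⊆
      (chart (n := n) x).source :=
    (Function.support_mul_subset_left _ _).trans ((subset_tsupport f).trans hf)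
  have hs2 : Function.support (fun y => dL f y (v y)) ⊆ (chart (n := n) x).source := by
    intro y hy
    by_contra h
    exact hy (congrArg (fun L : Vec n →L[ℝ] ℝ => L (v y))
      (dL_eq_zero_of_notMem_tsupport fun h' => h (hf h')))
  rw [integral_riemVol_of_subset g hc1 hs1, integral_riemVol_of_subset g (continuous_dL f v) hs2]
  -- the coordinate representation `F` of `f`, extended by zero to `ℝⁿ`
  let F : Vec n → ℝ := (chart (n := n) x).target.indicator fun z => f ((chart (n := n) x).symm z)
  let K : Set (Vec n) := chart (n := n) x '' tsupport f
  have hK : IsCompact K :=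
    (isClosed_tsupport f).isCompact.image_of_continuousOn ((continuousOn_extChartAt x).mono hf)
  have hKT : K ⊆ (chart (n := n) x).target := by
    rintro _ ⟨y, hy, rfl⟩; exact (chart (n := n) x).map_source (hf hy)
  have hF0 : ∀ z, z ∉ K → F z = 0 := by
    intro z hz
    by_cases hzT : z ∈ (chart (n := n) x).target
    · simp only [F, indicator_of_mem hzT]
      by_contra h
      exact hz ⟨_, subset_tsupport f h, (chart (n := n) x).right_inv hzT⟩
    · exact indicator_of_notMem hzT _
  have hFT : ∀ z ∈ (chart (n := n) x).target,
      F =ᶠ[𝓝 z] fun z => f ((chart (n := n) x).symm z) := fun z hz => by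
    filter_upwards [hT.mem_nhds hz] with w hw using indicator_of_mem hw _
  have hFs : ContDiff ℝ ∞ F := by
    refine contDiff_iff_contDiffAt.2 fun z => ?_
    by_cases hz : z ∈ (chart (n := n) x).target
    · exact ((contDiffOn_comp_chart_symm x f.contMDiff).contDiffAt
        (hT.mem_nhds hz)).congr_of_eventuallyEq (hFT z hz)
    · refine contDiffAt_const (c := (0 : ℝ)) |>.congr_of_eventuallyEq ?_
      filter_upwards [hK.isClosed.isOpen_compl.mem_nhds fun h => hz (hKT h)] with w hw
      exact hF0 w hw
  have htsF : tsupport F ⊆ K := closure_minimal (fun z hz => by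
    by_contra h; exact hz (hF0 z h)) hK.isClosed
  -- the components of `√(det g) v`
  let W : Fin n → Vec n → ℝ := fun i z => volDensity g x z * fieldCoord x v z i
  have hW : ∀ i, ContDiffOn ℝ ∞ (W i) (chart (n := n) x).target := contDiffOn_density_field g x v
  have hint : ∀ {G H : Vec n → ℝ}, tsupport G ⊆ K → Continuous G →
      ContinuousOn H (chart (n := n) x).target → Integrable fun z => G z * H z := by
    intro G H hG hGc hH
    have : Continuous fun z => G z * H z :=
      (hGc.continuousOn.mul hH).continuous_of_tsupport_subset hT
        (tsupport_mul_subset_left.trans (hG.trans hKT))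
    refine this.integrable_of_hasCompactSupport ?_
    exact HasCompactSupport.intro hK fun z hz => by
      rw [image_eq_zero_of_notMem_tsupport fun h => hz (hG h), zero_mul]
  have hdF : ∀ i : Fin n, Continuous fun z => fderiv ℝ F z (EuclideanSpace.single i 1) := fun i =>
    (hFs.continuous_fderiv (by simp)).clm_apply continuous_const
  have hdFs : ∀ i : Fin n, tsupport (fun z => fderiv ℝ F z (EuclideanSpace.single i 1)) ⊆ K :=
    fun i => (tsupport_fderiv_apply_subset ℝ _).trans htsF
  have hdW : ∀ i : Fin n, ContinuousOn (fun z => fderiv ℝ (W i) z (EuclideanSpace.single i 1))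
      (chart (n := n) x).target := fun i =>
    ((hW i).continuousOn_fderiv_of_isOpen hT (by simp)).clm_apply continuousOn_const
  -- integration by parts in `ℝⁿ`; `W i` is only defined on the chart, which contains `K`
  have hparts : ∀ i : Fin n, ∫ z, F z * fderiv ℝ (W i) z (EuclideanSpace.single i 1) =
      -∫ z, fderiv ℝ F z (EuclideanSpace.single i 1) * W i z := fun i =>
    integral_mul_fderiv_eq_neg_fderiv_mul_of_integrable
      (hint (hdFs i) (hdF i) (hW i).continuousOn) (hint htsF hFs.continuous (hdW i))
      (hint htsF hFs.continuous (hW i).continuousOn)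
      (fun z _ => hFs.differentiable (by simp) z)
      (fun z hz => ((hW i).contDiffAt (hT.mem_nhds (hKT (htsF hz)))).differentiableAt (by simp))
  have e1 : ∫ z in (chart (n := n) x).target, volDensity g x z *
      (f ((chart (n := n) x).symm z) *
        divCoord g x v (chart (n := n) x ((chart (n := n) x).symm z))) =
      ∑ i, ∫ z, F z * fderiv ℝ (W i) z (EuclideanSpace.single i 1) := by
    rw [← integral_finsetSum _ fun i _ => hint htsF hFs.continuous (hdW i)]
    refine Eq.trans ?_ (setIntegral_eq_integral_of_forall_compl_eq_zero
      (s := (chart (n := n) x).target) ?_)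
    · refine setIntegral_congr_fun hT.measurableSet fun z hz => ?_
      have h0 := (volDensity_pos g hz).ne'
      simp only [F, indicator_of_mem hz, (chart (n := n) x).right_inv hz, divCoord,
        ← Finset.mul_sum, W]
      field_simp
    · intro z hz
      simp only [F, indicator_of_notMem hz, zero_mul, Finset.sum_const_zero]
  have e2 : ∫ z in (chart (n := n) x).target, volDensity g x z *
      dL f ((chart (n := n) x).symm z) (v ((chart (n := n) x).symm z)) =
      ∑ i, ∫ z, fderiv ℝ F z (EuclideanSpace.single i 1) * W i z := by
    rw [← integral_finsetSum _ fun i _ => hint (hdFs i) (hdF i) (hW i).continuousOn]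
    refine Eq.trans ?_ (setIntegral_eq_integral_of_forall_compl_eq_zero
      (s := (chart (n := n) x).target) ?_)
    · refine setIntegral_congr_fun hT.measurableSet fun z hz => ?_
      have hw : fieldCoord x v z = ∑ i, fieldCoord x v z i • EuclideanSpace.single i (1 : ℝ) := by
        ext j; simp [Finset.sum_apply, Pi.single_apply]
      simp only [dL_eq_fderiv hz f.contMDiff v]
      rw [(hFT z hz).fderiv_eq, congrArg (fderiv ℝ _ z) hw, map_sum, Finset.mul_sum]
      refine Finset.sum_congr rfl fun i _ => ?_
      rw [map_smul, smul_eq_mul]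
      ring
    · intro z hz
      have : ∀ i : Fin n, fderiv ℝ F z (EuclideanSpace.single i 1) = 0 := fun i =>
        image_eq_zero_of_notMem_tsupport (f := fun z => fderiv ℝ F z (EuclideanSpace.single i 1))
          fun h => hz (hKT (hdFs i h))
      simp [this]
  rw [e1, e2, Finset.sum_congr rfl fun i _ => hparts i, Finset.sum_neg_distrib]

/-- The coordinate expression of the divergence does not depend on the chart: both expressions have
the same integrals against test functions. -/
lemma divCoord_eq_divergence (g : RMetric n M) (v : VField n M) {x y : M}
    (hy : y ∈ (chart (n := n) x).source) :
    divCoord g x v (chart (n := n) x y) = divergence g v y := by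
  rw [divergence_eq]
  have hU : IsOpen ((chart (n := n) x).source ∩ (chart (n := n) y).source) :=
    (isOpen_extChartAt_source x).inter (isOpen_extChartAt_source y)
  have hc1 := (continuousOn_divCoord_chart g x v).mono
    (inter_subset_left : (chart (n := n) x).source ∩ (chart (n := n) y).source ⊆ _)
  have hc2 := (continuousOn_divCoord_chart g y v).mono
    (inter_subset_right : (chart (n := n) x).source ∩ (chart (n := n) y).source ⊆ _)
  have := eqOn_zero_of_forall_integral_mul g hU (hc1.sub hc2) (fun f hf => ?_) y
    ⟨hy, mem_extChartAt_source y⟩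
  · exact sub_eq_zero.1 this
  · have hint : ∀ {H : M → ℝ}, ContinuousOn H ((chart (n := n) x).source ∩
        (chart (n := n) y).source) → Integrable (fun p => f p * H p) (riemVol g) := fun hH =>
      integrable_riemVol g ((f.contMDiff.continuous.continuousOn.mul
        hH).continuous_of_tsupport_subset hU (tsupport_mul_subset_left.trans hf))
    simp only [Pi.sub_apply, mul_sub]
    rw [integral_sub (hint hc1) (hint hc2),
      integral_mul_divCoord g x v f (hf.trans inter_subset_left),
      integral_mul_divCoord g y v f (hf.trans inter_subset_right), sub_self]

lemma continuous_divergence (g : RMetric n M) (v : VField n M) : Continuous (divergence g v) := by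
  refine continuous_iff_continuousAt.2 fun x => ?_
  have h := (continuousOn_divCoord_chart g x v).continuousAt
    ((isOpen_extChartAt_source x).mem_nhds (mem_extChartAt_source x))
  refine h.congr ?_
  filter_upwards [extChartAt_source_mem_nhds (I := 𝓡 n) x] with y hy
  exact divCoord_eq_divergence g v hy

/-- The divergence theorem on a compact manifold. -/
lemma integral_mul_divergence (g : RMetric n M) (v : VField n M) (f : SFun n M) :
    ∫ y, f y * divergence g v y ∂riemVol g = -∫ y, dL f y (v y) ∂riemVol g := by
  obtain ⟨t, ht⟩ := exists_finite_chart_cover n M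
  obtain ⟨χ, hχ⟩ := SmoothPartitionOfUnity.exists_isSubordinate (𝓡 n) (s := (univ : Set M))
    isClosed_univ (fun x : t => (chart (n := n) (x : M)).source)
    (fun x => isOpen_extChartAt_source (x : M))
    fun y _ => by
      obtain ⟨x, hx, hy⟩ := ht y
      exact mem_iUnion.2 ⟨⟨x, hx⟩, hy⟩
  let F : t → SFun n M := fun i => χ i * f
  have hsum : ∀ y, f y = ∑ i, F i y := by
    intro y
    have := χ.sum_eq_one (mem_univ y)
    rw [finsum_eq_sum_of_fintype] at this
    simp only [F, ContMDiffMap.coe_mul, Pi.mul_apply, ← Finset.sum_mul, this, one_mul]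
  have hF : ∀ i, ∫ y, F i y * divergence g v y ∂riemVol g = -∫ y, dL (F i) y (v y) ∂riemVol g := by
    intro i
    have hs : tsupport (F i) ⊆ (chart (n := n) (i : M)).source := by
      refine subset_trans ?_ (hχ i)
      simp only [F, ContMDiffMap.coe_mul]
      exact tsupport_mul_subset_left
    rw [← integral_mul_divCoord g (i : M) v (F i) hs]
    refine integral_congr_ae (Filter.Eventually.of_forall fun y => ?_)
    by_cases hy : y ∈ (chart (n := n) (i : M)).source
    · simp only [divCoord_eq_divergence g v hy]
    · have : F i y = 0 := image_eq_zero_of_notMem_tsupport fun h => hy (hs h)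
      simp only [this, zero_mul]
  have hd : ∀ y, dL f y (v y) = ∑ i, dL (F i) y (v y) := by
    intro y
    have h1 : (f : M → ℝ) = ∑ i, (F i : M → ℝ) := by
      funext y; rw [hsum y, Finset.sum_apply]
    exact (congrArg (fun f' : M → ℝ => dL (n := n) f' y (v y)) h1).trans
      (dL_sum Finset.univ F y (v y))
  have hi1 : ∀ i, Integrable (fun y => F i y * divergence g v y) (riemVol g) := fun i =>
    integrable_riemVol g ((F i).contMDiff.continuous.mul (continuous_divergence g v))
  calc ∫ y, f y * divergence g v y ∂riemVol g
      = ∫ y, ∑ i, F i y * divergence g v y ∂riemVol g := by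
        simp only [hsum, Finset.sum_mul]
    _ = ∑ i, ∫ y, F i y * divergence g v y ∂riemVol g := integral_finsetSum _ fun i _ => hi1 i
    _ = ∑ i, -∫ y, dL (F i) y (v y) ∂riemVol g := Finset.sum_congr rfl fun i _ => hF i
    _ = -∑ i, ∫ y, dL (F i) y (v y) ∂riemVol g := Finset.sum_neg_distrib _
    _ = -∫ y, ∑ i, dL (F i) y (v y) ∂riemVol g := by
        rw [integral_finsetSum _ fun i _ => integrable_riemVol g (continuous_dL (F i) v)]
    _ = -∫ y, dL f y (v y) ∂riemVol g := by simp only [← hd]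

end Volume

/-! ### Velocities of families of diffeomorphisms -/

section Velocity

variable {P : Type*} [NormedAddCommGroup P] [NormedSpace ℝ P] {S : Set P}

/-- The derivative of `p ↦ φ_p(x)` in the direction `u`, a vector at `φ_p(x)`. -/
def famVel (φ : P → Diff n M) (p u : P) (x : M) : Vec n :=
  (mfderiv 𝓘(ℝ, P) (𝓡 n) (fun p' => φ p' x) p : P →L[ℝ] Vec n) u

/-- The derivative of the family `φ_p` in the direction `u`, as a vector field on `M`. -/
def famEul (φ : P → Diff n M) (p u : P) (y : M) : Vec n := famVel φ p u ((φ p).symm y)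

lemma eulVel_eq (φ : ℝ → Diff n M) (t : ℝ) (y : M) : eulVel φ t y = famEul φ t 1 y := by
  have : ∀ y', y' = y → (famVel φ t 1 ((φ t).symm y) : TangentSpace (𝓡 n) y') =
    famVel φ t 1 ((φ t).symm y) := fun _ _ => rfl
  exact this _ ((φ t).apply_symm_apply y)

lemma SmoothDiffOn.contMDiffAt_slice (hS : IsOpen S) {φ : P → Diff n M} (hφ : SmoothDiffOn S φ)
    {p : P} (hp : p ∈ S) (x : M) : ContMDiffAt 𝓘(ℝ, P) (𝓡 n) ∞ (fun p' => φ p' x) p :=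
  (((smoothDiffOn_iff hS).1 hφ p hp x).1).comp p (contMDiffAt_id.prodMk contMDiffAt_const)

lemma SmoothDiffOn.hasMFDerivAt (hS : IsOpen S) {φ : P → Diff n M} (hφ : SmoothDiffOn S φ)
    {p : P} (hp : p ∈ S) (x : M) : HasMFDerivAt 𝓘(ℝ, P) (𝓡 n) (fun p' => φ p' x) p
      (mfderiv 𝓘(ℝ, P) (𝓡 n) (fun p' => φ p' x) p) :=
  ((hφ.contMDiffAt_slice hS hp x).mdifferentiableAt (by simp)).hasMFDerivAt

lemma SmoothDiffOn.contMDiffAt_famVel (hS : IsOpen S) {φ : P → Diff n M} (hφ : SmoothDiffOn S φ)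
    {p : P} (hp : p ∈ S) (u : P) (x : M) :
    ContMDiffAt (𝓘(ℝ, P).prod (𝓡 n)) (𝓡 n).tangent ∞
      (fun q : P × M => (⟨φ q.1 q.2, famVel φ q.1 u q.2⟩ : TangentBundle (𝓡 n) M)) (p, x) := by
  refine contMDiffAt_mfderiv_along (IN := 𝓘(ℝ, P).prod (𝓡 n)) (IA := 𝓘(ℝ, P)) (IB := 𝓡 n)
    (q₀ := (p, x)) (f := fun (q : P × M) (p' : P) => φ p' q.2) (a := fun q => q.1)
    (V := fun _ => u) ?_ (contMDiffAt_tangent_vectorSpace.2 ⟨contMDiffAt_fst, contMDiffAt_const⟩)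
  exact ContMDiffAt.comp (I' := 𝓘(ℝ, P).prod (𝓡 n)) ((p, x), p)
    (g := fun q : P × M => φ q.1 q.2) (f := fun q : (P × M) × P => (q.2, q.1.2))
    ((smoothDiffOn_iff hS).1 hφ p hp x).1
    (contMDiffAt_snd.prodMk (contMDiffAt_snd.comp _ contMDiffAt_fst))

lemma SmoothDiffOn.smoothFieldOn_famEul (hS : IsOpen S) {φ : P → Diff n M} (hφ : SmoothDiffOn S φ)
    (u : P) : SmoothFieldOn S (fun p y => famEul φ p u y) := by
  refine (smoothFieldOn_iff hS).2 fun p hp y => ?_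
  have h1 := hφ.contMDiffAt_famVel hS hp u ((φ p).symm y)
  have h2 : ContMDiffAt (𝓘(ℝ, P).prod (𝓡 n)) (𝓘(ℝ, P).prod (𝓡 n)) ∞
      (fun q : P × M => (q.1, (φ q.1).symm q.2)) (p, y) :=
    contMDiffAt_fst.prodMk ((smoothDiffOn_iff hS).1 hφ p hp y).2
  refine (ContMDiffAt.comp (p, y) h1 h2).congr_of_eventuallyEq
    (Filter.Eventually.of_forall fun q => ?_)
  have : ∀ y', y' = q.2 → (⟨q.2, famEul φ q.1 u q.2⟩ : TangentBundle (𝓡 n) M) =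
    ⟨y', famEul φ q.1 u q.2⟩ := by rintro _ rfl; rfl
  exact this _ ((φ q.1).apply_symm_apply q.2)

lemma SmoothDiffOn.smoothFieldOn_eulVel {J : Set ℝ} (hJ : IsOpen J) {φ : ℝ → Diff n M}
    (hφ : SmoothDiffOn J φ) : SmoothFieldOn J (eulVel φ) := by
  have : eulVel φ = fun t y => (famEul φ t 1 y : TangentSpace (𝓡 n) y) := by
    funext t y; exact eulVel_eq φ t y
  rw [this]
  exact hφ.smoothFieldOn_famEul hJ 1

/-- The chain rule for the velocity of a curve of diffeomorphisms inside a family. -/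
lemma SmoothDiffOn.lagVel_comp (hS : IsOpen S) {φ : P → Diff n M} (hφ : SmoothDiffOn S φ)
    {k : ℝ → P} {t : ℝ} {u : P} (hk : HasDerivAt k u t) (hp : k t ∈ S) (x : M) :
    lagVel (fun s => φ (k s)) t x = famVel φ (k t) u x := by
  have h1 : HasMFDerivAt 𝓘(ℝ, ℝ) 𝓘(ℝ, P) k t (ContinuousLinearMap.toSpanSingleton ℝ u) :=
    hk.hasFDerivAt.hasMFDerivAt
  have h := (hφ.hasMFDerivAt hS hp x).comp t h1
  have := congrArg (fun L : ℝ →L[ℝ] Vec n => L 1) h.mfderiv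
  exact this.trans (congrArg (mfderiv 𝓘(ℝ, P) (𝓡 n) (fun p' => φ p' x) (k t) : P →L[ℝ] Vec n)
    (one_smul ℝ u))

lemma famEul_apply (φ : P → Diff n M) (p u : P) (x : M) : famEul φ p u (φ p x) = famVel φ p u x := by
  rw [famEul, (φ p).symm_apply_apply]

lemma eulVel_apply (φ : ℝ → Diff n M) (t : ℝ) (x : M) : eulVel φ t (φ t x) = lagVel φ t x :=
  (eulVel_eq φ t (φ t x)).trans (famEul_apply φ t 1 x)

/-- The derivative of `f (φ_t(x))`. -/
lemma hasDerivAt_comp_curve {f : M → ℝ} (hf : ContMDiff (𝓡 n) 𝓘(ℝ, ℝ) ∞ f) {c : ℝ → M} {t : ℝ}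
    (hc : MDifferentiableAt 𝓘(ℝ, ℝ) (𝓡 n) c t) :
    HasDerivAt (fun s => f (c s)) (dL f (c t) (curveVel (n := n) c t)) t := by
  have h := ((hf.mdifferentiable (by simp) (c t)).hasMFDerivAt).comp t hc.hasMFDerivAt
  have h' : HasFDerivAt (fun s => f (c s))
      ((dL f (c t)).comp (mfderiv 𝓘(ℝ, ℝ) (𝓡 n) c t : ℝ →L[ℝ] Vec n)) t := h.hasFDerivAt
  exact h'.hasDerivAt

end Velocity

/-! ### The continuity equation -/

/-- A family of smooth vector fields at a parameter. -/
def SmoothFieldOn.toVField {P : Type*} [NormedAddCommGroup P] [NormedSpace ℝ P] {S : Set P}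
    {v : P → (x : M) → TangentSpace (𝓡 n) x} (h : SmoothFieldOn S v) {p : P} (hp : p ∈ S) :
    VField n M := ⟨v p, h.vfield hp⟩

/-- A family of smooth functions at a parameter. -/
def SmoothFunOn.toSFun {P : Type*} [NormedAddCommGroup P] [NormedSpace ℝ P] {S : Set P}
    {f : P → M → ℝ} (h : SmoothFunOn n S f) {p : P} (hp : p ∈ S) :
    SFun n M := ⟨f p, h.sfun hp⟩

/-- The product of a smooth function and a smooth vector field. -/
def smulField (f : SFun n M) (v : VField n M) : VField n M :=
  ((smoothFieldOn_const (univ : Set ℝ) v).smul isOpen_univ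
    (smoothFunOn_const univ f)).toVField (mem_univ (0 : ℝ))

section Volume

variable [CompactSpace M] [T2Space M] [MeasurableSpace M] [BorelSpace M]

/-- Transport of a density: `d/dt ∫ f φ_{t*}(s μ) = ∫ (v_t f) φ_{t*}(s μ)`. -/
lemma integral_mul_deriv_push (g : RMetric n M) {J : Set ℝ} (hJ : IsOpen J) {φ : ℝ → Diff n M}
    (hφ : SmoothDiffOn J φ) (s f : SFun n M) {t : ℝ} (ht : t ∈ J) :
    ∫ y, f y * deriv (fun r => push g (φ r) s y) t ∂riemVol g =
      ∫ y, dL f y (eulVel φ t y) * push g (φ t) s y ∂riemVol g := by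
  have hp := hφ.push hJ g s.contMDiff
  have h1 := hasDerivAt_integral_family g hJ ((smoothFunOn_const J f).mul hp) ht
  have h2 : SmoothFunOn n J (fun r x => f (φ r x) * s x) :=
    ((smoothFunOn_const J f).comp_diff hφ.1).mul (smoothFunOn_const J s)
  have h3 := hasDerivAt_integral_family g hJ h2 ht
  have e : (fun r => ∫ y, f y * push g (φ r) s y ∂riemVol g) =
      fun r => ∫ x, f (φ r x) * s x ∂riemVol g := by
    funext r; exact integral_mul_push g (φ r) f s
  rw [e] at h1
  have h4 := h1.unique h3
  have e1 : ∀ y, deriv (fun r => f y * push g (φ r) s y) t =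
      f y * deriv (fun r => push g (φ r) s y) t := fun y =>
    ((hp.hasDerivAt hJ ht y).const_mul (f y)).deriv
  have e2 : ∀ x, deriv (fun r => f (φ r x) * s x) t = dL f (φ t x) (lagVel φ t x) * s x := fun x =>
    ((hasDerivAt_comp_curve f.contMDiff
      (c := fun r => φ r x) ((hφ.contMDiffAt_slice hJ ht x).mdifferentiableAt
        (by simp))).mul_const (s x)).deriv
  simp only [e1, e2] at h4
  rw [h4, integral_mul_push g (φ t) (fun y => dL f y (eulVel φ t y)) s]
  refine integral_congr_ae (Filter.Eventually.of_forall fun x => ?_)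
  exact congrArg (fun w : Vec n => dL f (φ t x) w * s x) (eulVel_apply φ t x).symm

/-- The continuity equation for the transported density `φ_{t*}(s μ)`. -/
lemma deriv_push_add_divergence (g : RMetric n M) {J : Set ℝ} (hJ : IsOpen J) {φ : ℝ → Diff n M}
    (hφ : SmoothDiffOn J φ) (s : SFun n M) {t : ℝ} (ht : t ∈ J) (x : M) :
    deriv (fun r => push g (φ r) s x) t +
      divergence g (fun y => push g (φ t) s y • eulVel φ t y) x = 0 := by
  have hp := hφ.push hJ g s.contMDiff
  have hv := hφ.smoothFieldOn_eulVel hJ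
  let w : VField n M := smulField (hp.toSFun ht) (hv.toVField ht)
  have hd := (hp.deriv hJ).sfun ht
  refine eq_zero_of_forall_integral_mul g
    (F := fun x => deriv (fun r => push g (φ r) s x) t + divergence g w x)
    (hd.continuous.add (continuous_divergence g w)) (fun f => ?_) x
  simp only [mul_add]
  rw [integral_add (f := fun x => f x * deriv (fun r => push g (φ r) s x) t)
    (g := fun x => f x * divergence g w x)
    (integrable_riemVol g (f.contMDiff.continuous.mul hd.continuous))
    (integrable_riemVol g (f.contMDiff.continuous.mul (continuous_divergence g w))),
    integral_mul_deriv_push g hJ hφ s f ht, integral_mul_divergence, ← sub_eq_add_neg, sub_eq_zero]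
  refine integral_congr_ae (Filter.Eventually.of_forall fun y => ?_)
  exact (mul_comm _ _).trans ((dL f y).map_smul (push g (φ t) s y) (eulVel φ t y)).symm

end Volume

/-! ### The Levi-Civita derivative -/

lemma fieldCoord_self (x : M) (v : (y : M) → TangentSpace (𝓡 n) y) :
    fieldCoord x v (chart (n := n) x x) = v x := by
  rw [fieldCoord_eq]
  have : ∀ y, y = x → toCoord (n := n) x y (v y) = v x := by
    rintro _ rfl
    exact congrArg (fun L : Vec n →L[ℝ] Vec n => L (v _)) (toCoord_self _)
  exact this _ ((chart (n := n) x).left_inv (mem_extChartAt_source x))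

/-- The metric in the coordinates of a chart. -/
lemma metricAt_eq_metricL (g : RMetric n M) {x y : M} (hy : y ∈ (chart (n := n) x).source)
    (u w : Vec n) : metricAt g y u w =
      metricL g x (chart (n := n) x y) (toCoord x y u) (toCoord x y w) := by
  rw [metricL, ContinuousLinearMap.bilinearComp_apply, (chart (n := n) x).left_inv hy,
    ofCoord_toCoord hy, ofCoord_toCoord hy]

lemma metricL_self (g : RMetric n M) (x : M) :
    metricL g x (chart (n := n) x x) = metricAt g x := by
  ext u w
  rw [metricAt_eq_metricL g (mem_extChartAt_source x), toCoord_self]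
  rfl

set_option synthInstance.maxHeartbeats 200000 in
/-- The derivative of the metric coefficients at `x`, in the chart at `x`. -/
def dMet (g : RMetric n M) (x : M) : Vec n →L[ℝ] Vec n →L[ℝ] Vec n →L[ℝ] ℝ :=
  fderiv ℝ (metricL g x) (chart (n := n) x x)

set_option synthInstance.maxHeartbeats 200000 in
lemma hasFDerivAt_metricL (g : RMetric n M) (x : M) :
    HasFDerivAt (metricL g x) (dMet g x) (chart (n := n) x x) :=
  (((contDiffOn_metricL g x).contDiffAt (extChartAt_target_mem_nhds (I := 𝓡 n) x)).differentiableAt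
    (by simp)).hasFDerivAt

lemma dMetric_eq (g : RMetric n M) (x : M) (a w z : Vec n) :
    dMetric g x a w z = dMet g x a w z := by
  have h : (fun p => metricCoord g x p w z) =ᶠ[𝓝 (chart (n := n) x x)]
      fun p => metricL g x p w z := by
    filter_upwards [extChartAt_target_mem_nhds (I := 𝓡 n) x] with p hp using metricCoord_eq g hp w z
  rw [dMetric, h.fderiv_eq]
  have h2 := ((hasFDerivAt_metricL g x).clm_apply (hasFDerivAt_const w _)).clm_apply
    (hasFDerivAt_const z _)
  rw [h2.fderiv]
  simp

lemma dMet_symm (g : RMetric n M) (x : M) (a w z : Vec n) : dMet g x a w z = dMet g x a z w := by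
  rw [← dMetric_eq, ← dMetric_eq, dMetric, dMetric]
  congr 2
  funext p
  exact g.symm _ _ _

/-- The defining property of the Christoffel symbol. -/
lemma metricAt_christoffel (g : RMetric n M) (x : M) (u w z : Vec n) :
    metricAt g x (christoffel g x u w) z =
      (dMet g x u w z + dMet g x w u z - dMet g x z u w) / 2 := by
  let L : Vec n →L[ℝ] ℝ := (1 / 2 : ℝ) • (dMet g x u w + dMet g x w u -
    ((ContinuousLinearMap.apply ℝ ℝ w).comp ((dMet g x).flip u)))
  obtain ⟨y, hy⟩ := metricAt_surjective g x L
  have h : ∃ y : TangentSpace (𝓡 n) x, (fun z : TangentSpace (𝓡 n) x => g.inner x y z) =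
      fun z => (dMetric g x u w z + dMetric g x w u z - dMetric g x z u w) / 2 := by
    refine ⟨y, funext fun z => ?_⟩
    refine (congrArg (fun L : Vec n →L[ℝ] ℝ => L z) hy).trans ?_
    have : ∀ z : Vec n, L z = (dMetric g x u w z + dMetric g x w u z - dMetric g x z u w) / 2 := by
      intro z
      rw [dMetric_eq, dMetric_eq, dMetric_eq]
      show (1 / 2 : ℝ) * (dMet g x u w z + dMet g x w u z - dMet g x z u w) = _
      ring
    exact this z
  refine (congrFun (Function.invFun_eq h) z).trans ?_
  rw [dMetric_eq, dMetric_eq, dMetric_eq]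

lemma dL_self {f : M → ℝ} {x : M} (hf : MDifferentiableAt (𝓡 n) 𝓘(ℝ, ℝ) f x) :
    HasFDerivAt (fun z => f ((chart (n := n) x).symm z)) (dL f x) (chart (n := n) x x) := by
  have h := hasFDerivAt_comp_chart_symm (mem_extChartAt_source x) hf
  rwa [ofCoord_self, ContinuousLinearMap.comp_id] at h

lemma hasFDerivAt_fieldCoord (v : VField n M) (x : M) :
    HasFDerivAt (fieldCoord x v) (fderiv ℝ (fieldCoord x v) (chart (n := n) x x))
      (chart (n := n) x x) :=
  (((contDiffOn_fieldCoord x v).contDiffAt (extChartAt_target_mem_nhds (I := 𝓡 n) x)).differentiableAt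
    (by simp)).hasFDerivAt

/-- The commutator of vector fields in coordinates. -/
lemma lieField_apply (v u : VField n M) (x : M) :
    lieField v u x = fderiv ℝ (fieldCoord x u) (chart (n := n) x x) (v x) -
      fderiv ℝ (fieldCoord x v) (chart (n := n) x x) (u x) := by
  have hpull : ∀ w : VField n M, (VectorField.mpullbackWithin 𝓘(ℝ, Vec n) (𝓡 n)
      (extChartAt (𝓡 n) x).symm w (range (𝓡 n)) : Vec n → Vec n) =ᶠ[𝓝 (chart (n := n) x x)]
      fieldCoord x w := by
    intro w
    filter_upwards [extChartAt_target_mem_nhds (I := 𝓡 n) x] with z hz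
    have hy := (chart (n := n) x).map_target hz
    have e1 : (mfderivWithin 𝓘(ℝ, Vec n) (𝓡 n) (extChartAt (𝓡 n) x).symm (range (𝓡 n)) z :
        Vec n →L[ℝ] Vec n) = ofCoord x ((chart (n := n) x).symm z) := by
      rw [modelWithCornersSelf_coe, range_id, mfderivWithin_univ]
      ext1 u
      exact coordVec_eq hz u
    have e2 : (ofCoord (n := n) x ((chart (n := n) x).symm z)).inverse =
        toCoord x ((chart (n := n) x).symm z) :=
      ContinuousLinearMap.inverse_eq (by ext1 u; exact ofCoord_toCoord hy u)
        (by ext1 u; exact toCoord_ofCoord hy u)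
    have e3 := e2
    rw [← e1] at e3
    exact congrArg (fun L : Vec n →L[ℝ] Vec n => L (w ((chart (n := n) x).symm z))) e3
  have e4 : (mfderiv (𝓡 n) 𝓘(ℝ, Vec n) (extChartAt (𝓡 n) x) x : Vec n →L[ℝ] Vec n).inverse =
      ContinuousLinearMap.id ℝ _ :=
    (congrArg ContinuousLinearMap.inverse (toCoord_self x)).trans ContinuousLinearMap.inverse_id
  have e5 : ∀ A B : Vec n → Vec n, A =ᶠ[𝓝 (chart (n := n) x x)] fieldCoord x v →
      B =ᶠ[𝓝 (chart (n := n) x x)] fieldCoord x u → ∀ s : Set (Vec n), s = univ →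
      VectorField.lieBracketWithin ℝ A B s (chart (n := n) x x) =
      fderiv ℝ (fieldCoord x u) (chart (n := n) x x) (v x) -
        fderiv ℝ (fieldCoord x v) (chart (n := n) x x) (u x) := by
    rintro A B hA hB _ rfl
    rw [VectorField.lieBracketWithin_univ, hA.lieBracket_vectorField_eq hB, VectorField.lieBracket,
      fieldCoord_self, fieldCoord_self]
  exact (congrArg (fun L : Vec n →L[ℝ] Vec n => L _) e4).trans
    (e5 _ _ (hpull v) (hpull u) _ (by simp))

/-- The pointwise inner product of vector fields. -/
def innerFun (g : RMetric n M) (v w : VField n M) : SFun n M :=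
  ((smoothFieldOn_const (univ : Set ℝ) v).metric isOpen_univ g
    (smoothFieldOn_const univ w)).toSFun (mem_univ (0 : ℝ))

lemma innerFun_apply (g : RMetric n M) (v w : VField n M) (x : M) :
    innerFun g v w x = metricAt g x (v x) (w x) := rfl

/-- The derivative of `g(v, w)` in coordinates. -/
lemma dL_innerFun (g : RMetric n M) (v w : VField n M) (x : M) (u : Vec n) :
    dL (innerFun g v w) x u = dMet g x u (v x) (w x) +
      metricAt g x (fderiv ℝ (fieldCoord x v) (chart (n := n) x x) u) (w x) +
      metricAt g x (v x) (fderiv ℝ (fieldCoord x w) (chart (n := n) x x) u) := by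
  have h1 := dL_self ((innerFun g v w).contMDiff.mdifferentiable (by simp) x)
  have h2 := ((hasFDerivAt_metricL g x).clm_apply (hasFDerivAt_fieldCoord v x)).clm_apply
    (hasFDerivAt_fieldCoord w x)
  have h3 : (fun z => innerFun g v w ((chart (n := n) x).symm z)) =ᶠ[𝓝 (chart (n := n) x x)]
      fun z => metricL g x z (fieldCoord x v z) (fieldCoord x w z) := by
    filter_upwards [extChartAt_target_mem_nhds (I := 𝓡 n) x] with z hz
    rw [innerFun_apply]
    refine (metricAt_eq_metricL g ((chart (n := n) x).map_target hz) _ _).trans ?_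
    rw [(chart (n := n) x).right_inv hz]
    rfl
  rw [h1.unique (h2.congr_of_eventuallyEq h3), fieldCoord_self, fieldCoord_self, metricL_self]
  have : ∀ a b c : ℝ, a + (c + b) = b + c + a := fun a b c => by ring
  exact this _ _ _

/-- The identity `g(v, [v, X]) = v g(v, X) - g(∇_v v, X) - X |v|² / 2`, by which the bracket of the
Lie-Poisson structure produces the covariant derivative. -/
lemma metricAt_lieField (g : RMetric n M) (v X : VField n M) (x : M) :
    metricAt g x (v x) (lieField v X x) = dL (innerFun g v X) x (v x) -
      metricAt g x (covDeriv g v v x) (X x) - dL (innerFun g v v) x (X x) / 2 := by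
  have e1 : metricAt g x (covDeriv g v v x) (X x) =
      metricAt g x (fderiv ℝ (fieldCoord x v) (chart (n := n) x x) (v x)) (X x) +
      metricAt g x (christoffel g x (v x) (v x)) (X x) := by
    rw [covDeriv]
    exact congrArg (fun L : Vec n →L[ℝ] ℝ => L (X x)) ((metricAt g x).map_add _ _)
  have e2 : metricAt g x (v x) (lieField v X x) =
      metricAt g x (v x) (fderiv ℝ (fieldCoord x X) (chart (n := n) x x) (v x)) -
      metricAt g x (v x) (fderiv ℝ (fieldCoord x v) (chart (n := n) x x) (X x)) := by
    rw [lieField_apply]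
    exact (metricAt g x (v x)).map_sub _ _
  have e3 := metricAt_christoffel g x (v x) (v x) (X x)
  have e4 := metricAt_symm g x (fderiv ℝ (fieldCoord x v) (chart (n := n) x x) (X x)) (v x)
  have alg : ∀ {A B C D E F G H K L N : ℝ}, B = F - G → C = D + E → E = (H + H - K) / 2 →
      L = G → A = H + D + F → N = K + L + G → B = A - C - N / 2 := by
    intros; linarith
  exact alg e2 e1 e3 e4 (dL_innerFun g v X x (v x)) (dL_innerFun g v v x (X x))

/-! ### The acceleration of curves -/

section ChartCurve

variable {P : Type*} [NormedAddCommGroup P] [NormedSpace ℝ P]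

lemma hasFDerivAt_chart_comp {c : P → M} {p : P} {x : M} (hc : MDifferentiableAt 𝓘(ℝ, P) (𝓡 n) c p)
    (hx : c p ∈ (chart (n := n) x).source) :
    HasFDerivAt (fun p' => chart (n := n) x (c p'))
      ((toCoord x (c p)).comp (mfderiv 𝓘(ℝ, P) (𝓡 n) c p : P →L[ℝ] Vec n)) p := by
  have h1 : MDifferentiableAt (𝓡 n) 𝓘(ℝ, Vec n) (chart (n := n) x) (c p) :=
    (contMDiffAt_extChartAt' (n := ∞) (by rwa [extChartAt_source] at hx)).mdifferentiableAt (by simp)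
  exact (h1.hasMFDerivAt.comp p hc.hasMFDerivAt).hasFDerivAt

end ChartCurve

lemma hasDerivAt_chart_comp {c : ℝ → M} {t : ℝ} {x : M} (hc : MDifferentiableAt 𝓘(ℝ, ℝ) (𝓡 n) c t)
    (hx : c t ∈ (chart (n := n) x).source) :
    HasDerivAt (fun s => chart (n := n) x (c s)) (toCoord x (c t) (curveVel (n := n) c t)) t :=
  (hasFDerivAt_chart_comp hc hx).hasDerivAt

lemma contDiffAt_fieldCoord_family {J : Set ℝ} (hJ : IsOpen J)
    {v : ℝ → (x : M) → TangentSpace (𝓡 n) x} (hv : SmoothFieldOn J v) {t : ℝ} (ht : t ∈ J) (x : M)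
    {z : Vec n} (hz : z ∈ (chart (n := n) x).target) :
    ContDiffAt ℝ ∞ (fun p : ℝ × Vec n => fieldCoord x (v p.1) p.2) (t, z) := by
  have hb : ContMDiffAt 𝓘(ℝ, Vec n) (𝓡 n) ∞ (chart (n := n) x).symm z :=
    (contMDiffOn_extChartAt_symm x).contMDiffAt (extChartAt_target_mem_nhds' (I := 𝓡 n) hz)
  have h1 : ContMDiffAt (𝓘(ℝ, ℝ).prod 𝓘(ℝ, Vec n)) (𝓘(ℝ, ℝ).prod (𝓡 n)) ∞
      (fun p : ℝ × Vec n => (p.1, (chart (n := n) x).symm p.2)) (t, z) :=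
    contMDiffAt_fst.prodMk (ContMDiffAt.comp (t, z) hb contMDiffAt_snd)
  have h2 := ContMDiffAt.comp (t, z) ((smoothFieldOn_iff hJ).1 hv t ht _) h1
  have h3 : ContMDiffAt (𝓘(ℝ, ℝ).prod 𝓘(ℝ, Vec n)) 𝓘(ℝ, Vec n) ∞
      (fun p : ℝ × Vec n => fieldCoord x (v p.1) p.2) (t, z) := ((contMDiffAt_field_iff' (b := fun p : ℝ × Vec n => (chart (n := n) x).symm p.2)
    (V := fun p : ℝ × Vec n => v p.1 ((chart (n := n) x).symm p.2)) (q₀ := (t, z))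
    ((chart (n := n) x).map_target hz)).1 h2).2
  rw [← modelWithCornersSelf_prod, chartedSpaceSelf_prod] at h3
  exact h3.contDiffAt

/-- The acceleration of an integral curve of a time-dependent vector field is its material
derivative. -/
lemma curveAccel_eq (g : RMetric n M) {J : Set ℝ} (hJ : IsOpen J)
    {v : ℝ → (x : M) → TangentSpace (𝓡 n) x} (hv : SmoothFieldOn J v) {t : ℝ} (ht : t ∈ J)
    {c : ℝ → M} (hc : ∀ s ∈ J, MDifferentiableAt 𝓘(ℝ, ℝ) (𝓡 n) c s ∧ curveVel c s = v s (c s)) :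
    curveAccel g c t = deriv (fun s => v s (c t)) t + covDeriv g (v t) (v t) (c t) := by
  let V : ℝ × Vec n → Vec n := fun p => fieldCoord (c t) (v p.1) p.2
  let z := chart (n := n) (c t) (c t)
  have hz : z ∈ (chart (n := n) (c t)).target :=
    (chart (n := n) (c t)).map_source (mem_extChartAt_source _)
  have hV : HasFDerivAt V (fderiv ℝ V (t, z)) (t, z) :=
    ((contDiffAt_fieldCoord_family hJ hv ht (c t) hz).differentiableAt (by simp)).hasFDerivAt
  have h1 : HasDerivAt (F := Vec n) (fun s => v s (c t)) (fderiv ℝ V (t, z) (1, 0)) t := by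
    have := hV.comp_hasDerivAt t ((hasDerivAt_id t).prodMk (hasDerivAt_const t z))
    refine this.congr_of_eventuallyEq (Filter.Eventually.of_forall fun s => ?_)
    exact (fieldCoord_self (c t) (v s)).symm
  have h2 : HasFDerivAt (fieldCoord (c t) (v t))
      ((fderiv ℝ V (t, z)).comp (ContinuousLinearMap.inr ℝ ℝ (Vec n))) z :=
    hV.comp z ((hasFDerivAt_const t z).prodMk (hasFDerivAt_id z))
  -- in the chart at `c t`, the curve solves `dq/ds = V (s, q)` near `t`
  have hq : ∀ s ∈ J, c s ∈ (chart (n := n) (c t)).source →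
      HasDerivAt (fun s => chart (n := n) (c t) (c s)) (V (s, chart (n := n) (c t) (c s))) s := by
    intro s hs hcs
    convert hasDerivAt_chart_comp (hc s hs).1 hcs using 1
    have : ∀ y, y = c s → toCoord (n := n) (c t) y (v s y) = toCoord (c t) (c s) (curveVel c s) := by
      rintro _ rfl
      exact congrArg (toCoord (c t) (c s)) (hc s hs).2.symm
    exact this _ ((chart (n := n) (c t)).left_inv hcs)
  have hev : ∀ᶠ s in 𝓝 t, s ∈ J ∧ c s ∈ (chart (n := n) (c t)).source :=
    (hJ.eventually_mem ht).and ((hc t ht).1.continuousAt.preimage_mem_nhds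
      ((isOpen_extChartAt_source (c t)).mem_nhds (mem_extChartAt_source _)))
  have h3 : deriv (fun s => chart (n := n) (c t) (c s)) =ᶠ[𝓝 t]
      fun s => V (s, chart (n := n) (c t) (c s)) := by
    filter_upwards [hev] with s hs using (hq s hs.1 hs.2).deriv
  have hvt : V (t, z) = v t (c t) := fieldCoord_self (c t) (v t)
  have h4 : HasDerivAt (fun s => V (s, chart (n := n) (c t) (c s)))
      (fderiv ℝ V (t, z) (1, v t (c t))) t := by
    have := hV.comp_hasDerivAt t ((hasDerivAt_id t).prodMk (hq t ht (mem_extChartAt_source _)))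
    rwa [hvt] at this
  -- hence its second derivative is `∂_s V + D_z V · V`
  have h5 : iteratedDeriv 2 (fun s => chart (n := n) (c t) (c s)) t =
      fderiv ℝ V (t, z) (1, 0) + fderiv ℝ V (t, z) (0, v t (c t)) := by
    rw [iteratedDeriv_succ, iteratedDeriv_one, h3.deriv_eq, h4.deriv]
    have : ∀ w : Vec n, fderiv ℝ V (t, z) (1, w) =
        fderiv ℝ V (t, z) (1, 0) + fderiv ℝ V (t, z) (0, w) := fun w => by
      rw [← map_add, Prod.mk_add_mk, add_zero, zero_add]
    exact this _
  have e1 : deriv (F := Vec n) (fun s => v s (c t)) t = fderiv ℝ V (t, z) (1, 0) := h1.deriv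
  have e2 : fderiv ℝ (fieldCoord (c t) (v t)) z (v t (c t)) =
      fderiv ℝ V (t, z) (0, v t (c t)) := by rw [h2.fderiv]; rfl
  have e3 : ∀ {a b d A B C : Vec n}, a = b + d → A = b → B = d → a + C = A + (B + C) := by
    rintro a b d A B C rfl rfl rfl; rw [add_assoc]
  have e4 : christoffel g (c t) (curveVel c t) (curveVel c t) =
    christoffel g (c t) (v t (c t)) (v t (c t)) := by rw [(hc t ht).2]
  rw [curveAccel, e4]
  exact e3 h5 e1 e2

/-- The acceleration of the paths of a curve of diffeomorphisms. -/
lemma SmoothDiffOn.curveAccel_eq (g : RMetric n M) {J : Set ℝ} (hJ : IsOpen J) {φ : ℝ → Diff n M}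
    (hφ : SmoothDiffOn J φ) {t : ℝ} (ht : t ∈ J) (x : M) :
    curveAccel g (fun s => φ s x) t = deriv (fun s => eulVel φ s (φ t x)) t +
      covDeriv g (eulVel φ t) (eulVel φ t) (φ t x) :=
  FullEuler.curveAccel_eq g hJ (hφ.smoothFieldOn_eulVel hJ) ht (c := fun s => φ s x) fun s hs =>
    ⟨(hφ.contMDiffAt_slice hJ hs x).mdifferentiableAt (by simp), (eulVel_apply φ s x).symm⟩

/-! ### The first variation of the kinetic energy -/

set_option synthInstance.maxHeartbeats 200000 in
lemma fderiv_bilinear_comp {P : Type*} [NormedAddCommGroup P] [NormedSpace ℝ P]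
    {G : Vec n → Vec n →L[ℝ] Vec n →L[ℝ] ℝ} {q A B : P → Vec n}
    {G' : Vec n →L[ℝ] Vec n →L[ℝ] Vec n →L[ℝ] ℝ} {q' A' B' : P →L[ℝ] Vec n} {p : P}
    (hG : HasFDerivAt G G' (q p)) (hq : HasFDerivAt q q' p) (hA : HasFDerivAt A A' p)
    (hB : HasFDerivAt B B' p) (u : P) :
    fderiv ℝ (fun p => G (q p) (A p) (B p)) p u =
      G' (q' u) (A p) (B p) + G (q p) (A' u) (B p) + G (q p) (A p) (B' u) := by
  have h0 : HasFDerivAt (G ∘ q) (G'.comp q') p := HasFDerivAt.comp (g := G) (g' := G') p hG hq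
  have h1 : HasFDerivAt (fun p => G (q p)) (G'.comp q') p := h0
  have h2 := h1.clm_apply hA
  have h3 := h2.clm_apply hB
  rw [h3.fderiv]
  simp only [_root_.add_apply, ContinuousLinearMap.comp_apply, ContinuousLinearMap.flip_apply]
  ring

lemma metricAt_curveAccel (g : RMetric n M) (c : ℝ → M) (t : ℝ) (w : Vec n) :
    metricAt g (c t) w (curveAccel g c t) =
      metricAt g (c t) w (iteratedDeriv 2 (fun s => chart (n := n) (c t) (c s)) t) +
      (dMet g (c t) (curveVel c t) (curveVel c t) w + dMet g (c t) (curveVel c t) (curveVel c t) w -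
        dMet g (c t) w (curveVel c t) (curveVel c t)) / 2 := by
  have h3 := metricAt_christoffel g (c t) (curveVel c t) (curveVel c t) w
  exact ((metricAt g (c t) w).map_add _ _).trans
    (congrArg (_ + ·) ((metricAt_symm g (c t) _ _).trans h3))

/-- The second derivative along the second variable, as a value of the second derivative. -/
lemma iteratedDeriv_two_slice {E : Type*} [NormedAddCommGroup E] [NormedSpace ℝ E]
    {q : ℝ × ℝ → E} {p : ℝ × ℝ} (hq : ContDiffAt ℝ ∞ q p) :
    iteratedDeriv 2 (fun s => q (p.1, s)) p.2 = fderiv ℝ (fderiv ℝ q) p (0, 1) (0, 1) := by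
  have hk : ∀ s : ℝ, HasDerivAt (fun s : ℝ => ((p.1, s) : ℝ × ℝ)) (0, 1) s := fun s =>
    (hasDerivAt_const s p.1).prodMk (hasDerivAt_id s)
  have hc : ContinuousAt (fun s : ℝ => ((p.1, s) : ℝ × ℝ)) p.2 := by fun_prop
  have hev : ∀ᶠ p' in 𝓝 p, ContDiffAt ℝ 1 q p' :=
    (hq.of_le (m := 1) ENat.LEInfty.out).eventually (by simp)
  have h1 : deriv (fun s => q (p.1, s)) =ᶠ[𝓝 p.2] fun s => fderiv ℝ q (p.1, s) (0, 1) := by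
    filter_upwards [hc.preimage_mem_nhds hev] with s hs
    have h := (ContDiffAt.differentiableAt (n := 1) hs (by simp)).hasFDerivAt
    exact (h.comp_hasDerivAt s (hk s)).deriv
  have hq2 : HasFDerivAt (fderiv ℝ q) (fderiv ℝ (fderiv ℝ q) p) p :=
    ((hq.fderiv_right (m := 1) (by rw [one_add_one_eq_two]; exact ENat.LEInfty.out)).differentiableAt
      (by simp)).hasFDerivAt
  rw [iteratedDeriv_succ, iteratedDeriv_one, h1.deriv_eq]
  have h2 : HasDerivAt (fun s => fderiv ℝ q (p.1, s)) (fderiv ℝ (fderiv ℝ q) p (0, 1)) p.2 :=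
    hq2.comp_hasDerivAt p.2 (hk p.2)
  have h3 := h2.clm_apply (hasDerivAt_const p.2 ((0, 1) : ℝ × ℝ))
  rw [h3.deriv, map_zero, add_zero]

section FirstVariation

variable {S : Set (ℝ × ℝ)}

/-- The inner product of the derivatives of a family in two directions. -/
def famInner (g : RMetric n M) (Φ : ℝ × ℝ → Diff n M) (a b : ℝ × ℝ) (p : ℝ × ℝ) (x : M) : ℝ :=
  metricAt g (Φ p x) (famVel Φ p a x) (famVel Φ p b x)

lemma SmoothDiffOn.famInner (hS : IsOpen S) (g : RMetric n M) {Φ : ℝ × ℝ → Diff n M}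
    (hΦ : SmoothDiffOn S Φ) (a b : ℝ × ℝ) : SmoothFunOn n S (famInner g Φ a b) :=
  (smoothFunOn_iff hS).2 fun _ hp x => contMDiffAt_metric g (hΦ.contMDiffAt_famVel hS hp a x)
    (hΦ.contMDiffAt_famVel hS hp b x)

set_option synthInstance.maxHeartbeats 200000 in
/-- The first variation of the kinetic energy of a path, by the symmetry of the Levi-Civita
derivative: `∂_ε |∂_t c|² / 2 = ∂_t g(∂_ε c, ∂_t c) - g(∂_ε c, ∇_{∂_t c} ∂_t c)`. -/
lemma fderiv_famInner (g : RMetric n M) (hS : IsOpen S) {Φ : ℝ × ℝ → Diff n M}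
    (hΦ : SmoothDiffOn S Φ) {p : ℝ × ℝ} (hp : p ∈ S) (x : M) :
    fderiv ℝ (fun p => famInner g Φ (0, 1) (0, 1) p x) p (1, 0) / 2 =
      fderiv ℝ (fun p => famInner g Φ (1, 0) (0, 1) p x) p (0, 1) -
      metricAt g (Φ p x) (famVel Φ p (1, 0) x) (curveAccel g (fun s => Φ (p.1, s) x) p.2) := by
  let y := Φ p x
  let q : ℝ × ℝ → Vec n := fun p' => chart (n := n) y (Φ p' x)
  have hsm : ∀ p' ∈ S, ContMDiffAt 𝓘(ℝ, ℝ × ℝ) (𝓡 n) ∞ (fun p => Φ p x) p' := fun p' hp' =>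
    hΦ.contMDiffAt_slice hS hp' x
  have hev : ∀ᶠ p' in 𝓝 p, p' ∈ S ∧ Φ p' x ∈ (chart (n := n) y).source :=
    (hS.eventually_mem hp).and ((hsm p hp).continuousAt.preimage_mem_nhds
      ((isOpen_extChartAt_source y).mem_nhds (mem_extChartAt_source _)))
  have hq : ContDiffAt ℝ ∞ q p := by
    have : ContMDiffAt 𝓘(ℝ, ℝ × ℝ) 𝓘(ℝ, Vec n) ∞ q p :=
      ContMDiffAt.comp p (contMDiffAt_extChartAt (x := y)) (hsm p hp)
    exact this.contDiffAt
  let D : ℝ × ℝ → (ℝ × ℝ →L[ℝ] Vec n) := fun p' => mfderiv 𝓘(ℝ, ℝ × ℝ) (𝓡 n) (fun p => Φ p x) p'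
  have hqd : ∀ p', p' ∈ S ∧ Φ p' x ∈ (chart (n := n) y).source →
      HasFDerivAt q ((toCoord y (Φ p' x)).comp (D p')) p' := fun p' h =>
    hasFDerivAt_chart_comp ((hsm p' h.1).mdifferentiableAt (by simp)) h.2
  have hqv : ∀ p', p' ∈ S ∧ Φ p' x ∈ (chart (n := n) y).source → ∀ u,
      fderiv ℝ q p' u = toCoord y (Φ p' x) (famVel Φ p' u x) := fun p' h u => by
    rw [(hqd p' h).fderiv]; rfl
  have hq2 : HasFDerivAt (fderiv ℝ q) (fderiv ℝ (fderiv ℝ q) p) p :=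
    ((hq.fderiv_right (m := 1) (by rw [one_add_one_eq_two]; exact ENat.LEInfty.out)).differentiableAt (by simp)).hasFDerivAt
  have hq1 : HasFDerivAt q (fderiv ℝ q p) p := (hq.differentiableAt (by simp)).hasFDerivAt
  -- the symmetry of second derivatives is the torsion-freeness of the Levi-Civita derivative
  have hsymm : ∀ a b, fderiv ℝ (fderiv ℝ q) p a b = fderiv ℝ (fderiv ℝ q) p b a := fun a b =>
    (hq.isSymmSndFDerivAt (by
      rw [minSmoothness_of_isRCLikeNormedField]; exact ENat.LEInfty.out)).eq a b
  have hG : HasFDerivAt (metricL g y) (dMet g y) (q p) := hasFDerivAt_metricL g y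
  have hGq : metricL g y (q p) = metricAt g y := metricL_self g y
  have hvel : ∀ u, fderiv ℝ q p u = famVel Φ p u x := fun u => by
    rw [hqv p ⟨hp, mem_extChartAt_source _⟩ u]
    exact congrArg (fun L : Vec n →L[ℝ] Vec n => L _) (toCoord_self y)
  -- the derivative of `g(∂_a c, ∂_b c)` in the direction `u`
  have key : ∀ a b u, fderiv ℝ (fun p => famInner g Φ a b p x) p u =
      dMet g y (famVel Φ p u x) (famVel Φ p a x) (famVel Φ p b x) +
      metricAt g y (fderiv ℝ (fderiv ℝ q) p u a) (famVel Φ p b x) +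
      metricAt g y (famVel Φ p a x) (fderiv ℝ (fderiv ℝ q) p u b) := by
    intro a b u
    have h1 : (fun p => famInner g Φ a b p x) =ᶠ[𝓝 p]
        fun p' => metricL g y (q p') (fderiv ℝ q p' a) (fderiv ℝ q p' b) := by
      filter_upwards [hev] with p' hp'
      rw [hqv p' hp' a, hqv p' hp' b]
      exact metricAt_eq_metricL g hp'.2 _ _
    have h2 : ∀ a, HasFDerivAt (fun p' => fderiv ℝ q p' a)
        ((ContinuousLinearMap.apply ℝ (Vec n) a).comp (fderiv ℝ (fderiv ℝ q) p)) p := fun a =>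
      (ContinuousLinearMap.apply ℝ (Vec n) a).hasFDerivAt.comp p hq2
    rw [h1.fderiv_eq, fderiv_bilinear_comp hG hq1 (h2 a) (h2 b), hGq, hvel u, hvel a, hvel b]
    rfl
  have hacc : metricAt g y (famVel Φ p (1, 0) x) (curveAccel g (fun s => Φ (p.1, s) x) p.2) =
      metricAt g y (famVel Φ p (1, 0) x) (fderiv ℝ (fderiv ℝ q) p (0, 1) (0, 1)) +
      (dMet g y (famVel Φ p (0, 1) x) (famVel Φ p (0, 1) x) (famVel Φ p (1, 0) x) +
        dMet g y (famVel Φ p (0, 1) x) (famVel Φ p (0, 1) x) (famVel Φ p (1, 0) x) -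
        dMet g y (famVel Φ p (1, 0) x) (famVel Φ p (0, 1) x) (famVel Φ p (0, 1) x)) / 2 := by
    have hk : ∀ s : ℝ, HasDerivAt (fun s : ℝ => ((p.1, s) : ℝ × ℝ)) (0, 1) s := fun s =>
      (hasDerivAt_const s p.1).prodMk (hasDerivAt_id s)
    have hcv : curveVel (n := n) (fun s => Φ (p.1, s) x) p.2 = famVel Φ p (0, 1) x :=
      hΦ.lagVel_comp hS (φ := Φ) (k := fun s => (p.1, s)) (t := p.2) (hk p.2) hp x
    have h3 := metricAt_curveAccel g (fun s => Φ (p.1, s) x) p.2 (famVel Φ p (1, 0) x)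
    refine h3.trans ?_
    rw [hcv, ← iteratedDeriv_two_slice hq]
  have e1 := metricAt_symm g y (fderiv ℝ (fderiv ℝ q) p (1, 0) (0, 1)) (famVel Φ p (0, 1) x)
  have e2 := dMet_symm g y (famVel Φ p (0, 1) x) (famVel Φ p (1, 0) x) (famVel Φ p (0, 1) x)
  refine Eq.trans ?_ (congrArg (fun r => _ - r) hacc.symm)
  rw [key, key, hsymm (0, 1) (1, 0)]
  linarith

end FirstVariation

/-! ### Thermodynamics -/

section Thermodynamics

variable {e : ℝ → ℝ → ℝ}

/-- The internal energy per unit volume `e(ρ, σ) ρ`. -/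
def energyDensity (e : ℝ → ℝ → ℝ) (p : ℝ × ℝ) : ℝ := e p.1 p.2 * p.1

/-- The derivative of the energy density in the mass density. -/
def dEnergyRho (e : ℝ → ℝ → ℝ) (p : ℝ × ℝ) : ℝ := fderiv ℝ (energyDensity e) p (1, 0)

/-- The derivative of the energy density in the entropy density. -/
def dEnergySigma (e : ℝ → ℝ → ℝ) (p : ℝ × ℝ) : ℝ := fderiv ℝ (energyDensity e) p (0, 1)

/-- The states of positive mass density. -/
abbrev posStates : Set (ℝ × ℝ) := Ioi 0 ×ˢ univ

lemma isOpen_posStates : IsOpen posStates := isOpen_Ioi.prod isOpen_univ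

variable (he : ContDiffOn ℝ ∞ (fun p : ℝ × ℝ => e p.1 p.2) (Ioi 0 ×ˢ univ))

include he

lemma contDiffOn_energyDensity : ContDiffOn ℝ ∞ (energyDensity e) posStates :=
  he.mul contDiff_fst.contDiffOn

lemma contDiffOn_dEnergyRho : ContDiffOn ℝ ∞ (dEnergyRho e) posStates :=
  ((contDiffOn_energyDensity he).fderiv_of_isOpen isOpen_posStates (by simp)).clm_apply
    contDiffOn_const

lemma contDiffOn_dEnergySigma : ContDiffOn ℝ ∞ (dEnergySigma e) posStates :=
  ((contDiffOn_energyDensity he).fderiv_of_isOpen isOpen_posStates (by simp)).clm_apply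
    contDiffOn_const

/-- The pressure is the Legendre transform of the energy density. -/
lemma pressure_eq {p : ℝ × ℝ} (hp : p ∈ posStates) : pressure e p.1 p.2 =
    p.1 * dEnergyRho e p + p.2 * dEnergySigma e p - energyDensity e p := by
  obtain ⟨r, s⟩ := p
  have hd := (he.contDiffAt (isOpen_posStates.mem_nhds hp)).differentiableAt (by simp)
  have hE := ((contDiffOn_energyDensity he).contDiffAt
    (isOpen_posStates.mem_nhds hp)).differentiableAt (by simp)
  have hr : HasDerivAt (fun r' => e r' s) (deriv (fun r' => e r' s) r) r :=
    (DifferentiableAt.comp (g := fun p : ℝ × ℝ => e p.1 p.2) (f := fun r' : ℝ => (r', s)) r hd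
      (by fun_prop)).hasDerivAt
  have hs : HasDerivAt (fun s' => e r s') (deriv (fun s' => e r s') s) s :=
    (DifferentiableAt.comp (g := fun p : ℝ × ℝ => e p.1 p.2) (f := fun s' : ℝ => (r, s')) s hd
      (by fun_prop)).hasDerivAt
  have h1 : HasDerivAt (fun r' => e r' s * r') (dEnergyRho e (r, s)) r :=
    HasFDerivAt.comp_hasDerivAt (f := fun r' : ℝ => (r', s)) r hE.hasFDerivAt
      ((hasDerivAt_id r).prodMk (hasDerivAt_const r s))
  have h2 : HasDerivAt (fun s' => e r s' * r) (dEnergySigma e (r, s)) s :=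
    HasFDerivAt.comp_hasDerivAt (f := fun s' : ℝ => (r, s')) s hE.hasFDerivAt
      ((hasDerivAt_const s r).prodMk (hasDerivAt_id s))
  rw [h1.unique (hr.mul (hasDerivAt_id r)), h2.unique (hs.mul_const r)]
  simp only [pressure, energyDensity]
  ring

lemma contDiffOn_pressure : ContDiffOn ℝ ∞ (fun p : ℝ × ℝ => pressure e p.1 p.2) posStates :=
  (((contDiff_fst.contDiffOn.mul (contDiffOn_dEnergyRho he)).add
    (contDiff_snd.contDiffOn.mul (contDiffOn_dEnergySigma he))).sub
    (contDiffOn_energyDensity he)).congr fun _ hp => pressure_eq he hp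

lemma fderiv_energyDensity {p : ℝ × ℝ} (u : ℝ × ℝ) :
    fderiv ℝ (energyDensity e) p u = dEnergyRho e p * u.1 + dEnergySigma e p * u.2 := by
  have : u = u.1 • ((1, 0) : ℝ × ℝ) + u.2 • (0, 1) := by ext <;> simp
  conv_lhs => rw [this, map_add, map_smul, map_smul, smul_eq_mul, smul_eq_mul]
  rw [dEnergyRho, dEnergySigma, mul_comm, mul_comm u.2]

/-- The Gibbs-Duhem relation `dP = ρ d(∂E/∂ρ) + σ d(∂E/∂σ)`. -/
lemma fderiv_pressure {p : ℝ × ℝ} (hp : p ∈ posStates) (u : ℝ × ℝ) :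
    fderiv ℝ (fun p : ℝ × ℝ => pressure e p.1 p.2) p u =
      p.1 * fderiv ℝ (dEnergyRho e) p u + p.2 * fderiv ℝ (dEnergySigma e) p u := by
  have hU := isOpen_posStates.mem_nhds hp
  have h1 := (((contDiffOn_dEnergyRho he).contDiffAt hU).differentiableAt (by simp)).hasFDerivAt
  have h2 := (((contDiffOn_dEnergySigma he).contDiffAt hU).differentiableAt (by simp)).hasFDerivAt
  have h3 := (((contDiffOn_energyDensity he).contDiffAt hU).differentiableAt (by simp)).hasFDerivAt
  have h4 := (((hasFDerivAt_fst (𝕜 := ℝ) (p := p)).mul h1).add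
    ((hasFDerivAt_snd (𝕜 := ℝ) (p := p)).mul h2)).sub h3
  have h5 : (fun p : ℝ × ℝ => pressure e p.1 p.2) =ᶠ[𝓝 p] fun p =>
      p.1 * dEnergyRho e p + p.2 * dEnergySigma e p - energyDensity e p := by
    filter_upwards [hU] with q hq using pressure_eq he hq
  rw [(h4.congr_of_eventuallyEq h5).fderiv]
  have := fderiv_energyDensity he (p := p) u
  simp only [_root_.sub_apply, _root_.add_apply, _root_.smul_apply, smul_eq_mul,
    ContinuousLinearMap.coe_fst', ContinuousLinearMap.coe_snd', this]
  ring

end Thermodynamics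

/-! ### Functions of the state -/

section State

/-- The function `F(ρ, σ)` of a state `(ρ, σ)` of positive mass density. -/
def stateFun {F : ℝ × ℝ → ℝ} (hF : ContDiffOn ℝ ∞ F posStates) (ρ σ : SFun n M)
    (hρ : ∀ x, 0 < ρ x) : SFun n M :=
  ((smoothFunOn_const (univ : Set ℝ) ρ).comp₂ isOpen_univ (smoothFunOn_const univ σ)
    isOpen_posStates hF fun _ _ x => ⟨hρ x, mem_univ _⟩).toSFun (mem_univ (0 : ℝ))

lemma dL_comp₂ {F : ℝ × ℝ → ℝ} {ρ σ : SFun n M} {x : M} (hF : DifferentiableAt ℝ F (ρ x, σ x))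
    (u : Vec n) : dL (fun y => F (ρ y, σ y)) x u = fderiv ℝ F (ρ x, σ x) (dL ρ x u, dL σ x u) := by
  have hx := (chart (n := n) x).left_inv (mem_extChartAt_source x)
  have h1 := dL_self (ρ.contMDiff.mdifferentiable (by simp) x)
  have h2 := dL_self (σ.contMDiff.mdifferentiable (by simp) x)
  have h3 : MDifferentiableAt (𝓡 n) 𝓘(ℝ, ℝ × ℝ) (fun y => (ρ y, σ y)) x :=
    (ρ.contMDiff.prodMk_space σ.contMDiff).mdifferentiable (by simp) x
  have h4 : MDifferentiableAt (𝓡 n) 𝓘(ℝ, ℝ) (fun y => F (ρ y, σ y)) x :=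
    MDifferentiableAt.comp (g := F) (f := fun y => (ρ y, σ y)) x hF.mdifferentiableAt h3
  have h5 : HasFDerivAt F (fderiv ℝ F (ρ x, σ x)) (ρ ((chart (n := n) x).symm (chart (n := n) x x)),
      σ ((chart (n := n) x).symm (chart (n := n) x x))) := by rw [hx]; exact hF.hasFDerivAt
  have h6 := HasFDerivAt.comp (g := F) (f := fun z => (ρ ((chart (n := n) x).symm z),
    σ ((chart (n := n) x).symm z))) (chart (n := n) x x) h5 (h1.prodMk h2)
  rw [(dL_self h4).unique h6]
  rfl

variable {e : ℝ → ℝ → ℝ}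

/-- The Gibbs-Duhem relation for states on `M`. -/
lemma dL_pressure (he : ContDiffOn ℝ ∞ (fun p : ℝ × ℝ => e p.1 p.2) (Ioi 0 ×ˢ univ))
    (ρ σ : SFun n M) (hρ : ∀ x, 0 < ρ x) (x : M) (u : Vec n) :
    dL (fun y => pressure e (ρ y) (σ y)) x u =
      ρ x * dL (stateFun (contDiffOn_dEnergyRho he) ρ σ hρ) x u +
      σ x * dL (stateFun (contDiffOn_dEnergySigma he) ρ σ hρ) x u := by
  have hx : (ρ x, σ x) ∈ posStates := ⟨hρ x, mem_univ _⟩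
  have hU := isOpen_posStates.mem_nhds hx
  have h1 := dL_comp₂ (n := n) (((contDiffOn_dEnergyRho he).contDiffAt hU).differentiableAt
    (by simp)) u
  have h2 := dL_comp₂ (n := n) (((contDiffOn_dEnergySigma he).contDiffAt hU).differentiableAt
    (by simp)) u
  have h3 := dL_comp₂ (n := n) (((contDiffOn_pressure he).contDiffAt hU).differentiableAt
    (by simp)) u
  refine h3.trans ((fderiv_pressure he hx _).trans ?_)
  rw [← h1, ← h2]
  rfl

lemma SmoothFunOn.eventually_pos [CompactSpace M] {J : Set ℝ} (hJ : IsOpen J) {f : ℝ → M → ℝ}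
    (hf : SmoothFunOn n J f) {t : ℝ} (ht : t ∈ J) (h0 : ∀ x, 0 < f t x) :
    ∀ᶠ s in 𝓝 t, ∀ x, 0 < f s x := by
  have h := isCompact_univ.eventually_forall_of_forall_eventually (Y := M) (x₀ := t)
    (P := fun s x => 0 < f s x) (fun x _ => ?_)
  · simpa using h
  · have := (hf.continuousOn.continuousAt ((hJ.prod isOpen_univ).mem_nhds
      (⟨ht, mem_univ x⟩ : (t, x) ∈ J ×ˢ univ)))
    exact this.eventually (lt_mem_nhds (h0 x))

variable [CompactSpace M] [T2Space M] [MeasurableSpace M] [BorelSpace M]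

/-- The derivative of the potential energy along a curve of states. -/
lemma hasDerivAt_Ubar (g : RMetric n M)
    (he : ContDiffOn ℝ ∞ (fun p : ℝ × ℝ => e p.1 p.2) (Ioi 0 ×ˢ univ)) {J : Set ℝ} (hJ : IsOpen J)
    {ρ σ : ℝ → M → ℝ} (hρ : SmoothFunOn n J ρ) (hσ : SmoothFunOn n J σ) {t : ℝ} (ht : t ∈ J)
    (h0 : ∀ x, 0 < ρ t x) :
    HasDerivAt (fun s => Ubar g e (ρ s) (σ s))
      (∫ x, (dEnergyRho e (ρ t x, σ t x) * deriv (fun s => ρ s x) t +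
        dEnergySigma e (ρ t x, σ t x) * deriv (fun s => σ s x) t) ∂riemVol g) t := by
  obtain ⟨J', hJ'sub, hJ', ht'⟩ := eventually_nhds_iff.1
    ((hρ.eventually_pos hJ ht h0).and (hJ.eventually_mem ht))
  have hρ' : SmoothFunOn n J' ρ := hρ.comp contDiff_id fun s hs => (hJ'sub s hs).2
  have hσ' : SmoothFunOn n J' σ := hσ.comp contDiff_id fun s hs => (hJ'sub s hs).2
  have h1 := hasDerivAt_integral_family g hJ' (hρ'.comp₂ hJ' hσ' isOpen_posStates
    (contDiffOn_energyDensity he) fun s hs x => ⟨(hJ'sub s hs).1 x, mem_univ _⟩) ht'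
  refine h1.congr_deriv (integral_congr_ae (Filter.Eventually.of_forall fun x => ?_))
  have hE := ((contDiffOn_energyDensity he).contDiffAt (isOpen_posStates.mem_nhds
    (⟨h0 x, mem_univ _⟩ : (ρ t x, σ t x) ∈ posStates))).differentiableAt (by simp)
  have h2 := HasFDerivAt.comp_hasDerivAt (f := fun s => (ρ s x, σ s x)) t hE.hasFDerivAt
    ((hρ.hasDerivAt hJ ht x).prodMk (hσ.hasDerivAt hJ ht x))
  exact h2.deriv.trans (fderiv_energyDensity he _)

end State

/-! ### Variational derivatives on the dual of the Lie algebra -/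

lemma dL_eq_metricAt_grad (g : RMetric n M) (f : M → ℝ) (x : M) :
    metricAt g x (grad g f x) = dL f x := metricAt_sharp g x _

/-- The gradient of a smooth function. -/
def gradField (g : RMetric n M) (f : SFun n M) : VField n M := (smoothForm_mfderiv f).sharpField g

/-- A covector of `M`, as a linear form on `ℝⁿ`. -/
def covecAt (α : Covec n M) (x : M) : Vec n →L[ℝ] ℝ := α x

lemma SmoothFormOn.hasDerivAt {J : Set ℝ} (hJ : IsOpen J) {α : ℝ → Covec n M}
    (hα : SmoothFormOn J α) {t : ℝ} (ht : t ∈ J) (x : M) :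
    HasDerivAt (fun s => covecAt (α s) x) (deriv (fun s => covecAt (α s) x) t) t := by
  have h1 := (contMDiffAt_form_iff (b := fun q : ℝ × M => q.2)
    (α := fun q : ℝ × M => covecAt (α q.1) q.2) (q₀ := (t, x))).1
    ((smoothFormOn_iff hJ).1 hα t ht x)
  have h2 : ContMDiffAt 𝓘(ℝ, ℝ) 𝓘(ℝ, Vec n →L[ℝ] ℝ) ∞ (fun s => covecAt (α s) x) t := by
    refine contMDiffAt_clm fun w => ?_
    have h3 := (h1.2 w).comp t (f := fun s : ℝ => (s, x))
      (contMDiffAt_id.prodMk contMDiffAt_const)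
    refine h3.congr_of_eventuallyEq (Filter.Eventually.of_forall fun s => ?_)
    exact (congrArg (fun L : Vec n →L[ℝ] Vec n => covecAt (α s) x (L w)) (ofCoord_self x)).symm
  exact (h2.contDiffAt.differentiableAt (by simp)).hasDerivAt

lemma SmoothFormOn.hasDerivAt_apply {J : Set ℝ} (hJ : IsOpen J) {α : ℝ → Covec n M}
    (hα : SmoothFormOn J α) {t : ℝ} (ht : t ∈ J) (x : M) (u : Vec n) :
    HasDerivAt (fun s => covecAt (α s) x u) (deriv (fun s => covecAt (α s) x) t u) t := by
  have := (hα.hasDerivAt hJ ht x).clm_apply (hasDerivAt_const t u)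
  rwa [map_zero, add_zero] at this

/-- The musical isomorphism at a point, as a linear map. -/
lemma exists_sharpL (g : RMetric n M) (x : M) :
    ∃ L : (Vec n →L[ℝ] ℝ) →L[ℝ] Vec n, ∀ α, L α = sharpV g x α := by
  let f : (Vec n →L[ℝ] ℝ) →ₗ[ℝ] Vec n :=
    { toFun := sharpV g x
      map_add' := fun α β => metricAt_injective g x (by
        rw [map_add, metricAt_sharpV, metricAt_sharpV, metricAt_sharpV])
      map_smul' := fun r α => metricAt_injective g x (by
        rw [RingHom.id_apply, map_smul, metricAt_sharpV, metricAt_sharpV]) }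
  exact ⟨LinearMap.toContinuousLinearMap f, fun _ => rfl⟩

lemma SmoothFormOn.hasDerivAt_normSq {J : Set ℝ} (hJ : IsOpen J) (g : RMetric n M)
    {α : ℝ → Covec n M} (hα : SmoothFormOn J α) {t : ℝ} (ht : t ∈ J) (x : M) :
    HasDerivAt (fun s => covecAt (α s) x (sharpV g x (covecAt (α s) x)))
      (2 * deriv (fun s => covecAt (α s) x) t (sharpV g x (covecAt (α t) x))) t := by
  obtain ⟨L, hL⟩ := exists_sharpL g x
  have h1 := hα.hasDerivAt hJ ht x
  have h2 := h1.clm_apply (L.hasFDerivAt.comp_hasDerivAt t h1)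
  refine (h2.congr_deriv ?_).congr_of_eventuallyEq (Filter.Eventually.of_forall fun s => ?_)
  · have h3 : ∀ a b : Vec n →L[ℝ] ℝ, b (sharpV g x a) = a (sharpV g x b) := fun a b => by
      conv_lhs => rw [← metricAt_sharpV g x b]
      conv_rhs => rw [← metricAt_sharpV g x a]
      exact metricAt_symm g x _ _
    simp only [Function.comp_apply, hL]
    rw [h3 _ (covecAt (α t) x), two_mul]
  · simp only [Function.comp_apply, hL]

lemma contMDiff_sfun_congr {f h : M → ℝ} (hf : ContMDiff (𝓡 n) 𝓘(ℝ, ℝ) ∞ f) (e : ∀ x, h x = f x) :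
    ContMDiff (𝓡 n) 𝓘(ℝ, ℝ) ∞ h := by rwa [funext e]

lemma smoothFunOn_univ_const {f : M → ℝ} (h : SmoothFunOn n (univ : Set ℝ) fun _ => f) :
    ContMDiff (𝓡 n) 𝓘(ℝ, ℝ) ∞ f := h.sfun (mem_univ (0 : ℝ))

/-- The smooth function `ρ` of a smooth point `(m, ρ, σ)`. -/
def SDual.Smooth.rhoFun {ξ : SDual n M} (h : ξ.Smooth) : SFun n M :=
  ⟨ξ.ρ, smoothFunOn_univ_const h.2.1⟩

/-- The smooth function `σ` of a smooth point `(m, ρ, σ)`. -/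
def SDual.Smooth.sigmaFun {ξ : SDual n M} (h : ξ.Smooth) : SFun n M :=
  ⟨ξ.σ, smoothFunOn_univ_const h.2.2⟩

/-- The points of a smooth curve are smooth. -/
lemma SDual.SmoothOn.smooth {J : Set ℝ} {γ : ℝ → SDual n M} (h : SDual.SmoothOn J γ) {t : ℝ}
    (ht : t ∈ J) : (γ t).Smooth :=
  ⟨h.1.comp (k := fun _ => t) contDiff_const fun _ _ => ht,
    h.2.1.comp (k := fun _ => t) contDiff_const fun _ _ => ht,
    h.2.2.comp (k := fun _ => t) contDiff_const fun _ _ => ht⟩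

section Volume

variable [CompactSpace M] [T2Space M] [MeasurableSpace M] [BorelSpace M]

lemma integrable_sfun (g : RMetric n M) {f : M → ℝ} (hf : ContMDiff (𝓡 n) 𝓘(ℝ, ℝ) ∞ f) :
    Integrable f (riemVol g) := integrable_riemVol g hf.continuous

/-- Linear functionals are their own derivatives along curves. -/
lemma hasDerivAt_pairing (g : RMetric n M) (X : SAlg n M) {J : Set ℝ} (hJ : IsOpen J)
    {γ : ℝ → SDual n M} (hγ : SDual.SmoothOn J γ) {t : ℝ} (ht : t ∈ J) :
    HasDerivAt (fun s => pairing g (γ s) X) (pairing g (SDual.vel γ t) X) t := by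
  have h1 := hγ.1.apply hJ (smoothFieldOn_const J X.v)
  have h2 := hγ.2.1.mul (smoothFunOn_const J X.a)
  have h3 := hγ.2.2.mul (smoothFunOn_const J X.b)
  refine (hasDerivAt_integral_family g hJ ((h1.add h2).add h3) ht).congr_deriv
    (integral_congr_ae (Filter.Eventually.of_forall fun x => ?_))
  exact (((hγ.1.hasDerivAt_apply hJ ht x (X.v x)).add ((hγ.2.1.hasDerivAt hJ ht x).mul_const _)).add
    ((hγ.2.2.hasDerivAt hJ ht x).mul_const _)).deriv

lemma hasVarDeriv_pairing (g : RMetric n M) (ξ : SDual n M) (X : SAlg n M) :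
    HasVarDeriv g (fun ξ => pairing g ξ X) ξ X := fun δ hδ γ hγ _ =>
  hasDerivAt_pairing g X isOpen_Ioo hγ (by constructor <;> linarith)

/-- Variational derivatives are unique: test with the straight line in the direction dual to the
difference. -/
lemma HasVarDeriv.unique (g : RMetric n M) {F : SDual n M → ℝ} {ξ : SDual n M} (hξ : ξ.Smooth)
    {X Y : SAlg n M} (hX : HasVarDeriv g F ξ X) (hY : HasVarDeriv g F ξ Y) (x : M) :
    X.v x = Y.v x ∧ X.a x = Y.a x ∧ X.b x = Y.b x := by
  -- the point `η` of the dual that corresponds to `X - Y` under the `L²`-metric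
  let w : VField n M := X.v - Y.v
  let η : SDual n M := ⟨fun x => g.inner x (w x), X.a - Y.a, X.b - Y.b⟩
  let γ : ℝ → SDual n M := fun ε => ⟨fun x => ξ.α x + ε • η.α x, fun x => ξ.ρ x + ε * η.ρ x,
    fun x => ξ.σ x + ε * η.σ x⟩
  have hη : SmoothForm η.α := (smoothFieldOn_const (univ : Set ℝ) w).flat isOpen_univ g
  have hid : SmoothFunOn n (univ : Set ℝ) (fun ε (_ : M) => ε) := by
    refine (smoothFunOn_iff isOpen_univ).2 fun p _ x => contMDiffAt_fst
  have hγ : SDual.SmoothOn univ γ :=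
    ⟨SmoothFormOn.add isOpen_univ hξ.1 (SmoothFormOn.smul isOpen_univ hid hη),
      hξ.2.1.add (hid.mul (smoothFunOn_const univ (X.a - Y.a))),
      hξ.2.2.add (hid.mul (smoothFunOn_const univ (X.b - Y.b)))⟩
  have hγ1 : SDual.SmoothOn (Ioo (-1) 1) γ :=
    ⟨hγ.1.comp contDiff_id fun _ _ => mem_univ _, hγ.2.1.comp contDiff_id fun _ _ => mem_univ _,
      hγ.2.2.comp contDiff_id fun _ _ => mem_univ _⟩
  have h0 : γ 0 = ξ := by
    refine SDual.ext ?_ ?_ ?_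
    · funext x
      show ξ.α x + (0 : ℝ) • η.α x = ξ.α x
      rw [zero_smul, add_zero]
    · funext x; simp [γ]
    · funext x; simp [γ]
  have h1 := (hX 1 one_pos γ hγ1 h0).unique (hY 1 one_pos γ hγ1 h0)
  have hv1 : ∀ x, deriv (F := Vec n →L[ℝ] ℝ) (fun s => (γ s).α x) 0 = metricAt g x (w x) := by
    intro x
    have : HasDerivAt (fun s : ℝ => covecAt ξ.α x +
        s • metricAt g x (w x)) ((1 : ℝ) • metricAt g x (w x)) 0 :=
      ((hasDerivAt_id (0 : ℝ)).smul_const (metricAt g x (w x))).const_add _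
    rw [one_smul] at this
    exact this.deriv
  have hv2 : ∀ a b : ℝ, deriv (fun s : ℝ => a + s * b) 0 = b := fun a b => by
    have : HasDerivAt (fun s : ℝ => a + s * b) (1 * b) 0 :=
      ((hasDerivAt_id (0 : ℝ)).mul_const b).const_add a
    rw [this.deriv, one_mul]
  have hp : ∀ Z : SAlg n M, pairing g (SDual.vel γ 0) Z =
      ∫ x, (metricAt g x (w x) (Z.v x) + (X.a x - Y.a x) * Z.a x + (X.b x - Y.b x) * Z.b x)
        ∂riemVol g := fun Z => by
    refine integral_congr_ae (Filter.Eventually.of_forall fun x => ?_)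
    have e1 := congrArg (fun L : Vec n →L[ℝ] ℝ => L (Z.v x)) (hv1 x)
    have e2 : (SDual.vel γ 0).ρ x = X.a x - Y.a x := hv2 _ _
    have e3 : (SDual.vel γ 0).σ x = X.b x - Y.b x := hv2 _ _
    show (SDual.vel γ 0).α x (Z.v x) + (SDual.vel γ 0).ρ x * Z.a x + (SDual.vel γ 0).σ x * Z.b x = _
    rw [e2, e3]
    exact congrArg (fun r => r + (X.a x - Y.a x) * Z.a x + (X.b x - Y.b x) * Z.b x) e1
  have hi : ∀ Z : SAlg n M, Continuous fun x => metricAt g x (w x) (Z.v x) +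
      (X.a x - Y.a x) * Z.a x + (X.b x - Y.b x) * Z.b x := fun Z =>
    (((innerFun g w Z.v).contMDiff.continuous).add
      ((X.a.contMDiff.continuous.sub Y.a.contMDiff.continuous).mul Z.a.contMDiff.continuous)).add
      ((X.b.contMDiff.continuous.sub Y.b.contMDiff.continuous).mul Z.b.contMDiff.continuous)
  rw [hp, hp, ← sub_eq_zero, ← integral_sub (integrable_riemVol g (hi X))
    (integrable_riemVol g (hi Y))] at h1
  -- both derivatives along the line agree, so the square of the difference has integral zero
  have hsq : ∀ x, metricAt g x (w x) (X.v x) + (X.a x - Y.a x) * X.a x + (X.b x - Y.b x) * X.b x -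
      (metricAt g x (w x) (Y.v x) + (X.a x - Y.a x) * Y.a x + (X.b x - Y.b x) * Y.b x) =
      metricAt g x (w x) (w x) + (X.a x - Y.a x) ^ 2 + (X.b x - Y.b x) ^ 2 := fun x => by
    have : metricAt g x (w x) (w x) = metricAt g x (w x) (X.v x) - metricAt g x (w x) (Y.v x) :=
      (metricAt g x (w x)).map_sub (X.v x) (Y.v x)
    linarith
  have hnn : ∀ x (u : Vec n), 0 ≤ metricAt g x u u := fun x u => by
    rcases eq_or_ne u 0 with rfl | hu
    · rw [map_zero]
    · exact (metricAt_pos g x hu).le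
  have h2 := eq_zero_of_integral_sq_eq_zero g ((hi X).sub (hi Y)) (fun x => by
    have := hnn x (w x)
    refine le_of_le_of_eq ?_ (hsq x).symm
    positivity) h1 x
  have h3 : metricAt g x (w x) (w x) + (X.a x - Y.a x) ^ 2 + (X.b x - Y.b x) ^ 2 = 0 :=
    (hsq x).symm.trans h2
  have h4 := hnn x (w x)
  have ha : (X.a x - Y.a x) ^ 2 = 0 := by nlinarith [sq_nonneg (X.a x - Y.a x), sq_nonneg (X.b x - Y.b x)]
  have hb : (X.b x - Y.b x) ^ 2 = 0 := by nlinarith [sq_nonneg (X.a x - Y.a x), sq_nonneg (X.b x - Y.b x)]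
  have hw : metricAt g x (w x) (w x) = 0 := by linarith
  refine ⟨?_, sub_eq_zero.1 (pow_eq_zero_iff two_ne_zero |>.1 ha),
    sub_eq_zero.1 (pow_eq_zero_iff two_ne_zero |>.1 hb)⟩
  by_contra hne
  exact (metricAt_pos g x (u := w x) (sub_ne_zero.2 hne)).ne' hw

variable {e : ℝ → ℝ → ℝ}

/-- The velocity field `v = ♯m / ρ` of a smooth point `(m, ρ, σ)`. -/
def SDual.Smooth.velocity (g : RMetric n M) {ξ : SDual n M} (h : ξ.Smooth) (h0 : ∀ x, 0 < ξ.ρ x) :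
    VField n M :=
  smulField ((SmoothFunOn.inv isOpen_univ h.2.1 fun _ _ x => (h0 x).ne').toSFun (mem_univ (0 : ℝ)))
    (SmoothForm.sharpField g h.1)

/-- The variational derivatives `(v, a - |v|²/2, b)` of the Hamiltonian, `a` and `b` being the
derivatives of the energy density. -/
def dHamiltonian (g : RMetric n M)
    (he : ContDiffOn ℝ ∞ (fun p : ℝ × ℝ => e p.1 p.2) (Ioi 0 ×ˢ univ)) {ξ : SDual n M}
    (h : ξ.Smooth) (h0 : ∀ x, 0 < ξ.ρ x) : SAlg n M where
  v := h.velocity g h0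
  a := stateFun (contDiffOn_dEnergyRho he) h.rhoFun h.sigmaFun h0 -
    (1 / 2 : ℝ) • innerFun g (h.velocity g h0) (h.velocity g h0)
  b := stateFun (contDiffOn_dEnergySigma he) h.rhoFun h.sigmaFun h0

/-- The kinetic energy `|m|² / (2 ρ)` is differentiated pointwise, as a quotient. The curve `γ` need
not stay in the region `ρ > 0`, so time is first restricted to where it does. -/
lemma hasVarDeriv_hamiltonian (g : RMetric n M)
    (he : ContDiffOn ℝ ∞ (fun p : ℝ × ℝ => e p.1 p.2) (Ioi 0 ×ˢ univ)) {ξ : SDual n M}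
    (h : ξ.Smooth) (h0 : ∀ x, 0 < ξ.ρ x) :
    HasVarDeriv g (hamiltonian g e) ξ (dHamiltonian g he h h0) := by
  rintro δ hδ γ hγ rfl
  have ht : (0 : ℝ) ∈ Ioo (-δ) δ := by constructor <;> linarith
  obtain ⟨J, hJsub, hJ, htJ⟩ := eventually_nhds_iff.1
    ((hγ.2.1.eventually_pos isOpen_Ioo ht h0).and (isOpen_Ioo.eventually_mem ht))
  have hα : SmoothFormOn J fun t => (γ t).α := hγ.1.comp contDiff_id fun s hs => (hJsub s hs).2
  have hρ : SmoothFunOn n J fun t => (γ t).ρ := hγ.2.1.comp contDiff_id fun s hs => (hJsub s hs).2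
  have hσ : SmoothFunOn n J fun t => (γ t).σ := hγ.2.2.comp contDiff_id fun s hs => (hJsub s hs).2
  have hne : ∀ p ∈ J, ∀ x, 2 * (γ p).ρ x ≠ 0 := fun p hp x => by
    have := (hJsub p hp).1 x; positivity
  have h2ρ : SmoothFunOn n J fun t x => 2 * (γ t).ρ x :=
    (smoothFunOn_const J (ContMDiffMap.const 2)).mul hρ
  have hK : SmoothFunOn n J fun t x => (1 / (2 * (γ t).ρ x)) * (γ t).α x (sharp g x ((γ t).α x)) := by
    simp only [one_div]
    exact (h2ρ.inv hJ hne).mul (hα.apply hJ (hα.sharp hJ g))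
  have h1 := hasDerivAt_integral_family g hJ hK htJ
  have h2 := hasDerivAt_Ubar g he hJ hρ hσ htJ h0
  refine (h1.add h2).congr_deriv ?_
  have hi2 : Continuous fun x => dEnergyRho e ((γ 0).ρ x, (γ 0).σ x) * deriv (fun s => (γ s).ρ x) 0 +
      dEnergySigma e ((γ 0).ρ x, (γ 0).σ x) * deriv (fun s => (γ s).σ x) 0 :=
    (((stateFun (contDiffOn_dEnergyRho he) h.rhoFun h.sigmaFun h0).contMDiff.continuous).mul
      ((hρ.deriv hJ).sfun htJ).continuous).add
      (((stateFun (contDiffOn_dEnergySigma he) h.rhoFun h.sigmaFun h0).contMDiff.continuous).mul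
      ((hσ.deriv hJ).sfun htJ).continuous)
  rw [← integral_add (integrable_sfun g ((hK.deriv hJ).sfun htJ)) (integrable_riemVol g hi2)]
  refine integral_congr_ae (Filter.Eventually.of_forall fun x => ?_)
  have hρx := h0 x
  have d1 := hα.hasDerivAt_normSq hJ g htJ x
  have d2 := hρ.hasDerivAt hJ htJ x
  set r := (γ 0).ρ x with hr
  set A := covecAt (γ 0).α x with hA
  set A' := deriv (fun s => covecAt (γ s).α x) 0 with hA'
  set r' := deriv (fun s => (γ s).ρ x) 0 with hr'
  have d3 : deriv (fun s => (1 / (2 * (γ s).ρ x)) * (γ s).α x (sharp g x ((γ s).α x))) 0 =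
      -(2 * r') / (2 * r) ^ 2 * A (sharpV g x A) + (2 * r)⁻¹ * (2 * A' (sharpV g x A)) := by
    have h3 := ((d2.const_mul 2).inv (hne 0 htJ x)).mul d1
    refine (h3.congr_of_eventuallyEq (Filter.Eventually.of_forall fun s => ?_)).deriv
    exact congrArg (fun c => c * covecAt (γ s).α x (sharpV g x (covecAt (γ s).α x))) (one_div _)
  have hv : (dHamiltonian g he h h0).v x = r⁻¹ • sharpV g x A := rfl
  have ha : (dHamiltonian g he h h0).a x = dEnergyRho e (r, (γ 0).σ x) -
      (1 / 2 : ℝ) * metricAt g x (r⁻¹ • sharpV g x A) (r⁻¹ • sharpV g x A) := rfl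
  have hb : (dHamiltonian g he h h0).b x = dEnergySigma e (r, (γ 0).σ x) := rfl
  have hm : metricAt g x (r⁻¹ • sharpV g x A) (r⁻¹ • sharpV g x A) =
      r⁻¹ * (r⁻¹ * A (sharpV g x A)) := by
    rw [map_smul, map_smul, _root_.smul_apply, metricAt_sharpV, smul_eq_mul, smul_eq_mul]
  have hp : (SDual.vel γ 0).α x ((dHamiltonian g he h h0).v x) = r⁻¹ * A' (sharpV g x A) :=
    A'.map_smul r⁻¹ (sharpV g x A)
  have hr0 : r ≠ 0 := hρx.ne'
  -- `d(N / (2 r)) = dN / (2 r) - N dr / (2 r²)`, and `N / (2 r²) = |v|² / 2`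
  have alg : ∀ {D P a m N B dE b s : ℝ}, D = -(2 * r') / (2 * r) ^ 2 * N + (2 * r)⁻¹ * (2 * B) →
      P = r⁻¹ * B → a = dE - 1 / 2 * m → m = r⁻¹ * (r⁻¹ * N) →
      D + (dE * r' + b * s) = P + r' * a + s * b := by
    rintro D P a m N B dE b s rfl rfl rfl rfl
    field_simp
    ring
  exact alg d3 hp ha hm

/-- The gradient of the potential on `Diff(M)` is `ρ⁻¹ ∇P`. -/
lemma hasL2Gradient_potential (g : RMetric n M)
    (he : ContDiffOn ℝ ∞ (fun p : ℝ × ℝ => e p.1 p.2) (Ioi 0 ×ˢ univ)) (s₀ : SFun n M)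
    (φ : Diff n M) (w : VField n M)
    (hw : ∀ x, w x = (density g φ x)⁻¹ •
      grad g (fun y => pressure e (density g φ y) (push g φ s₀ y)) x) :
    HasL2Gradient g (potential g e s₀) φ w := by
  rintro δ hδ ψ hψ rfl
  have ht : (0 : ℝ) ∈ Ioo (-δ) δ := by constructor <;> linarith
  have hρ := hψ.density isOpen_Ioo g
  have hσ := hψ.push isOpen_Ioo g s₀.contMDiff
  have h0 : ∀ x, 0 < density g (ψ 0) x := density_pos g (ψ 0)
  refine (hasDerivAt_Ubar g he isOpen_Ioo hρ hσ ht h0).congr_deriv ?_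
  let ρ : SFun n M := hρ.toSFun ht
  let σ : SFun n M := hσ.toSFun ht
  let a := stateFun (contDiffOn_dEnergyRho he) ρ σ h0
  let b := stateFun (contDiffOn_dEnergySigma he) ρ σ h0
  -- the derivative of `∫ E(ρ, σ)` is `∫ (a ∂ρ + b ∂σ) = ∫ (ρ da + σ db)(v) = ∫ dP(v)`
  have i1 := integral_mul_deriv_push g isOpen_Ioo hψ (ContMDiffMap.const 1) a ht
  have i2 := integral_mul_deriv_push g isOpen_Ioo hψ s₀ b ht
  have hv : VField n M := (hψ.smoothFieldOn_eulVel isOpen_Ioo).toVField ht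
  have c1 : Continuous fun x => a x * deriv (fun s => density g (ψ s) x) 0 :=
    a.contMDiff.continuous.mul ((hρ.deriv isOpen_Ioo).sfun ht).continuous
  have c2 : Continuous fun x => b x * deriv (fun s => push g (ψ s) s₀ x) 0 :=
    b.contMDiff.continuous.mul ((hσ.deriv isOpen_Ioo).sfun ht).continuous
  have c3 : Continuous fun y => dL a y (eulVel ψ 0 y) * push g (ψ 0) (ContMDiffMap.const 1 : SFun n M) y :=
    (continuous_dL a ((hψ.smoothFieldOn_eulVel isOpen_Ioo).toVField ht)).mul ρ.contMDiff.continuous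
  have c4 : Continuous fun y => dL b y (eulVel ψ 0 y) * push g (ψ 0) s₀ y :=
    (continuous_dL b ((hψ.smoothFieldOn_eulVel isOpen_Ioo).toVField ht)).mul σ.contMDiff.continuous
  calc _ = (∫ x, a x * deriv (fun s => density g (ψ s) x) 0 ∂riemVol g) +
        ∫ x, b x * deriv (fun s => push g (ψ s) s₀ x) 0 ∂riemVol g :=
        integral_add (integrable_riemVol g c1) (integrable_riemVol g c2)
    _ = _ := congrArg₂ (· + ·) i1 i2
    _ = ∫ y, (dL a y (eulVel ψ 0 y) * push g (ψ 0) (ContMDiffMap.const 1 : SFun n M) y +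
        dL b y (eulVel ψ 0 y) * push g (ψ 0) s₀ y) ∂riemVol g :=
        (integral_add (integrable_riemVol g c3) (integrable_riemVol g c4)).symm
    _ = ∫ y, metricAt g y (w y) (eulVel ψ 0 y) * density g (ψ 0) y ∂riemVol g := by
        refine integral_congr_ae (Filter.Eventually.of_forall fun y => ?_)
        have e1 := dL_pressure he ρ σ h0 y (eulVel ψ 0 y)
        have e2 : metricAt g y (w y) (eulVel ψ 0 y) = (density g (ψ 0) y)⁻¹ *
            dL (fun y => pressure e (density g (ψ 0) y) (push g (ψ 0) s₀ y)) y (eulVel ψ 0 y) := by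
          have e3 : metricAt g y (w y) = (density g (ψ 0) y)⁻¹ •
              dL (fun y => pressure e (density g (ψ 0) y) (push g (ψ 0) s₀ y)) y := by
            rw [← dL_eq_metricAt_grad g, hw y]
            exact (metricAt g y).map_smul _ _
          exact congrArg (fun L : Vec n →L[ℝ] ℝ => L (eulVel ψ 0 y)) e3
        have e4 := (h0 y).ne'
        have alg : ∀ {A B C D r s i : ℝ}, D = r * A + s * B → C = i * D → i * r = 1 →
            A * r + B * s = C * r := by
          intro A B C D r s i h1 h2 h3
          subst h1 h2
          linear_combination (-(r * A + s * B)) * h3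
        exact alg e1 e2 (inv_mul_cancel₀ e4)
    _ = ∫ x, metricAt g (ψ 0 x) (w (ψ 0 x)) (eulVel ψ 0 (ψ 0 x)) ∂riemVol g :=
        integral_mul_density g (ψ 0) (fun y => metricAt g y (w y) (eulVel ψ 0 y))
    _ = _ := by
        refine integral_congr_ae (Filter.Eventually.of_forall fun x => ?_)
        exact congrArg (metricAt g (ψ 0 x) (w (ψ 0 x))) (eulVel_apply ψ 0 x)

end Volume

/-! ### The symmetry group and the fibres of the embedding -/

lemma refl_mem_symmetryGroup (g : RMetric n M) (s₀ : SFun n M) :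
    Diffeomorph.refl (𝓡 n) M ∞ ∈ symmetryGroup g s₀ := ⟨push_refl g 1, push_refl g s₀⟩

lemma symm_mem_symmetryGroup (g : RMetric n M) (s₀ : SFun n M) {η : Diff n M}
    (h : η ∈ symmetryGroup g s₀) : η.symm ∈ symmetryGroup g s₀ := by
  have h1 := push_symm_push g η 1
  have h2 := push_symm_push g η s₀
  rw [h.1] at h1
  rw [h.2] at h2
  exact ⟨h1, h2⟩

lemma trans_mem_symmetryGroup (g : RMetric n M) (s₀ : SFun n M) {η ζ : Diff n M}
    (h : η ∈ symmetryGroup g s₀) (h' : ζ ∈ symmetryGroup g s₀) :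
    η.trans ζ ∈ symmetryGroup g s₀ :=
  ⟨by rw [Set.mem_ofPred_eq, push_trans, h.1, h'.1], by rw [Set.mem_ofPred_eq, push_trans, h.2, h'.2]⟩

/-- The fibres of the embedding are the orbits of the symmetry group. -/
lemma embed_eq_iff (g : RMetric n M) (s₀ : SFun n M) (φ ψ : Diff n M) (α β : Covec n M) :
    embed g s₀ φ α = embed g s₀ ψ β ↔ ∃ η ∈ symmetryGroup g s₀, ψ = η.trans φ ∧ β = α := by
  constructor
  · intro h
    have h1 : α = β := congrArg SDual.α h
    have h2 : push g φ 1 = push g ψ 1 := congrArg SDual.ρ h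
    have h3 : push g φ s₀ = push g ψ s₀ := congrArg SDual.σ h
    refine ⟨ψ.trans φ.symm, ⟨?_, ?_⟩, ?_, h1.symm⟩
    · rw [Set.mem_ofPred_eq, push_trans, ← h2, push_symm_push]
    · rw [Set.mem_ofPred_eq, push_trans, ← h3, push_symm_push]
    · ext x
      exact (φ.apply_symm_apply (ψ x)).symm
  · rintro ⟨η, hη, rfl, rfl⟩
    refine SDual.ext rfl ?_ ?_
    · show push g φ 1 = push g (η.trans φ) 1
      rw [push_trans, hη.1]
    · show push g φ s₀ = push g (η.trans φ) s₀
      rw [push_trans, hη.2]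

lemma smooth_embed (g : RMetric n M) (s₀ : SFun n M) (φ : Diff n M) {α : Covec n M}
    (hα : SmoothForm α) : SDual.Smooth (embed g s₀ φ α) :=
  ⟨hα, smoothFunOn_const univ ⟨_, contMDiff_density g φ⟩,
    smoothFunOn_const univ ⟨_, contMDiff_push g φ s₀.contMDiff⟩⟩

lemma SmoothDiffOn.embed {J : Set ℝ} (hJ : IsOpen J) (g : RMetric n M) (s₀ : SFun n M)
    {ψ : ℝ → Diff n M} {β : ℝ → Covec n M} (hψ : SmoothDiffOn J ψ) (hβ : SmoothFormOn J β) :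
    SDual.SmoothOn J (fun t => embed g s₀ (ψ t) (β t)) :=
  ⟨hβ, hψ.density hJ g, hψ.push hJ g s₀.contMDiff⟩

section Volume

variable [CompactSpace M] [T2Space M] [MeasurableSpace M] [BorelSpace M]

omit [CompactSpace M] [T2Space M] [BorelSpace M] in
lemma integral_add_add {μ : Measure M} {a b c : M → ℝ} (ha : Integrable a μ) (hb : Integrable b μ)
    (hc : Integrable c μ) :
    ∫ x, (a x + b x + c x) ∂μ = (∫ x, a x ∂μ) + (∫ x, b x ∂μ) + ∫ x, c x ∂μ := by
  have hab : Integrable (fun x => a x + b x) μ := ha.add hb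
  rw [integral_add hab hc, integral_add ha hb]

/-- The Lagrangian is invariant under relabelling by the symmetry group. -/
lemma lagrangian_trans (g : RMetric n M) (e : ℝ → ℝ → ℝ) (s₀ : SFun n M) {η : Diff n M}
    (hη : η ∈ symmetryGroup g s₀) (φ : Diff n M) (ξ : (x : M) → TangentSpace (𝓡 n) (φ x)) :
    lagrangian g e s₀ (η.trans φ) (fun x => ξ (η x)) = lagrangian g e s₀ φ ξ := by
  have h1 : potential g e s₀ (η.trans φ) = potential g e s₀ φ := by
    rw [potential, potential, density, density, push_trans, push_trans, hη.1, hη.2]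
  have h2 := integral_mul_density g η (fun x => metricAt g (φ x) (ξ x) (ξ x))
  have h3 : density g η = 1 := hη.1
  simp only [h3, Pi.one_apply, mul_one] at h2
  have h4 : ∫ x, g.inner ((η.trans φ) x) (ξ (η x)) (ξ (η x)) ∂riemVol g =
      ∫ x, g.inner (φ x) (ξ x) (ξ x) ∂riemVol g := h2.symm
  exact congrArg₂ (fun a b => 1 / 2 * a - b) h4 h1

/-! ### The embedding is a Poisson map -/

/-- The differential of `F ∘ embed`, from the variational derivatives of `F`. -/
def cotDeriv {ξ : SDual n M} (h : ξ.Smooth) (X : SAlg n M) : TCovec n M where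
  ν x := ξ.ρ x • (dL X.a x : TangentSpace (𝓡 n) x →L[ℝ] ℝ) +
    ξ.σ x • (dL X.b x : TangentSpace (𝓡 n) x →L[ℝ] ℝ)
  v := X.v

omit [CompactSpace M] [T2Space M] [MeasurableSpace M] [BorelSpace M] in
lemma smoothForm_cotDeriv {ξ : SDual n M} (h : ξ.Smooth) (X : SAlg n M) :
    SmoothForm (cotDeriv h X).ν :=
  SmoothFormOn.add isOpen_univ (SmoothFormOn.smul isOpen_univ h.2.1 (smoothForm_mfderiv X.a))
    (SmoothFormOn.smul isOpen_univ h.2.2 (smoothForm_mfderiv X.b))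

/-- The derivative of `F ∘ embed` along `(ψ, β)`: the variational derivatives of `F` with respect to
the densities are moved to the velocity of `ψ` by the weak continuity equation. -/
lemma hasCotDeriv_comp_embed (g : RMetric n M) (s₀ : SFun n M) (φ : Diff n M) {α : Covec n M}
    (hα : SmoothForm α) {F : SDual n M → ℝ} {dF : SAlg n M}
    (hF : HasVarDeriv g F (embed g s₀ φ α) dF) :
    HasCotDeriv g (fun ψ β => F (embed g s₀ ψ β)) φ α (cotDeriv (smooth_embed g s₀ φ hα) dF) := by
  rintro δ hδ ψ β hψ hβ rfl rfl
  have ht : (0 : ℝ) ∈ Ioo (-δ) δ := by constructor <;> linarith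
  have hγ := hψ.embed isOpen_Ioo g s₀ hβ
  refine (hF δ hδ _ hγ rfl).congr_deriv ?_
  have i1 := integral_mul_deriv_push g isOpen_Ioo hψ (ContMDiffMap.const 1) dF.a ht
  have i2 := integral_mul_deriv_push g isOpen_Ioo hψ s₀ dF.b ht
  let v := (hψ.smoothFieldOn_eulVel isOpen_Ioo).toVField ht
  have hρ := hψ.density isOpen_Ioo g
  have hσ := hψ.push isOpen_Ioo g s₀.contMDiff
  have c0 : Continuous fun x => deriv (fun s => covecAt (β s) x) 0 (dF.v x) := by
    have := ((hβ.apply isOpen_Ioo (smoothFieldOn_const _ dF.v)).deriv isOpen_Ioo).sfun ht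
    refine (contMDiff_sfun_congr this fun x => ?_).continuous
    exact (hβ.hasDerivAt_apply isOpen_Ioo ht x (dF.v x)).deriv.symm
  have c1 : Continuous fun x => dF.a x * deriv (fun s => density g (ψ s) x) 0 :=
    dF.a.contMDiff.continuous.mul ((hρ.deriv isOpen_Ioo).sfun ht).continuous
  have c2 : Continuous fun x => dF.b x * deriv (fun s => push g (ψ s) s₀ x) 0 :=
    dF.b.contMDiff.continuous.mul ((hσ.deriv isOpen_Ioo).sfun ht).continuous
  have c3 : Continuous fun y => dL dF.a y (v y) * density g (ψ 0) y :=
    (continuous_dL dF.a v).mul (contMDiff_density g (ψ 0)).continuous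
  have c4 : Continuous fun y => dL dF.b y (v y) * push g (ψ 0) s₀ y :=
    (continuous_dL dF.b v).mul (contMDiff_push g (ψ 0) s₀.contMDiff).continuous
  have j0 := integrable_riemVol g c0
  have j1 := integrable_riemVol g c1
  have j2 := integrable_riemVol g c2
  have j3 := integrable_riemVol g c3
  have j4 := integrable_riemVol g c4
  have hL : pairing g (SDual.vel (fun t => FullEuler.embed g s₀ (ψ t) (β t)) 0) dF =
      (∫ x, deriv (fun s => covecAt (β s) x) 0 (dF.v x) ∂riemVol g) +
      (∫ x, dF.a x * deriv (fun s => density g (ψ s) x) 0 ∂riemVol g) +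
      ∫ x, dF.b x * deriv (fun s => push g (ψ s) s₀ x) 0 ∂riemVol g := by
    rw [← integral_add_add j0 j1 j2]
    refine integral_congr_ae (Filter.Eventually.of_forall fun x => ?_)
    have alg : ∀ A a b c d : ℝ, A + a * b + c * d = A + b * a + d * c := by intros; ring
    exact alg _ _ _ _ _
  have hR : ∫ x, ((cotDeriv (smooth_embed g s₀ (ψ 0) hα) dF).ν x (eulVel ψ 0 x) +
      deriv (fun ε => β ε x) 0 ((cotDeriv (smooth_embed g s₀ (ψ 0) hα) dF).v x)) ∂riemVol g =
      (∫ x, deriv (fun s => covecAt (β s) x) 0 (dF.v x) ∂riemVol g) +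
      (∫ y, dL dF.a y (v y) * density g (ψ 0) y ∂riemVol g) +
      ∫ y, dL dF.b y (v y) * push g (ψ 0) s₀ y ∂riemVol g := by
    rw [← integral_add_add j0 j3 j4]
    refine integral_congr_ae (Filter.Eventually.of_forall fun x => ?_)
    have alg : ∀ A a b c d : ℝ, (a * b + c * d) + A = A + b * a + d * c := by intros; ring
    exact alg _ _ _ _ _
  rw [hL, hR]
  exact congrArg₂ (fun a b => _ + a + b) i1 i2

/-- The canonical bracket of pulled back functions is the Lie-Poisson bracket, as an identity of
integrands. -/
lemma canonicalBracket_cotDeriv (g : RMetric n M) {ξ : SDual n M} (h : ξ.Smooth)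
    (X Y : SAlg n M) :
    canonicalBracket g ξ.α (cotDeriv h X) (cotDeriv h Y) = liePoisson g ξ X Y := by
  rw [canonicalBracket, liePoisson, pairing, ← integral_neg]
  refine integral_congr_ae (Filter.Eventually.of_forall fun x => ?_)
  have h1 : covecAt ξ.α x ((SAlg.ad X Y).v x) = -covecAt ξ.α x (lieField X.v Y.v x) :=
    (covecAt ξ.α x).map_neg _
  have alg : ∀ {A B ρ σ a b c d : ℝ}, B = -A →
      A - (ρ * a + σ * b) + (ρ * c + σ * d) = -(B + ρ * (a - c) + σ * (b - d)) := by
    rintro A B ρ σ a b c d rfl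
    ring
  exact alg h1

/-! ### The Legendre transform -/

lemma integral_legendre_apply (g : RMetric n M) (φ : Diff n M) (w u : VField n M) :
    ∫ x, legendre g (density g φ) w x (u x) ∂riemVol g =
      ∫ x, innerFun g w u (φ x) ∂riemVol g := by
  rw [← integral_mul_density g φ (innerFun g w u)]
  exact integral_congr_ae (Filter.Eventually.of_forall fun x => mul_comm _ _)

/-- The fibre derivative of the Lagrangian: in the direction of the velocity the Lagrangian is a
quadratic polynomial. -/
lemma hasDerivAt_lagrangian (g : RMetric n M) (e : ℝ → ℝ → ℝ) (s₀ : SFun n M) (φ : Diff n M)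
    (w u : VField n M) :
    HasDerivAt (fun ε : ℝ => lagrangian g e s₀ φ (fun x => w (φ x) + ε • u (φ x)))
      (∫ x, legendre g (density g φ) w x (u x) ∂riemVol g) 0 := by
  have hc : ∀ v v' : VField n M, Integrable (fun x => innerFun g v v' (φ x)) (riemVol g) :=
    fun v v' => integrable_riemVol g ((innerFun g v v').contMDiff.continuous.comp φ.continuous)
  have h1 : ∀ ε : ℝ, lagrangian g e s₀ φ (fun x => w (φ x) + ε • u (φ x)) =
      1 / 2 * ((∫ x, innerFun g w w (φ x) ∂riemVol g) +
        (2 * ε) * (∫ x, innerFun g w u (φ x) ∂riemVol g) +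
        ε ^ 2 * ∫ x, innerFun g u u (φ x) ∂riemVol g) - potential g e s₀ φ := by
    intro ε
    have h2 := (integral_add_add (hc w w) ((hc w u).const_mul (2 * ε))
      ((hc u u).const_mul (ε ^ 2))).symm
    rw [integral_const_mul, integral_const_mul] at h2
    rw [h2]
    refine congrArg (fun a => 1 / 2 * a - potential g e s₀ φ) ?_
    refine integral_congr_ae (Filter.Eventually.of_forall fun x => ?_)
    have : ∀ (y : M) (a b : Vec n), metricAt g y (a + ε • b) (a + ε • b) =
        metricAt g y a a + 2 * ε * metricAt g y a b + ε ^ 2 * metricAt g y b b := by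
      intro y a b
      simp only [map_add, map_smul, _root_.add_apply, _root_.smul_apply, smul_eq_mul,
        metricAt_symm g y b a]
      ring
    exact this (φ x) (w (φ x)) (u (φ x))
  rw [integral_legendre_apply]
  simp only [h1]
  have h2 : HasDerivAt (fun ε : ℝ => ε) 1 0 := hasDerivAt_id 0
  have h3 := ((((h2.const_mul 2).mul_const (∫ x, innerFun g w u (φ x) ∂riemVol g)).const_add
    (∫ x, innerFun g w w (φ x) ∂riemVol g)).add
    ((h2.pow 2).mul_const (∫ x, innerFun g u u (φ x) ∂riemVol g))).const_mul (1 / 2) |>.sub_const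
    (potential g e s₀ φ)
  refine h3.congr_deriv ?_
  simp

/-- The energy of the Lagrangian is the Hamiltonian: `|m|² / (2 ρ) = ρ |w|² / 2`, and the mass
density is removed by the change of variables. -/
lemma hamiltonian_embed_legendre (g : RMetric n M) (e : ℝ → ℝ → ℝ) (s₀ : SFun n M) (φ : Diff n M)
    (w : VField n M) :
    hamiltonian g e (embed g s₀ φ (legendre g (density g φ) w)) =
      (∫ x, legendre g (density g φ) w x (w x) ∂riemVol g)
        - lagrangian g e s₀ φ (fun x => w (φ x)) := by
  have h1 : ∫ x, (1 / (2 * density g φ x)) * legendre g (density g φ) w x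
      (sharp g x (legendre g (density g φ) w x)) ∂riemVol g =
      1 / 2 * ∫ x, innerFun g w w (φ x) ∂riemVol g := by
    rw [← integral_mul_density g φ (innerFun g w w), ← integral_const_mul]
    refine integral_congr_ae (Filter.Eventually.of_forall fun x => ?_)
    have e1 : sharpV g x (covecAt (legendre g (density g φ) w) x) = density g φ x • w x :=
      (sharp_smul g x (density g φ x) (metricAt g x (w x))).trans
        (congrArg (fun v : Vec n => density g φ x • v) (sharp_metricAt g x (w x)))
    have e2 : covecAt (legendre g (density g φ) w) x
        (sharpV g x (covecAt (legendre g (density g φ) w) x)) =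
        density g φ x * (density g φ x * innerFun g w w x) := by
      rw [e1]
      exact congrArg (density g φ x * ·) ((metricAt g x (w x)).map_smul (density g φ x) (w x))
    have e3 := (density_pos g φ x).ne'
    have alg : ∀ {r L k : ℝ}, r ≠ 0 → L = r * (r * k) → 1 / (2 * r) * L = 1 / 2 * (k * r) := by
      rintro r L k hr rfl
      field_simp
    exact alg e3 e2
  rw [hamiltonian, integral_legendre_apply, lagrangian]
  have h2 : ∫ x, g.inner (φ x) (w (φ x)) (w (φ x)) ∂riemVol g =
    ∫ x, innerFun g w w (φ x) ∂riemVol g := rfl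
  refine (congrArg (· + Ubar g e (density g φ) (push g φ s₀)) h1).trans ?_
  rw [h2, potential]
  ring

end Volume

/-! ### The Lie-Poisson system and the Euler system -/

lemma SmoothFieldOn.hasDerivAt {J : Set ℝ} (hJ : IsOpen J)
    {v : ℝ → (x : M) → TangentSpace (𝓡 n) x} (hv : SmoothFieldOn J v) {t : ℝ} (ht : t ∈ J) (x : M) :
    HasDerivAt (F := Vec n) (fun s => v s x) (deriv (F := Vec n) (fun s => v s x) t) t := by
  have hz : chart (n := n) x x ∈ (chart (n := n) x).target := mem_extChartAt_target x
  have h1 := (contDiffAt_fieldCoord_family hJ hv ht x hz).differentiableAt (by simp)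
  have h2 := h1.hasFDerivAt.comp_hasDerivAt t
    ((hasDerivAt_id t).prodMk (hasDerivAt_const t (chart (n := n) x x)))
  have h3 := HasDerivAt.congr_of_eventuallyEq (F := Vec n) (f₁ := fun s => v s x) h2
    (Filter.Eventually.of_forall fun s => (fieldCoord_self x (v s)).symm)
  exact h3.congr_deriv h3.deriv.symm

lemma dL_sub {f h : M → ℝ} {y : M} (hf : MDifferentiableAt (𝓡 n) 𝓘(ℝ, ℝ) f y)
    (hh : MDifferentiableAt (𝓡 n) 𝓘(ℝ, ℝ) h y) : dL (n := n) (f - h) y = dL f y - dL h y :=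
  (hf.hasMFDerivAt.sub hh.hasMFDerivAt).mfderiv

lemma dL_const_smul {f : M → ℝ} {y : M} (hf : MDifferentiableAt (𝓡 n) 𝓘(ℝ, ℝ) f y) (c : ℝ) :
    dL (n := n) (c • f) y = c • dL f y :=
  (hf.hasMFDerivAt.const_smul c).mfderiv

section Volume

variable [CompactSpace M] [T2Space M]

/-- Every tangent vector extends to a smooth vector field. -/
lemma exists_vfield_eq (x : M) (u : Vec n) : ∃ X : VField n M, X x = u := by
  classical
  obtain ⟨X, hX⟩ := exists_contMDiffSection_forall_mem_convex_of_local (I := 𝓡 n) (n := ⊤)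
    (F_fiber := Vec n) (fun x : M => TangentSpace (𝓡 n) x) (fun y => {w | y = x → HEq w u})
    (fun y => by
      rcases eq_or_ne y x with rfl | hy
      · have : {w : TangentSpace (𝓡 n) y | y = y → HEq w u} = {u} := by
          ext w
          exact ⟨fun h => eq_of_heq (h rfl), fun h _ => heq_of_eq h⟩
        rw [this]
        exact convex_singleton _
      · have : {w : TangentSpace (𝓡 n) y | y = x → HEq w u} = univ := by
          ext w
          simp [hy]
        rw [this]
        exact convex_univ)
    (fun y => by
      rcases eq_or_ne y x with rfl | hy
      · refine ⟨_, (isOpen_extChartAt_source (I := 𝓡 n) y).mem_nhds (mem_extChartAt_source y),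
          fun z => ofCoord y z u, fun z hz => ?_, ?_⟩
        · exact (contMDiffAt_frame (b := fun z : M => z) contMDiffAt_id hz u).contMDiffWithinAt
        · rintro z hz rfl
          exact heq_of_eq (congrArg (fun L : Vec n →L[ℝ] Vec n => L u) (ofCoord_self z))
      · refine ⟨_, isOpen_compl_singleton.mem_nhds hy, fun z => 0, ?_, fun z hz h => (hz h).elim⟩
        exact (contMDiff_zeroSection ℝ (fun x : M => TangentSpace (𝓡 n) x)).contMDiffOn)
  exact ⟨X, eq_of_heq (hX x rfl)⟩

variable [MeasurableSpace M] [BorelSpace M] {e : ℝ → ℝ → ℝ}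

lemma continuous_covDeriv (g : RMetric n M) (v X : VField n M) :
    Continuous fun x => metricAt g x (covDeriv g v v x) (X x) := by
  have h := ((continuous_dL (innerFun g v X) v).sub
    (innerFun g v (lieField v X)).contMDiff.continuous).sub
    ((continuous_dL (innerFun g v v) X).div_const 2)
  refine h.congr fun x => ?_
  have alg : ∀ {L a b c : ℝ}, L = a - b - c → a - L - c = b := by
    rintro L a b c rfl
    ring
  exact alg (metricAt_lieField g v X x)

lemma continuous_dL_pressure (he : ContDiffOn ℝ ∞ (fun p : ℝ × ℝ => e p.1 p.2) (Ioi 0 ×ˢ univ))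
    (ρ σ : SFun n M) (h0 : ∀ x, 0 < ρ x) (X : VField n M) :
    Continuous fun x => dL (fun y => pressure e (ρ y) (σ y)) x (X x) :=
  continuous_dL (stateFun (contDiffOn_pressure he) ρ σ h0) X

/-- The Lie-Poisson bracket with the Hamiltonian, after the integrations by parts that bring it to
Eulerian form. -/
lemma liePoisson_legendre (g : RMetric n M)
    (he : ContDiffOn ℝ ∞ (fun p : ℝ × ℝ => e p.1 p.2) (Ioi 0 ×ˢ univ)) (v : VField n M)
    (ρ σ : SFun n M) (h0 : ∀ x, 0 < ρ x) {dH : SAlg n M} (hv : dH.v = v)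
    (ha : dH.a = stateFun (contDiffOn_dEnergyRho he) ρ σ h0 - (1 / 2 : ℝ) • innerFun g v v)
    (hb : dH.b = stateFun (contDiffOn_dEnergySigma he) ρ σ h0) (X : SAlg n M) :
    liePoisson g ⟨legendre g ρ v, ρ, σ⟩ dH X =
      -∫ x, ((innerFun g v X.v x + X.a x) * divergence g (smulField ρ v) x +
        X.b x * divergence g (smulField σ v) x +
        (ρ x * metricAt g x (covDeriv g v v x) (X.v x) +
          dL (fun y => pressure e (ρ y) (σ y)) x (X.v x))) ∂riemVol g := by
  have hd : ∀ f : SFun n M, ∀ x, MDifferentiableAt (𝓡 n) 𝓘(ℝ, ℝ) f x :=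
    fun f x => f.contMDiff.mdifferentiable (by simp) x
  set f : SFun n M := innerFun g v X.v + X.a with hf
  have cP := continuous_dL_pressure he ρ σ h0 X.v
  have cV : Continuous fun x => ρ x * metricAt g x (covDeriv g v v x) (X.v x) :=
    ρ.contMDiff.continuous.mul (continuous_covDeriv g v X.v)
  have i0 := integrable_riemVol g (cV.add cP)
  have i1 := integrable_riemVol g (f.contMDiff.continuous.mul
    (continuous_divergence g (smulField ρ v)))
  have i2 := integrable_riemVol g (X.b.contMDiff.continuous.mul
    (continuous_divergence g (smulField σ v)))
  have i3 := (integrable_riemVol g (continuous_dL f (smulField ρ v))).neg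
  have i4 := (integrable_riemVol g (continuous_dL X.b (smulField σ v))).neg
  rw [liePoisson, pairing]
  refine congrArg Neg.neg ?_
  refine Eq.trans ?_ (integral_add_add i1 i2 i0).symm
  -- with the divergences integrated by parts, both sides agree pointwise
  have e1 : ∫ x, f x * divergence g (smulField ρ v) x ∂riemVol g =
      ∫ x, -dL f x (smulField ρ v x) ∂riemVol g :=
    (integral_mul_divergence g (smulField ρ v) f).trans (integral_neg _).symm
  have e2 : ∫ x, X.b x * divergence g (smulField σ v) x ∂riemVol g =
      ∫ x, -dL X.b x (smulField σ v x) ∂riemVol g :=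
    (integral_mul_divergence g (smulField σ v) X.b).trans (integral_neg _).symm
  refine Eq.trans ?_ (congrArg₂ (fun a b => a + b + ∫ x, (ρ x * metricAt g x (covDeriv g v v x)
    (X.v x) + dL (fun y => pressure e (ρ y) (σ y)) x (X.v x)) ∂riemVol g) e1 e2).symm
  refine Eq.trans ?_ (integral_add_add i3 i4 i0)
  refine integral_congr_ae (Filter.Eventually.of_forall fun x => ?_)
  have d1 : dL f x (ρ x • v x) = ρ x * dL (innerFun g v X.v) x (v x) + ρ x * dL X.a x (v x) := by
    have := dL_add (hd (innerFun g v X.v) x) (hd X.a x)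
    have h2 : dL f x (v x) = dL (innerFun g v X.v) x (v x) + dL X.a x (v x) :=
      congrArg (fun L : Vec n →L[ℝ] ℝ => L (v x)) this
    refine ((dL f x).map_smul (ρ x) (v x)).trans ?_
    rw [smul_eq_mul, h2, mul_add]
  have d2 : dL X.b x (σ x • v x) = σ x * dL X.b x (v x) := (dL X.b x).map_smul (σ x) (v x)
  have d3 : dL dH.a x (X.v x) = dL (stateFun (contDiffOn_dEnergyRho he) ρ σ h0) x (X.v x) -
      1 / 2 * dL (innerFun g v v) x (X.v x) := by
    rw [ha]
    have := (dL_sub (hd (stateFun (contDiffOn_dEnergyRho he) ρ σ h0) x)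
      ((hd (innerFun g v v) x).const_smul (1 / 2 : ℝ)))
    rw [dL_const_smul (hd (innerFun g v v) x)] at this
    exact congrArg (fun L : Vec n →L[ℝ] ℝ => L (X.v x)) this
  have d4 := dL_pressure he ρ σ h0 x (X.v x)
  have d5 := metricAt_lieField g v X.v x
  have d6 : covecAt (legendre g ρ v) x ((SAlg.ad dH X).v x) =
      -(ρ x * metricAt g x (v x) (lieField v X.v x)) := by
    have : (SAlg.ad dH X).v = -lieField v X.v := by rw [SAlg.ad, hv]
    rw [this]
    exact (covecAt (legendre g ρ v) x).map_neg (lieField v X.v x)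
  have d7 : (SAlg.ad dH X).a x = dL dH.a x (X.v x) - dL X.a x (v x) := by
    rw [← hv]; rfl
  have d8 : (SAlg.ad dH X).b x = dL (stateFun (contDiffOn_dEnergySigma he) ρ σ h0) x (X.v x) -
      dL X.b x (v x) := by
    rw [← hv, ← hb]; rfl
  have alg : ∀ {m a b r s f' b' Iv av bv A R I B P G L : ℝ}, f' = r * Iv + r * av → b' = s * bv →
      A = R - 1 / 2 * I → P = r * R + s * B → L = Iv - G - I / 2 → m = -(r * L) → a = A - av →
      b = B - bv → m + r * a + s * b = -f' + -b' + (r * G + P) := by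
    rintro m a b r s f' b' Iv av bv A R I B P G L rfl rfl rfl rfl rfl rfl rfl rfl
    ring
  exact alg d1 d2 d3 d4 d5 d6 d7 d8

lemma smoothFormOn_legendre_iff {J : Set ℝ} (hJ : IsOpen J) (g : RMetric n M) {ρ : ℝ → M → ℝ}
    (hρ : SmoothFunOn n J ρ) (h0 : ∀ t ∈ J, ∀ x, 0 < ρ t x)
    {v : ℝ → (x : M) → TangentSpace (𝓡 n) x} :
    SmoothFormOn J (fun t => legendre g (ρ t) (v t)) ↔ SmoothFieldOn J v := by
  refine ⟨fun h => ?_, fun h => SmoothFormOn.smul hJ hρ (h.flat hJ g)⟩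
  have h1 := SmoothFieldOn.smul hJ (hρ.inv hJ fun t ht x => (h0 t ht x).ne') (h.sharp hJ g)
  refine ContMDiffOn.congr h1 fun q hq => ?_
  have h2 : sharpV g q.2 (covecAt (legendre g (ρ q.1) (v q.1)) q.2) = ρ q.1 q.2 • v q.1 q.2 :=
    (sharp_smul g q.2 (ρ q.1 q.2) (metricAt g q.2 (v q.1 q.2))).trans
      (congrArg (fun w : Vec n => ρ q.1 q.2 • w) (sharp_metricAt g q.2 (v q.1 q.2)))
  have h3 : (ρ q.1 q.2)⁻¹ • sharpV g q.2 (covecAt (legendre g (ρ q.1) (v q.1)) q.2) =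
      (v q.1 q.2 : Vec n) := by
    rw [h2]
    exact inv_smul_smul₀ (h0 q.1 hq.1 q.2).ne' (v q.1 q.2 : Vec n)
  exact congrArg (fun w : Vec n => (⟨q.2, w⟩ : TangentBundle (𝓡 n) M)) h3.symm

/-- The variational derivatives of the Hamiltonian at `(ρ v^♭ ⊗ μ, ρ, σ)`. -/
def dHamiltonianVel (g : RMetric n M)
    (he : ContDiffOn ℝ ∞ (fun p : ℝ × ℝ => e p.1 p.2) (Ioi 0 ×ˢ univ)) (v : VField n M)
    (ρ σ : SFun n M) (h0 : ∀ x, 0 < ρ x) : SAlg n M where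
  v := v
  a := stateFun (contDiffOn_dEnergyRho he) ρ σ h0 - (1 / 2 : ℝ) • innerFun g v v
  b := stateFun (contDiffOn_dEnergySigma he) ρ σ h0

lemma SAlg.ext_apply {X Y : SAlg n M} (h : ∀ x, X.v x = Y.v x ∧ X.a x = Y.a x ∧ X.b x = Y.b x) :
    X = Y := by
  cases X
  cases Y
  congr
  · exact ContMDiffSection.ext fun x => (h x).1
  · exact ContMDiffMap.ext fun x => (h x).2.1
  · exact ContMDiffMap.ext fun x => (h x).2.2

lemma hasVarDeriv_dHamiltonianVel (g : RMetric n M)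
    (he : ContDiffOn ℝ ∞ (fun p : ℝ × ℝ => e p.1 p.2) (Ioi 0 ×ˢ univ)) (v : VField n M)
    (ρ σ : SFun n M) (h0 : ∀ x, 0 < ρ x) :
    HasVarDeriv g (hamiltonian g e) ⟨legendre g ρ v, ρ, σ⟩ (dHamiltonianVel g he v ρ σ h0) := by
  have hρ := smoothFunOn_const (univ : Set ℝ) ρ
  have h : SDual.Smooth ⟨legendre g ρ v, ρ, σ⟩ :=
    ⟨(smoothFormOn_legendre_iff isOpen_univ g hρ fun _ _ => h0).2 (smoothFieldOn_const univ v), hρ,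
      smoothFunOn_const univ σ⟩
  have hv : h.velocity g h0 = v := by
    refine ContMDiffSection.ext fun x => ?_
    have h2 : sharpV g x (covecAt (legendre g ρ v) x) = ρ x • v x :=
      (sharp_smul g x (ρ x) (metricAt g x (v x))).trans
        (congrArg (fun w : Vec n => ρ x • w) (sharp_metricAt g x (v x)))
    have h3 : (ρ x)⁻¹ • sharpV g x (covecAt (legendre g ρ v) x) = (v x : Vec n) := by
      rw [h2]
      exact inv_smul_smul₀ (h0 x).ne' (v x : Vec n)
    exact h3
  have h4 := hasVarDeriv_hamiltonian g he h h0
  have h5 : dHamiltonian g he h h0 = dHamiltonianVel g he v ρ σ h0 := by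
    rw [dHamiltonian, dHamiltonianVel, hv]
    rfl
  rwa [h5] at h4

/-- The Lie-Poisson system, tested against a linear functional, is the weak form of the Euler
system. -/
lemma pairing_vel_sub_liePoisson (g : RMetric n M)
    (he : ContDiffOn ℝ ∞ (fun p : ℝ × ℝ => e p.1 p.2) (Ioi 0 ×ˢ univ)) {J : Set ℝ} (hJ : IsOpen J)
    {v : ℝ → (x : M) → TangentSpace (𝓡 n) x} {ρ σ : ℝ → M → ℝ} (hv : SmoothFieldOn J v)
    (hρ : SmoothFunOn n J ρ) (hσ : SmoothFunOn n J σ) {t : ℝ} (ht : t ∈ J) (h0 : ∀ x, 0 < ρ t x)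
    (X : SAlg n M) :
    pairing g (SDual.vel (fun t => ⟨legendre g (ρ t) (v t), ρ t, σ t⟩) t) X -
      liePoisson g ⟨legendre g (ρ t) (v t), ρ t, σ t⟩
        (dHamiltonianVel g he (hv.toVField ht) (hρ.toSFun ht) (hσ.toSFun ht) h0) X =
      ∫ x, ((innerFun g (hv.toVField ht) X.v x + X.a x) *
          (deriv (fun s => ρ s x) t + divergence g (fun y => ρ t y • v t y) x) +
        X.b x * (deriv (fun s => σ s x) t + divergence g (fun y => σ t y • v t y) x) +
        ρ t x * metricAt g x (deriv (fun s => v s x) t + covDeriv g (v t) (v t) x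
          + (ρ t x)⁻¹ • grad g (fun y => pressure e (ρ t y) (σ t y)) x) (X.v x)) ∂riemVol g := by
  set vt := hv.toVField ht with hvt
  set ρt := hρ.toSFun ht with hρt
  set σt := hσ.toSFun ht with hσt
  have hL := liePoisson_legendre g he vt ρt σt h0
    (dH := dHamiltonianVel g he vt ρt σt h0) rfl rfl rfl X
  set f : SFun n M := innerFun g vt X.v + X.a with hf
  have c1 : Continuous fun x => f x * deriv (fun s => ρ s x) t :=
    f.contMDiff.continuous.mul ((hρ.deriv hJ).sfun ht).continuous
  have c2 : Continuous fun x => X.b x * deriv (fun s => σ s x) t :=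
    X.b.contMDiff.continuous.mul ((hσ.deriv hJ).sfun ht).continuous
  have c3 : Continuous fun x => f x * divergence g (smulField ρt vt) x :=
    f.contMDiff.continuous.mul (continuous_divergence g _)
  have c4 : Continuous fun x => X.b x * divergence g (smulField σt vt) x :=
    X.b.contMDiff.continuous.mul (continuous_divergence g _)
  have hg := hv.metric hJ g (smoothFieldOn_const J X.v)
  have d0 : ∀ x, deriv (fun s => metricAt g x (v s x) (X.v x)) t =
      metricAt g x (deriv (F := Vec n) (fun s => v s x) t) (X.v x) := fun x =>
    (((metricAt g x).flip (X.v x)).hasFDerivAt.comp_hasDerivAt t (hv.hasDerivAt hJ ht x)).deriv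
  have c5 : Continuous fun x => ρt x * metricAt g x (deriv (F := Vec n) (fun s => v s x) t) (X.v x) :=
    ρt.contMDiff.continuous.mul (((hg.deriv hJ).sfun ht).continuous.congr fun x => d0 x)
  have c6 : Continuous fun x => ρt x * metricAt g x (covDeriv g vt vt x) (X.v x) +
      dL (fun y => pressure e (ρt y) (σt y)) x (X.v x) :=
    (ρt.contMDiff.continuous.mul (continuous_covDeriv g vt X.v)).add
      (continuous_dL_pressure he ρt σt h0 X.v)
  -- the product rule for `m = ρ v^♭` moves `g(v, X) ∂_t ρ` to the continuity equation
  have hP : pairing g (SDual.vel (fun t => ⟨legendre g (ρ t) (v t), ρ t, σ t⟩) t) X =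
      ∫ x, (f x * deriv (fun s => ρ s x) t + X.b x * deriv (fun s => σ s x) t +
        ρt x * metricAt g x (deriv (F := Vec n) (fun s => v s x) t) (X.v x)) ∂riemVol g := by
    refine integral_congr_ae (Filter.Eventually.of_forall fun x => ?_)
    have h1 : deriv (fun s => covecAt (legendre g (ρ s) (v s)) x) t (X.v x) =
        ρ t x * metricAt g x (deriv (F := Vec n) (fun s => v s x) t) (X.v x) +
          deriv (fun s => ρ s x) t * innerFun g vt X.v x := by
      have := (hρ.hasDerivAt hJ ht x).smul
        ((metricAt g x).hasFDerivAt.comp_hasDerivAt t (hv.hasDerivAt hJ ht x))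
      exact congrArg (fun L : Vec n →L[ℝ] ℝ => L (X.v x)) this.deriv
    have alg : ∀ {A r B r' i a b s' : ℝ}, A = r * B + r' * i →
        A + r' * a + s' * b = (i + a) * r' + b * s' + r * B := by
      rintro A r B r' i a b s' rfl
      ring
    exact alg h1
  rw [hP]
  refine (congrArg (fun a => _ - a) hL).trans ?_
  rw [sub_neg_eq_add]
  refine (integral_add (integrable_riemVol g ((c1.add c2).add c5))
    (integrable_riemVol g ((c3.add c4).add c6))).symm.trans ?_
  refine integral_congr_ae (Filter.Eventually.of_forall fun x => ?_)
  have h2 : ∀ {A B C u : Vec n} {p : ℝ}, metricAt g x C u = p →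
      ρ t x * metricAt g x (A + B + (ρ t x)⁻¹ • C) u =
      ρ t x * metricAt g x A u + (ρ t x * metricAt g x B u + p) := by
    rintro A B C u p rfl
    have h3 := (h0 x).ne'
    simp only [map_add, map_smul, _root_.add_apply, _root_.smul_apply, smul_eq_mul]
    field_simp
    ring
  have alg : ∀ {T V P f r' D b s' D' : ℝ}, T = V + P →
      f * r' + b * s' + V + (f * D + b * D' + P) = f * (r' + D) + b * (s' + D') + T := by
    rintro T V P f r' D b s' D' rfl
    ring
  exact alg (h2 (congrArg (fun L : Vec n →L[ℝ] ℝ => L (X.v x))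
    (dL_eq_metricAt_grad g (fun y => pressure e (ρt y) (σt y)) x)))

/-- A functional with variational derivatives is differentiable along smooth curves, at all times. -/
lemma HasVarDeriv.hasDerivAt {g : RMetric n M} {F : SDual n M → ℝ} {X : SAlg n M} {J : Set ℝ}
    (hJ : IsOpen J) {γ : ℝ → SDual n M} (hγ : SDual.SmoothOn J γ) {t : ℝ} (ht : t ∈ J)
    (hF : HasVarDeriv g F (γ t) X) :
    HasDerivAt (fun s => F (γ s)) (pairing g (SDual.vel γ t) X) t := by
  obtain ⟨δ, hδ, hsub⟩ := Metric.isOpen_iff.1 hJ t ht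
  have hm : MapsTo (fun s : ℝ => t + s) (Ioo (-δ) δ) J := fun s hs => hsub <| by
    rw [Metric.mem_ball, Real.dist_eq, add_sub_cancel_left, abs_lt]
    exact hs
  have hk : ContDiff ℝ ∞ fun s : ℝ => t + s := contDiff_const.add contDiff_id
  have h1 := hF δ hδ (fun s => γ (t + s)) ⟨hγ.1.comp hk hm, hγ.2.1.comp hk hm, hγ.2.2.comp hk hm⟩
    (by simp only [add_zero])
  have h2 : SDual.vel (fun s => γ (t + s)) 0 = SDual.vel γ t := by
    refine SDual.ext ?_ ?_ ?_
    · funext x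
      exact (deriv_comp_const_add (f := fun s => covecAt (γ s).α x) t 0).trans (by rw [add_zero]; rfl)
    · funext x
      exact (deriv_comp_const_add (f := fun s => (γ s).ρ x) t 0).trans (by rw [add_zero]; rfl)
    · funext x
      exact (deriv_comp_const_add (f := fun s => (γ s).σ x) t 0).trans (by rw [add_zero]; rfl)
  rw [h2] at h1
  have h3 : HasDerivAt (fun s => s - t) 1 t := (hasDerivAt_id t).sub_const t
  have h4 : HasDerivAt (fun ε => F (γ (t + ε))) (pairing g (SDual.vel γ t) X) (t - t) := by
    rwa [sub_self]
  have h5 := HasDerivAt.scomp (h := fun s => s - t) (g₁ := fun ε => F (γ (t + ε))) t h4 h3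
  rw [one_smul] at h5
  refine h5.congr_of_eventuallyEq (Filter.Eventually.of_forall fun s => ?_)
  exact congrArg (fun r => F (γ r)) (by ring)

/-- The Lie-Poisson system of the Hamiltonian is the Euler system. In one direction, Hamilton's
equations for linear functionals give the Euler system in weak form; in the other, a functional with
variational derivative `dF` has the same derivative along the curve as the linear functional of
`dF`. -/
lemma isLiePoissonSolution_iff_isEulerSolution (g : RMetric n M)
    (he : ContDiffOn ℝ ∞ (fun p : ℝ × ℝ => e p.1 p.2) (Ioi 0 ×ˢ univ)) {J : Set ℝ} (hJ : IsOpen J)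
    {v : ℝ → (x : M) → TangentSpace (𝓡 n) x} {ρ σ : ℝ → M → ℝ} (h0 : ∀ t ∈ J, ∀ x, 0 < ρ t x) :
    IsLiePoissonSolution g (hamiltonian g e) J (fun t => ⟨legendre g (ρ t) (v t), ρ t, σ t⟩) ↔
      IsEulerSolution g (pressure e) J v ρ σ := by
  constructor
  · rintro ⟨hγ, hsol⟩
    have hρ : SmoothFunOn n J ρ := hγ.2.1
    have hσ : SmoothFunOn n J σ := hγ.2.2
    have hv : SmoothFieldOn J v := (smoothFormOn_legendre_iff hJ g hρ h0).1 hγ.1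
    refine ⟨hv, hρ, hσ, fun t ht => ?_⟩
    set vt := hv.toVField ht with hvt
    set ρt := hρ.toSFun ht with hρt
    set σt := hσ.toSFun ht with hσt
    obtain ⟨dH, hdH, hF⟩ := hsol t ht
    -- the definition only provides some variational derivative of the Hamiltonian
    have hdH' : dH = dHamiltonianVel g he vt ρt σt (h0 t ht) :=
      SAlg.ext_apply (hdH.unique g (hγ.smooth ht)
        (hasVarDeriv_dHamiltonianVel g he vt ρt σt (h0 t ht)))
    subst hdH'
    have key : ∀ X : SAlg n M, ∫ x, ((innerFun g vt X.v x + X.a x) *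
          (deriv (fun s => ρ s x) t + divergence g (fun y => ρ t y • v t y) x) +
        X.b x * (deriv (fun s => σ s x) t + divergence g (fun y => σ t y • v t y) x) +
        ρ t x * metricAt g x (deriv (fun s => v s x) t + covDeriv g (v t) (v t) x
          + (ρ t x)⁻¹ • grad g (fun y => pressure e (ρ t y) (σ t y)) x) (X.v x)) ∂riemVol g = 0 := by
      intro X
      rw [← pairing_vel_sub_liePoisson g he hJ hv hρ hσ ht (h0 t ht) X, sub_eq_zero]
      exact (hasDerivAt_pairing g X hJ hγ ht).unique
        (hF _ X (hasVarDeriv_pairing g _ X))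
    have cr : ∀ {τ : ℝ → M → ℝ} (hτ : SmoothFunOn n J τ),
        Continuous fun x => deriv (fun s => τ s x) t + divergence g (fun y => τ t y • v t y) x :=
      fun hτ => ((hτ.deriv hJ).sfun ht).continuous.add
        (continuous_divergence g (smulField (hτ.toSFun ht) vt))
    have z : ∀ x, metricAt g x (v t x) 0 = 0 := fun x => map_zero _
    -- test with functions of `ρ` alone, then of `σ` alone, then with vector fields; in the last step
    -- the continuity equation `r1` removes the term with `g(v, X)`
    have r1 : ∀ x, deriv (fun s => ρ s x) t + divergence g (fun y => ρ t y • v t y) x = 0 := by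
      refine eq_zero_of_forall_integral_mul g (cr hρ) fun f => ?_
      refine Eq.trans ?_ (key ⟨0, f, 0⟩)
      refine integral_congr_ae (Filter.Eventually.of_forall fun x => ?_)
      have alg : ∀ {f r s i r' : ℝ} {L : Vec n →L[ℝ] ℝ}, i = 0 →
          f * r = (i + f) * r + 0 * s + r' * L 0 := by
        rintro f r s i r' L rfl
        simp
      exact alg (z x)
    have r2 : ∀ x, deriv (fun s => σ s x) t + divergence g (fun y => σ t y • v t y) x = 0 := by
      refine eq_zero_of_forall_integral_mul g (cr hσ) fun f => ?_
      refine Eq.trans ?_ (key ⟨0, 0, f⟩)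
      refine integral_congr_ae (Filter.Eventually.of_forall fun x => ?_)
      have alg : ∀ {f r s i r' : ℝ} {L : Vec n →L[ℝ] ℝ}, i = 0 →
          f * s = (i + 0) * r + f * s + r' * L 0 := by
        rintro f r s i r' L rfl
        simp
      exact alg (z x)
    refine fun x => ⟨?_, r1 x, r2 x⟩
    have r3 : ∀ X : VField n M, ∀ x, ρ t x * metricAt g x (deriv (fun s => v s x) t +
        covDeriv g (v t) (v t) x + (ρ t x)⁻¹ • grad g (fun y => pressure e (ρ t y) (σ t y)) x)
        (X x) = 0 := by
      intro X
      have d0 : ∀ x, deriv (fun s => metricAt g x (v s x) (X x)) t =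
          metricAt g x (deriv (F := Vec n) (fun s => v s x) t) (X x) := fun x =>
        (((metricAt g x).flip (X x)).hasFDerivAt.comp_hasDerivAt t (hv.hasDerivAt hJ ht x)).deriv
      have c1 : Continuous fun x => metricAt g x (deriv (F := Vec n) (fun s => v s x) t) (X x) :=
        ((((hv.metric hJ g (smoothFieldOn_const J X)).deriv hJ).sfun ht).continuous.congr
          fun x => d0 x)
      have c2 := continuous_covDeriv g vt X
      have c3 : Continuous fun x => metricAt g x
          (grad g (fun y => pressure e (ρ t y) (σ t y)) x) (X x) :=
        (continuous_dL_pressure he ρt σt (h0 t ht) X).congr fun x =>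
          congrArg (fun L : Vec n →L[ℝ] ℝ => L (X x))
            (dL_eq_metricAt_grad g (fun y => pressure e (ρt y) (σt y)) x).symm
      have c4 := ρt.contMDiff.continuous.mul ((c1.add c2).add
        ((ρt.contMDiff.continuous.inv₀ fun x => (h0 t ht x).ne').mul c3))
      refine eq_zero_of_forall_integral_mul g (c4.congr fun x => ?_) fun f => ?_
      · have alg : ∀ {A B C u : Vec n} {r : ℝ}, r * (metricAt g x A u + metricAt g x B u +
            r⁻¹ * metricAt g x C u) = r * metricAt g x (A + B + r⁻¹ • C) u := by
          intro A B C u r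
          simp only [map_add, map_smul, _root_.add_apply, _root_.smul_apply, smul_eq_mul]
        exact alg
      · refine Eq.trans ?_ (key ⟨smulField f X, 0, 0⟩)
        refine integral_congr_ae (Filter.Eventually.of_forall fun x => ?_)
        have alg : ∀ {f r s r1 r2 i : ℝ} {L : Vec n →L[ℝ] ℝ} {u : Vec n}, r1 = 0 →
            f * (r * L u) = (i + 0) * r1 + 0 * r2 + r * L (f • u) := by
          rintro f r s r1 r2 i L u rfl
          rw [map_smul, smul_eq_mul]
          ring
        exact alg (s := 0) (r1 x)
    obtain ⟨X, hX⟩ := exists_vfield_eq x (deriv (fun s => v s x) t + covDeriv g (v t) (v t) x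
          + (ρ t x)⁻¹ • grad g (fun y => pressure e (ρ t y) (σ t y)) x)
    have h1 := r3 X x
    rw [hX] at h1
    have h2 := (mul_eq_zero.1 h1).resolve_left (h0 t ht x).ne'
    by_contra hne
    exact (metricAt_pos g x hne).ne' h2
  · rintro ⟨hv, hρ, hσ, hE⟩
    have hγ : SDual.SmoothOn J (fun t => (⟨legendre g (ρ t) (v t), ρ t, σ t⟩ : SDual n M)) :=
      ⟨(smoothFormOn_legendre_iff hJ g hρ h0).2 hv, hρ, hσ⟩
    refine ⟨hγ, fun t ht => ⟨_, hasVarDeriv_dHamiltonianVel g he (hv.toVField ht)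
      (hρ.toSFun ht) (hσ.toSFun ht) (h0 t ht), fun F dF hF => ?_⟩⟩
    refine (hF.hasDerivAt hJ hγ ht).congr_deriv ?_
    refine sub_eq_zero.1 ((pairing_vel_sub_liePoisson g he hJ hv hρ hσ ht (h0 t ht) dF).trans ?_)
    refine (integral_congr_ae (Filter.Eventually.of_forall fun x => ?_)).trans (integral_zero M ℝ)
    obtain ⟨E1, E2, E3⟩ := hE t ht x
    have alg : ∀ {f b r1 r2 r : ℝ} {E u : Vec n}, E = 0 → r1 = 0 → r2 = 0 →
        f * r1 + b * r2 + r * metricAt g x E u = 0 := by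
      rintro f b r1 r2 r E u rfl rfl rfl
      simp
    exact alg E1 E2 E3

end Volume

/-! ### Diffeomorphisms with prescribed velocity at the identity -/

/-- Small perturbations `z + κ sin(s) c(z)` of the identity are diffeomorphisms of `ℝⁿ`, smoothly
in the parameter `s`. The factor `sin s` makes the perturbation of `(s, z)` a global contraction. -/
lemma exists_inverse_perturbation {V : Type*} [NormedAddCommGroup V] [NormedSpace ℝ V]
    [CompleteSpace V] {c : V → V} (hc : ContDiff ℝ ∞ c) (hs : HasCompactSupport c) :
    ∃ κ : ℝ, 0 < κ ∧ ∃ G : ℝ × V → V, ContDiff ℝ ∞ G ∧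
      (∀ s z, G (s, z + (κ * Real.sin s) • c z) = z) ∧
      ∀ s z, G (s, z) + (κ * Real.sin s) • c (G (s, z)) = z := by
  obtain ⟨B, hB⟩ := hc.lipschitzWith_of_hasCompactSupport hs (by simp)
  obtain ⟨A, hA⟩ := hc.continuous.bounded_above_of_compact_support hs
  have hA0 : 0 ≤ A := (norm_nonneg _).trans (hA 0)
  -- `A` bounds `c` and `B` is a Lipschitz constant of `c`; `κ` is small enough for a contraction
  set κ : ℝ := 1 / (2 * (A + B + 1)) with hκ
  have hB0 : (0 : ℝ) ≤ B := B.2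
  have hpos : 0 < A + B + 1 := by positivity
  have hκ0 : 0 < κ := by positivity
  have hκAB : κ * (A + B) ≤ 1 / 2 := by
    rw [hκ, one_div, inv_mul_le_iff₀ (by positivity)]
    linarith
  -- the parameter is kept as a coordinate, so that the inverse is smooth in it
  let b : ℝ × V → ℝ × V := fun p => (0, (κ * Real.sin p.1) • c p.2)
  have hb : ContDiff ℝ ∞ b := contDiff_const.prodMk
    ((contDiff_const.mul (Real.contDiff_sin.comp contDiff_fst)).smul (hc.comp contDiff_snd))
  have hbL : LipschitzWith (1 / 2) b := by
    refine LipschitzWith.of_dist_le_mul fun p q => ?_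
    rw [Prod.dist_eq, dist_self, max_eq_right dist_nonneg, dist_eq_norm, dist_eq_norm]
    have h1 : (κ * Real.sin p.1) • c p.2 - (κ * Real.sin q.1) • c q.2 =
        κ • (Real.sin p.1 • (c p.2 - c q.2) + (Real.sin p.1 - Real.sin q.1) • c q.2) := by
      module
    have h2 : ‖c p.2 - c q.2‖ ≤ B * ‖p - q‖ := by
      have := hB.dist_le_mul p.2 q.2
      rw [dist_eq_norm, dist_eq_norm] at this
      exact this.trans (mul_le_mul_of_nonneg_left (norm_snd_le (p - q)) hB0)
    have h3 : |Real.sin p.1 - Real.sin q.1| ≤ ‖p - q‖ := by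
      have := Real.lipschitzWith_sin.dist_le_mul p.1 q.1
      rw [Real.dist_eq, Real.dist_eq, NNReal.coe_one, one_mul] at this
      exact this.trans (norm_fst_le (p - q))
    have h4 : ‖Real.sin p.1 • (c p.2 - c q.2)‖ ≤ B * ‖p - q‖ := by
      rw [norm_smul, Real.norm_eq_abs]
      calc _ ≤ 1 * ‖c p.2 - c q.2‖ :=
            mul_le_mul_of_nonneg_right (Real.abs_sin_le_one _) (norm_nonneg _)
        _ ≤ _ := by rwa [one_mul]
    have h5 : ‖(Real.sin p.1 - Real.sin q.1) • c q.2‖ ≤ ‖p - q‖ * A := by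
      rw [norm_smul, Real.norm_eq_abs]
      exact mul_le_mul h3 (hA _) (norm_nonneg _) (norm_nonneg _)
    rw [h1, norm_smul, Real.norm_eq_abs, abs_of_pos hκ0]
    calc _ ≤ κ * (B * ‖p - q‖ + ‖p - q‖ * A) :=
          mul_le_mul_of_nonneg_left ((norm_add_le _ _).trans (add_le_add h4 h5)) hκ0.le
      _ = κ * (A + B) * ‖p - q‖ := by ring
      _ ≤ 1 / 2 * ‖p - q‖ := mul_le_mul_of_nonneg_right hκAB (norm_nonneg _)
      _ = _ := by push_cast; rfl
  let Φ : ℝ × V → ℝ × V := fun p => p + b p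
  have hΦ : ContDiff ℝ ∞ Φ := contDiff_id.add hb
  have happ : ApproximatesLinearOn Φ
      ((ContinuousLinearEquiv.refl ℝ (ℝ × V) : (ℝ × V) ≃L[ℝ] (ℝ × V)) : (ℝ × V) →L[ℝ] (ℝ × V))
      univ (1 / 2) := by
    intro p _ q _
    have : Φ p - Φ q - (p - q) = b p - b q := by
      simp only [Φ]
      abel
    refine (congrArg norm this).trans_le ?_
    rw [← dist_eq_norm, ← dist_eq_norm]
    exact hbL.dist_le_mul p q
  have hN : ‖((ContinuousLinearEquiv.refl ℝ (ℝ × V)).symm : (ℝ × V) →L[ℝ] (ℝ × V))‖₊ = 1 :=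
    ContinuousLinearMap.nnnorm_id
  let h := happ.toHomeomorph Φ (Or.inr (by
    rw [hN, inv_one]
    exact NNReal.half_lt_self one_ne_zero))
  have hcoe : ∀ p, h p = Φ p := fun p => rfl
  have hsymm : ContDiff ℝ ∞ h.symm := by
    have hder : ∀ p, ∃ L : (ℝ × V) ≃L[ℝ] (ℝ × V), HasFDerivAt Φ (L : (ℝ × V) →L[ℝ] (ℝ × V)) p := by
      intro p
      have h1 : HasFDerivAt b (fderiv ℝ b p) p :=
        (hb.differentiable (by simp) p).hasFDerivAt
      have h2 : ‖fderiv ℝ b p‖ ≤ 1 / 2 := by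
        have := h1.le_of_lipschitz hbL
        simpa using this
      -- the derivative is `1 + Db` with `‖Db‖ ≤ 1/2`, hence invertible by the Neumann series
      let u := Units.oneSub (-fderiv ℝ b p) (by rw [norm_neg]; linarith)
      refine ⟨ContinuousLinearEquiv.unitsEquiv ℝ (ℝ × V) u, ?_⟩
      refine ((hasFDerivAt_id p).add h1).congr_fderiv ?_
      have : (u : (ℝ × V) →L[ℝ] (ℝ × V)) = ContinuousLinearMap.id ℝ _ + fderiv ℝ b p :=
        sub_neg_eq_add _ _
      rw [← this]
      exact ContinuousLinearMap.ext fun x => rfl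
    choose L hL using hder
    exact h.contDiff_symm (f₀' := L) hL hΦ
  refine ⟨κ, hκ0, fun p => (h.symm p).2, contDiff_snd.comp hsymm, fun s z => ?_, fun s z => ?_⟩
  · have : h (s, z) = (s, z + (κ * Real.sin s) • c z) := by
      rw [hcoe]
      exact Prod.ext (add_zero s) rfl
    exact (congrArg (fun p => (h.symm p).2) this.symm).trans
      (congrArg Prod.snd (h.symm_apply_apply (s, z)))
  · have h1 : h (h.symm (s, z)) = (s, z) := h.apply_symm_apply _
    rw [hcoe] at h1
    have h2 : (h.symm (s, z)).1 = s := (add_zero _).symm.trans (congrArg Prod.fst h1)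
    have h3 : (h.symm (s, z)).2 + (κ * Real.sin (h.symm (s, z)).1) • c (h.symm (s, z)).2 = z :=
      congrArg Prod.snd h1
    rw [h2] at h3
    exact h3

section ChartExt

open Classical in
/-- The family of maps of `M` that is `A` in the chart at `x₀` and the identity elsewhere. -/
def chartExt (x₀ : M) (A : ℝ × Vec n → Vec n) (s : ℝ) (x : M) : M :=
  if x ∈ (chart (n := n) x₀).source then (chart (n := n) x₀).symm (A (s, chart (n := n) x₀ x)) else x

variable {x₀ : M} {A B : ℝ × Vec n → Vec n} {K : Set (Vec n)}

lemma chartExt_of_mem {x : M} (hx : x ∈ (chart (n := n) x₀).source) (s : ℝ) :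
    chartExt x₀ A s x = (chart (n := n) x₀).symm (A (s, chart (n := n) x₀ x)) := if_pos hx

lemma chartExt_of_notMem {x : M} (hx : x ∉ (chart (n := n) x₀).source) (s : ℝ) :
    chartExt x₀ A s x = x := if_neg hx

lemma mem_target_of_fix (hKT : K ⊆ (chart (n := n) x₀).target)
    (hfix : ∀ s z, z ∉ K → A (s, z) = z) (hmap : ∀ s z, z ∈ K → A (s, z) ∈ K) {s : ℝ} {z : Vec n}
    (hz : z ∈ (chart (n := n) x₀).target) : A (s, z) ∈ (chart (n := n) x₀).target := by
  by_cases h : z ∈ K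
  · exact hKT (hmap s z h)
  · rwa [hfix s z h]

lemma chartExt_chartExt (hB : ∀ s, ∀ z ∈ (chart (n := n) x₀).target,
      B (s, z) ∈ (chart (n := n) x₀).target)
    (hAB : ∀ s z, A (s, B (s, z)) = z) (s : ℝ) (x : M) :
    chartExt x₀ A s (chartExt x₀ B s x) = x := by
  by_cases hx : x ∈ (chart (n := n) x₀).source
  · have h1 := hB s _ ((chart (n := n) x₀).map_source hx)
    rw [chartExt_of_mem hx, chartExt_of_mem ((chart (n := n) x₀).map_target h1),
      (chart (n := n) x₀).right_inv h1, hAB, (chart (n := n) x₀).left_inv hx]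
  · rw [chartExt_of_notMem hx, chartExt_of_notMem hx]

/-- Near a point outside the domain of the chart the extension is the identity, because `K` is
compact and hence closed in `M`. -/
lemma contMDiff_chartExt [T2Space M] (hK : IsCompact K) (hKT : K ⊆ (chart (n := n) x₀).target)
    (hA : ContDiff ℝ ∞ A) (hfix : ∀ s z, z ∉ K → A (s, z) = z)
    (hmap : ∀ s z, z ∈ K → A (s, z) ∈ K) :
    ContMDiff (𝓘(ℝ, ℝ).prod (𝓡 n)) (𝓡 n) ∞ (fun p : ℝ × M => chartExt x₀ A p.1 p.2) := by
  rintro ⟨s, x⟩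
  by_cases hx : x ∈ (chart (n := n) x₀).source
  · have h1 : ContMDiffAt (𝓘(ℝ, ℝ).prod (𝓡 n)) 𝓘(ℝ, ℝ × Vec n) ∞
        (fun p : ℝ × M => (p.1, chart (n := n) x₀ p.2)) (s, x) := by
      rw [modelWithCornersSelf_prod, ← chartedSpaceSelf_prod]
      exact contMDiffAt_fst.prodMk (ContMDiffAt.comp (s, x)
        (contMDiffAt_extChartAt' (by rwa [extChartAt_source] at hx)) contMDiffAt_snd)
    have h2 : ContMDiffAt (𝓘(ℝ, ℝ).prod (𝓡 n)) 𝓘(ℝ, Vec n) ∞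
        (fun p : ℝ × M => A (p.1, chart (n := n) x₀ p.2)) (s, x) :=
      ContMDiffAt.comp (s, x) (hA.contMDiff.contMDiffAt) h1
    have h3 : ContMDiffAt 𝓘(ℝ, Vec n) (𝓡 n) ∞ (chart (n := n) x₀).symm
        (A (s, chart (n := n) x₀ x)) :=
      (contMDiffOn_extChartAt_symm x₀).contMDiffAt (extChartAt_target_mem_nhds' (I := 𝓡 n)
        (mem_target_of_fix hKT hfix hmap ((chart (n := n) x₀).map_source hx)))
    refine (ContMDiffAt.comp (s, x) h3 h2).congr_of_eventuallyEq ?_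
    filter_upwards [continuousAt_snd.preimage_mem_nhds
      ((isOpen_extChartAt_source x₀).mem_nhds hx)] with p hp
    exact chartExt_of_mem hp p.1
  · have hcl : IsClosed ((chart (n := n) x₀).symm '' K) :=
      (hK.image_of_continuousOn ((continuousOn_extChartAt_symm x₀).mono hKT)).isClosed
    have hx' : x ∉ (chart (n := n) x₀).symm '' K := by
      rintro ⟨z, hz, rfl⟩
      exact hx ((chart (n := n) x₀).map_target (hKT hz))
    refine contMDiffAt_snd.congr_of_eventuallyEq ?_
    filter_upwards [continuousAt_snd.preimage_mem_nhds (hcl.isOpen_compl.mem_nhds hx')] with p hp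
    by_cases h : p.2 ∈ (chart (n := n) x₀).source
    · rw [chartExt_of_mem h, hfix, (chart (n := n) x₀).left_inv h]
      exact fun hz => hp ⟨_, hz, (chart (n := n) x₀).left_inv h⟩
    · exact chartExt_of_notMem h p.1

end ChartExt

/-- For `χ` supported in the domain of the chart at `x₀` and a coordinate vector `u`, the vector
field `χ u` is, up to a positive factor, the velocity at the identity of a smooth family of
diffeomorphisms. -/
lemma exists_diff_family_chart [CompactSpace M] [T2Space M] (x₀ : M) (u : Vec n) (χ : SFun n M)
    (hχ : tsupport χ ⊆ (chart (n := n) x₀).source) :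
    ∃ θ : ℝ → Diff n M, SmoothDiffOn univ θ ∧ (∀ x, θ 0 x = x) ∧ ∃ κ : ℝ, 0 < κ ∧
      ∀ x, (lagVel θ 0 x : Vec n) = (κ * χ x) • ofCoord x₀ x u := by
  classical
  set T := (chart (n := n) x₀).target with hT
  set K := chart (n := n) x₀ '' tsupport χ with hKdef
  have hK : IsCompact K :=
    (isClosed_tsupport _).isCompact.image_of_continuousOn ((continuousOn_extChartAt x₀).mono hχ)
  have hKT : K ⊆ T := by
    rintro _ ⟨x, hx, rfl⟩
    exact (chart (n := n) x₀).map_source (hχ hx)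
  -- the vector field `χ u` in the chart, extended by zero
  let c : Vec n → Vec n := fun z => if z ∈ T then χ ((chart (n := n) x₀).symm z) • u else 0
  have hc0 : ∀ z, z ∉ K → c z = 0 := by
    intro z hz
    by_cases h : z ∈ T
    · have : χ ((chart (n := n) x₀).symm z) = 0 := by
        by_contra hne
        exact hz ⟨_, subset_tsupport _ hne, (chart (n := n) x₀).right_inv h⟩
      simp only [c, h, if_true, this, zero_smul]
    · simp only [c, h, if_false]
  have hc : ContDiff ℝ ∞ c := by
    refine contDiff_iff_contDiffAt.2 fun z => ?_
    by_cases h : z ∈ K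
    · have h1 : T ∈ 𝓝 z := extChartAt_target_mem_nhds' (I := 𝓡 n) (hKT h)
      have h2 := ((contDiffOn_comp_chart_symm x₀ χ.contMDiff).contDiffAt h1).smul
        (contDiffAt_const (c := u))
      refine h2.congr_of_eventuallyEq ?_
      filter_upwards [h1] with w hw
      exact if_pos hw
    · refine contDiffAt_const (c := (0 : Vec n)) |>.congr_of_eventuallyEq ?_
      filter_upwards [hK.isClosed.isOpen_compl.mem_nhds h] with w hw
      exact hc0 w hw
  obtain ⟨κ, hκ, G, hG, hGH, hHG⟩ := exists_inverse_perturbation hc (HasCompactSupport.intro hK hc0)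
  let H : ℝ × Vec n → Vec n := fun p => p.2 + (κ * Real.sin p.1) • c p.2
  have hH : ContDiff ℝ ∞ H := contDiff_snd.add
    ((contDiff_const.mul (Real.contDiff_sin.comp contDiff_fst)).smul (hc.comp contDiff_snd))
  have hHfix : ∀ s z, z ∉ K → H (s, z) = z := fun s z hz => by
    simp only [H, hc0 z hz, smul_zero, add_zero]
  have hGfix : ∀ s z, z ∉ K → G (s, z) = z := fun s z hz => by
    have := hGH s z
    rwa [hc0 z hz, smul_zero, add_zero] at this
  -- both maps are the identity off `K`, so each of them maps `K` to itself
  have hHK : ∀ s z, z ∈ K → H (s, z) ∈ K := fun s z hz => by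
    by_contra h
    have h1 : G (s, H (s, z)) = z := hGH s z
    rw [hGfix s _ h] at h1
    exact h (by rwa [h1])
  have hGK : ∀ s z, z ∈ K → G (s, z) ∈ K := fun s z hz => by
    by_contra h
    have h1 : H (s, G (s, z)) = z := hHG s z
    rw [hHfix s _ h] at h1
    exact h (by rwa [h1])
  have sH := contMDiff_chartExt hK hKT hH hHfix hHK
  have sG := contMDiff_chartExt hK hKT hG hGfix hGK
  have hslice : ∀ s : ℝ, ContMDiff (𝓡 n) (𝓘(ℝ, ℝ).prod (𝓡 n)) ∞ (fun x : M => (s, x)) :=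
    fun s => contMDiff_const.prodMk contMDiff_id
  let θ : ℝ → Diff n M := fun s =>
    { toFun := chartExt x₀ H s
      invFun := chartExt x₀ G s
      left_inv := chartExt_chartExt (fun s z hz => mem_target_of_fix hKT hHfix hHK hz) hGH s
      right_inv := chartExt_chartExt (fun s z hz => mem_target_of_fix hKT hGfix hGK hz) hHG s
      contMDiff_toFun := sH.comp (hslice s)
      contMDiff_invFun := sG.comp (hslice s) }
  have hθ : ∀ s x, θ s x = chartExt x₀ H s x := fun s x => rfl
  refine ⟨θ, ⟨sH.contMDiffOn, sG.contMDiffOn⟩, fun x => ?_, κ, hκ, fun x => ?_⟩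
  · rw [hθ]
    by_cases hx : x ∈ (chart (n := n) x₀).source
    · rw [chartExt_of_mem hx]
      simp only [H, Real.sin_zero, mul_zero, zero_smul, add_zero]
      exact (chart (n := n) x₀).left_inv hx
    · exact chartExt_of_notMem hx 0
  · by_cases hx : x ∈ (chart (n := n) x₀).source
    · set z := chart (n := n) x₀ x with hz
      have hzT : z ∈ T := (chart (n := n) x₀).map_source hx
      let k : ℝ → Vec n := fun s => z + (κ * Real.sin s) • c z
      have hcz : c z = χ x • u := by
        simp only [c, hzT, if_true]
        rw [hz, (chart (n := n) x₀).left_inv hx]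
      have hk : HasDerivAt k ((κ * χ x) • u) 0 := by
        have h1 := (((Real.hasDerivAt_sin 0).const_mul κ).smul_const (c z)).const_add z
        refine h1.congr_deriv ?_
        rw [hcz, Real.cos_zero, mul_one, smul_smul]
      have hk0 : k 0 = z := by simp [k]
      have h2 : HasMFDerivAt 𝓘(ℝ, Vec n) (𝓡 n) (chart (n := n) x₀).symm (k 0)
          (mfderiv 𝓘(ℝ, Vec n) (𝓡 n) (chart (n := n) x₀).symm (k 0)) := by
        rw [hk0]
        exact (((contMDiffOn_extChartAt_symm (n := ∞) x₀).contMDiffAt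
          (extChartAt_target_mem_nhds' (I := 𝓡 n) hzT)).mdifferentiableAt (by simp)).hasMFDerivAt
      have h3 := h2.comp (0 : ℝ) hk.hasFDerivAt.hasMFDerivAt
      have h4 : (fun s => θ s x) = (chart (n := n) x₀).symm ∘ k := by
        funext s
        exact chartExt_of_mem hx s
      have h5 : famVel θ 0 1 x = (mfderiv 𝓘(ℝ, Vec n) (𝓡 n) (chart (n := n) x₀).symm (k 0) :
          Vec n →L[ℝ] Vec n) ((1 : ℝ) • ((κ * χ x) • u)) := by
        rw [famVel, h4]
        exact congrArg (fun L : ℝ →L[ℝ] Vec n => L 1) h3.mfderiv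
      have h6 : ∀ w, w = z → (mfderiv 𝓘(ℝ, Vec n) (𝓡 n) (chart (n := n) x₀).symm w :
          Vec n →L[ℝ] Vec n) ((1 : ℝ) • ((κ * χ x) • u)) = (κ * χ x) • ofCoord x₀ x u := by
        rintro _ rfl
        rw [one_smul]
        exact (ofCoord x₀ x).map_smul _ _
      exact h5.trans (h6 _ hk0)
    · have h1 : χ x = 0 := by
        by_contra hne
        exact hx (hχ (subset_tsupport _ hne))
      have h4 : (fun s => θ s x) = fun _ => x := by
        funext s
        exact chartExt_of_notMem hx s
      have h5 : famVel θ 0 1 x = 0 := by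
        rw [famVel, h4]
        exact congrArg (fun L : ℝ →L[ℝ] Vec n => L 1) (mfderiv_const (c := x))
      rw [h1, mul_zero, zero_smul]
      exact h5

lemma SmoothDiffOn.trans {P : Type*} [NormedAddCommGroup P] [NormedSpace ℝ P] {S : Set P}
    {φ θ : P → Diff n M} (hφ : SmoothDiffOn S φ) (hθ : SmoothDiffOn S θ) :
    SmoothDiffOn S (fun p => (φ p).trans (θ p)) := by
  have h1 : ContMDiffOn (𝓘(ℝ, P).prod (𝓡 n)) (𝓘(ℝ, P).prod (𝓡 n)) ∞
      (fun p : P × M => (p.1, φ p.1 p.2)) (S ×ˢ univ) := contMDiffOn_fst.prodMk hφ.1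
  have h2 : ContMDiffOn (𝓘(ℝ, P).prod (𝓡 n)) (𝓘(ℝ, P).prod (𝓡 n)) ∞
      (fun p : P × M => (p.1, (θ p.1).symm p.2)) (S ×ˢ univ) := contMDiffOn_fst.prodMk hθ.2
  exact ⟨ContMDiffOn.comp (f := fun p : P × M => (p.1, φ p.1 p.2)) hθ.1 h1
      fun p hp => ⟨hp.1, mem_univ _⟩,
    ContMDiffOn.comp (f := fun p : P × M => (p.1, (θ p.1).symm p.2)) hφ.2 h2
      fun p hp => ⟨hp.1, mem_univ _⟩⟩

/-- The velocity of a family of diffeomorphisms at the identity, as a smooth vector field. -/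
lemma exists_vfield_eq_lagVel {θ : ℝ → Diff n M} (hθ : SmoothDiffOn univ θ)
    (h0 : ∀ x, θ 0 x = x) : ∃ L : VField n M, ∀ x, L x = (lagVel θ 0 x : Vec n) := by
  refine ⟨(hθ.smoothFieldOn_eulVel isOpen_univ).toVField (mem_univ 0), fun x => ?_⟩
  have : ∀ y, y = θ 0 x → (eulVel θ 0 y : Vec n) = lagVel θ 0 x := by
    rintro _ rfl
    exact eulVel_apply θ 0 x
  exact this x (h0 x).symm

section Volume

variable [CompactSpace M] [T2Space M] [MeasurableSpace M] [BorelSpace M] {e : ℝ → ℝ → ℝ}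

/-- The fundamental lemma of the calculus of variations, with the velocities of families of
diffeomorphisms as test fields. -/
lemma eq_zero_of_forall_variation (g : RMetric n M) {E : (x : M) → TangentSpace (𝓡 n) x} {r : M → ℝ}
    (hr : Continuous r) (hr0 : ∀ x, 0 < r x)
    (hc : ∀ X : VField n M, Continuous fun x => metricAt g x (E x) (X x))
    (h : ∀ θ : ℝ → Diff n M, SmoothDiffOn univ θ → (∀ x, θ 0 x = x) →
      ∫ x, metricAt g x (E x) (lagVel θ 0 x) * r x ∂riemVol g = 0) (x₀ : M) : E x₀ = 0 := by
  obtain ⟨β⟩ : Nonempty (SmoothBumpFunction (𝓡 n) x₀) := inferInstance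
  let χ : SFun n M := ⟨β, β.contMDiff⟩
  have hχ : tsupport χ ⊆ (chart (n := n) x₀).source := by
    rw [extChartAt_source]
    exact β.tsupport_subset_chartAt_source
  have hχ1 : χ x₀ = 1 := β.eq_one
  obtain ⟨θ, hθ, hθ0, κ, hκ, hv⟩ := exists_diff_family_chart x₀ (E x₀) χ hχ
  obtain ⟨X, hX⟩ := exists_vfield_eq_lagVel hθ hθ0
  -- `X = κ χ E(x₀)` in the chart, and `f X` is again such a velocity for every function `f`, up to a
  -- constant
  have hF : ∀ x, metricAt g x (E x) (X x) * r x = 0 := by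
    refine eq_zero_of_forall_integral_mul g ((hc X).mul hr) fun f => ?_
    obtain ⟨θ', hθ', hθ0', κ', hκ', hv'⟩ := exists_diff_family_chart x₀ (E x₀) (f * χ)
      ((tsupport_mul_subset_right).trans hχ)
    have h1 := h θ' hθ' hθ0'
    have h2 : ∫ x, metricAt g x (E x) (lagVel θ' 0 x) * r x ∂riemVol g =
        ∫ x, (κ' / κ) * (f x * (metricAt g x (E x) (X x) * r x)) ∂riemVol g := by
      refine integral_congr_ae (Filter.Eventually.of_forall fun x => ?_)
      have alg : ∀ {A B C : Vec n} {L : Vec n →L[ℝ] ℝ} {a b c : ℝ}, A = (κ' * (a * b)) • C →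
          B = (κ * b) • C → L A * c = (κ' / κ) * (a * (L B * c)) := by
        rintro A B C L a b c rfl rfl
        rw [map_smul, map_smul, smul_eq_mul, smul_eq_mul]
        field_simp
      exact alg (hv' x) ((hX x).trans (hv x))
    rw [h2, integral_const_mul] at h1
    exact (mul_eq_zero.1 h1).resolve_left (div_pos hκ' hκ).ne'
  have h3 := (mul_eq_zero.1 (hF x₀)).resolve_right (hr0 x₀).ne'
  have h4 : metricAt g x₀ (E x₀) (E x₀) = 0 := by
    have alg : ∀ {A B : Vec n} {L : Vec n →L[ℝ] ℝ}, A = κ • B → L A = 0 → L B = 0 := by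
      rintro A B L rfl hA
      rw [map_smul, smul_eq_mul] at hA
      exact (mul_eq_zero.1 hA).resolve_left hκ.ne'
    refine alg ?_ h3
    refine (hX x₀).trans ((hv x₀).trans ?_)
    rw [hχ1, mul_one, ofCoord_self]
    rfl
  by_contra hne
  exact (metricAt_pos g x₀ hne).ne' h4

/-- The `L²`-gradient is unique. -/
lemma HasL2Gradient.unique {g : RMetric n M} {U : Diff n M → ℝ} {φ : Diff n M} {w w' : VField n M}
    (hw : HasL2Gradient g U φ w) (hw' : HasL2Gradient g U φ w') : w = w' := by
  refine ContMDiffSection.ext fun x₀ => sub_eq_zero.1 ?_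
  refine eq_zero_of_forall_variation g (E := fun x => w x - w' x)
    (contMDiff_density g φ).continuous (density_pos g φ) (fun X => ?_) (fun θ hθ hθ0 => ?_) x₀
  · exact (innerFun g (w - w') X).contMDiff.continuous
  · obtain ⟨L, hL⟩ := exists_vfield_eq_lagVel hθ hθ0
    -- the variation `θ_ε ∘ φ` has velocity `L ∘ φ`
    let ψ : ℝ → Diff n M := fun ε => φ.trans (θ ε)
    have hψ : SmoothDiffOn (Ioo (-1) 1) ψ :=
      (smoothDiffOn_const _ φ).trans (hθ.comp contDiff_id fun _ _ => mem_univ _)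
    have hψ0 : ψ 0 = φ := by
      ext x
      exact hθ0 (φ x)
    have hint : ∀ w : VField n M, ∫ x, g.inner (ψ 0 x) (w (ψ 0 x)) (lagVel ψ 0 x) ∂riemVol g =
        ∫ y, innerFun g w L y * density g φ y ∂riemVol g := by
      intro w
      rw [integral_mul_density g φ (innerFun g w L)]
      refine integral_congr_ae (Filter.Eventually.of_forall fun x => ?_)
      have h1 : ∀ y, y = φ x → metricAt g y (w y) (L (φ x)) =
          metricAt g (φ x) (w (φ x)) (L (φ x)) := by
        rintro _ rfl
        rfl
      have h2 : (lagVel ψ 0 x : Vec n) = L (φ x) := (hL (φ x)).symm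
      have h3 : metricAt g (ψ 0 x) (w (ψ 0 x)) (lagVel ψ 0 x) =
          metricAt g (ψ 0 x) (w (ψ 0 x)) (L (φ x)) :=
        congrArg (metricAt g (ψ 0 x) (w (ψ 0 x))) h2
      exact h3.trans (h1 _ (hθ0 (φ x)))
    have h1 := (hw 1 one_pos ψ hψ hψ0).unique (hw' 1 one_pos ψ hψ hψ0)
    rw [hint, hint, ← sub_eq_zero] at h1
    have hi : ∀ w : VField n M, Integrable (fun y => innerFun g w L y * density g φ y) (riemVol g) :=
      fun w => integrable_riemVol g ((innerFun g w L).contMDiff.continuous.mul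
        (contMDiff_density g φ).continuous)
    refine Eq.trans (integral_congr_ae (Filter.Eventually.of_forall fun x => ?_))
      ((integral_sub (hi w) (hi w')).trans h1)
    have alg : ∀ {A B C D : Vec n} {r : ℝ}, C = D →
        metricAt g x (A - B) D * r = metricAt g x A C * r - metricAt g x B C * r := by
      rintro A B C D r rfl
      rw [map_sub, _root_.sub_apply, sub_mul]
    exact alg (hL x)

/-! ### Newton's equations and the Euler system -/

/-- The specific force `ρ⁻¹ ∇P(ρ, σ)`. -/
def pressureField (g : RMetric n M) (he : ContDiffOn ℝ ∞ (fun p : ℝ × ℝ => e p.1 p.2) (Ioi 0 ×ˢ univ))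
    (ρ σ : SFun n M) (h0 : ∀ x, 0 < ρ x) : VField n M :=
  smulField (((smoothFunOn_const (univ : Set ℝ) ρ).inv isOpen_univ
    fun _ _ x => (h0 x).ne').toSFun (mem_univ (0 : ℝ)))
    (gradField g (stateFun (contDiffOn_pressure he) ρ σ h0))

lemma exists_hasL2Gradient_potential (g : RMetric n M)
    (he : ContDiffOn ℝ ∞ (fun p : ℝ × ℝ => e p.1 p.2) (Ioi 0 ×ˢ univ)) (s₀ : SFun n M)
    (φ : Diff n M) : ∃ w : VField n M, HasL2Gradient g (potential g e s₀) φ w ∧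
      ∀ x, w x = (density g φ x)⁻¹ •
        grad g (fun y => pressure e (density g φ y) (push g φ s₀ y)) x := by
  let w := pressureField g he ⟨_, contMDiff_density g φ⟩ ⟨_, contMDiff_push g φ s₀.contMDiff⟩
    (density_pos g φ)
  exact ⟨w, hasL2Gradient_potential g he s₀ φ w fun x => rfl, fun x => rfl⟩

/-- Newton's equations at `x` are the momentum equation at `φ_t x`; both continuity equations hold
for every curve of diffeomorphisms. -/
lemma isNewtonCurve_iff_isEulerSolution (g : RMetric n M)
    (he : ContDiffOn ℝ ∞ (fun p : ℝ × ℝ => e p.1 p.2) (Ioi 0 ×ˢ univ)) (s₀ : SFun n M)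
    {J : Set ℝ} (hJ : IsOpen J) {φ : ℝ → Diff n M} (hφ : SmoothDiffOn J φ) :
    IsNewtonCurve g e s₀ J φ ↔ IsEulerSolution g (pressure e) J (eulVel φ)
      (fun t => density g (φ t)) (fun t => push g (φ t) s₀) := by
  have key : ∀ t ∈ J, ∀ (w : VField n M), (∀ x, w x = (density g (φ t) x)⁻¹ •
      grad g (fun y => pressure e (density g (φ t) y) (push g (φ t) s₀ y)) x) → ∀ x,
      (curveAccel g (fun s => φ s x) t = -w (φ t x) ↔
        deriv (fun s => eulVel φ s (φ t x)) t + covDeriv g (eulVel φ t) (eulVel φ t) (φ t x) +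
          (density g (φ t) (φ t x))⁻¹ • grad g (fun y => pressure e (density g (φ t) y)
            (push g (φ t) s₀ y)) (φ t x) = 0) := by
    intro t ht w hw x
    rw [← hw (φ t x), ← hφ.curveAccel_eq g hJ ht x]
    exact eq_neg_iff_add_eq_zero
  constructor
  · intro hN
    refine ⟨hφ.smoothFieldOn_eulVel hJ, hφ.density hJ g, hφ.push hJ g s₀.contMDiff,
      fun t ht y => ⟨?_, deriv_push_add_divergence g hJ hφ (ContMDiffMap.const 1) ht y,
        deriv_push_add_divergence g hJ hφ s₀ ht y⟩⟩
    obtain ⟨w, hw, hacc⟩ := hN t ht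
    obtain ⟨w', hw', hform⟩ := exists_hasL2Gradient_potential g he s₀ (φ t)
    obtain rfl := hw.unique hw'
    obtain ⟨x, rfl⟩ := (φ t).surjective y
    exact (key t ht w hform x).1 (hacc x)
  · rintro ⟨-, -, -, hE⟩ t ht
    obtain ⟨w, hw, hform⟩ := exists_hasL2Gradient_potential g he s₀ (φ t)
    exact ⟨w, hw, fun x => (key t ht w hform x).2 (hE t ht (φ t x)).1⟩

end Volume

/-! ### The first variation of the action -/

lemma curveAccel_congr (g : RMetric n M) {c c' : ℝ → M} {t : ℝ} (h : c =ᶠ[𝓝 t] c') :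
    (curveAccel g c t : Vec n) = curveAccel g c' t := by
  have h0 : c t = c' t := h.eq_of_nhds
  have h1 : (curveVel c t : Vec n) = curveVel c' t :=
    congrArg (fun L : ℝ →L[ℝ] Vec n => L 1) h.mfderiv_eq
  have h2 : iteratedDeriv 2 (fun s => chart (n := n) (c t) (c s)) t =
      iteratedDeriv 2 (fun s => chart (n := n) (c' t) (c' s)) t := by
    rw [h0]
    refine Filter.EventuallyEq.iteratedDeriv_eq 2 ?_
    filter_upwards [h] with s hs
    rw [hs]
  let F : M → Vec n → Vec n → Vec n := fun y a v =>
    let c : Vec n := christoffel g y v v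
    a + c
  have alg : ∀ {y y' : M} {a a' v v' : Vec n}, y = y' → a = a' → v = v' → F y a v = F y' a' v' := by
    rintro y _ a _ v _ rfl rfl rfl
    rfl
  exact alg h0 h2 h1

/-- The chain rule along a curve of parameters, at a fixed point of `M`. -/
lemma SmoothFunOn.hasDerivAt_comp {P : Type*} [NormedAddCommGroup P] [NormedSpace ℝ P] {S : Set P}
    (hS : IsOpen S) {f : P → M → ℝ} (hf : SmoothFunOn n S f) {k : ℝ → P} {u : P} {t : ℝ}
    (hk : HasDerivAt k u t) (hp : k t ∈ S) (x : M) :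
    HasDerivAt (fun s => f (k s) x) (_root_.fderiv ℝ (fun p => f p x) (k t) u) t :=
  ((hf.contDiffAt hS hp x).differentiableAt (by simp)).hasFDerivAt.comp_hasDerivAt
    (f := k) t hk

section Volume

variable [CompactSpace M] [T2Space M] [MeasurableSpace M] [BorelSpace M] {e : ℝ → ℝ → ℝ}

/-- The density `|∂_t φ|² / 2 - e(ρ, σ) ρ` of the Lagrangian along a two-parameter family. -/
def lagDensity (g : RMetric n M) (e : ℝ → ℝ → ℝ) (s₀ : SFun n M) (Φ : ℝ × ℝ → Diff n M)
    (p : ℝ × ℝ) (x : M) : ℝ :=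
  1 / 2 * famInner g Φ (0, 1) (0, 1) p x -
    energyDensity e (density g (Φ p) x, push g (Φ p) s₀ x)

lemma smoothFunOn_energy (g : RMetric n M)
    (he : ContDiffOn ℝ ∞ (fun p : ℝ × ℝ => e p.1 p.2) (Ioi 0 ×ˢ univ)) (s₀ : SFun n M)
    {P : Type*} [NormedAddCommGroup P] [NormedSpace ℝ P] [FiniteDimensional ℝ P] {S : Set P}
    (hS : IsOpen S) {Φ : P → Diff n M} (hΦ : SmoothDiffOn S Φ) :
    SmoothFunOn n S (fun p x => energyDensity e (density g (Φ p) x, push g (Φ p) s₀ x)) :=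
  (hΦ.density hS g).comp₂ hS (hΦ.push hS g s₀.contMDiff) isOpen_posStates
    (contDiffOn_energyDensity he) fun p _ x => ⟨density_pos g (Φ p) x, mem_univ _⟩

lemma smoothFunOn_lagDensity (g : RMetric n M)
    (he : ContDiffOn ℝ ∞ (fun p : ℝ × ℝ => e p.1 p.2) (Ioi 0 ×ˢ univ)) (s₀ : SFun n M)
    {S : Set (ℝ × ℝ)} (hS : IsOpen S) {Φ : ℝ × ℝ → Diff n M} (hΦ : SmoothDiffOn S Φ) :
    SmoothFunOn n S (lagDensity g e s₀ Φ) :=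
  ((smoothFunOn_const S (ContMDiffMap.const (1 / 2))).mul (hΦ.famInner hS g (0, 1) (0, 1))).sub
    (smoothFunOn_energy g he s₀ hS hΦ)

lemma lagrangian_eq_integral (g : RMetric n M)
    (he : ContDiffOn ℝ ∞ (fun p : ℝ × ℝ => e p.1 p.2) (Ioi 0 ×ˢ univ)) (s₀ : SFun n M)
    {S : Set (ℝ × ℝ)} (hS : IsOpen S) {Φ : ℝ × ℝ → Diff n M} (hΦ : SmoothDiffOn S Φ) {ε t : ℝ}
    (hp : (ε, t) ∈ S) :
    lagrangian g e s₀ (Φ (ε, t)) (lagVel (fun s => Φ (ε, s)) t) =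
      ∫ x, lagDensity g e s₀ Φ (ε, t) x ∂riemVol g := by
  have hk : HasDerivAt (fun s : ℝ => (ε, s)) ((0 : ℝ), (1 : ℝ)) t :=
    (hasDerivAt_const t ε).prodMk (hasDerivAt_id t)
  have h1 := integrable_sfun g
    (((smoothFunOn_const S (ContMDiffMap.const (1 / 2))).mul (hΦ.famInner hS g (0, 1) (0, 1))).sfun hp)
  have h2 := integrable_sfun g ((smoothFunOn_energy g he s₀ hS hΦ).sfun hp)
  refine Eq.trans ?_ (integral_sub h1 h2).symm
  refine congrArg (· - ∫ x, energyDensity e (density g (Φ (ε, t)) x, push g (Φ (ε, t)) s₀ x)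
    ∂riemVol g) ?_
  refine Eq.trans ?_ (integral_const_mul (1 / 2 : ℝ) _).symm
  refine congrArg (1 / 2 * ·) (integral_congr_ae (Filter.Eventually.of_forall fun x => ?_))
  exact congrArg (fun v : Vec n => metricAt g (Φ (ε, t) x) v v) (hΦ.lagVel_comp hS hk hp x)

/-- The residual `∇_{∂_t c} ∂_t c + w` of Newton's equations with force `-w`, along the paths
`c = Φ (0, ·) x`, paired with the variation `∂_ε Φ` and integrated over `M`. -/
def virtualWork (g : RMetric n M) (Φ : ℝ × ℝ → Diff n M) (w : ℝ → VField n M) (t : ℝ) : ℝ :=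
  ∫ x, metricAt g (Φ (0, t) x) (curveAccel g (fun s => Φ (0, s) x) t + w t (Φ (0, t) x))
    (famVel Φ (0, t) (1, 0) x) ∂riemVol g

/-- The first variation of the Lagrangian, up to a total time derivative. -/
lemma integral_fderiv_lagDensity (g : RMetric n M)
    (he : ContDiffOn ℝ ∞ (fun p : ℝ × ℝ => e p.1 p.2) (Ioi 0 ×ˢ univ)) (s₀ : SFun n M)
    {J : Set ℝ} (hJ : IsOpen J) {δ : ℝ} (hδ : 0 < δ) {Φ : ℝ × ℝ → Diff n M}
    (hΦ : SmoothDiffOn (Ioo (-δ) δ ×ˢ J) Φ) {w : ℝ → VField n M} {t : ℝ} (ht : t ∈ J)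
    (hw : HasL2Gradient g (potential g e s₀) (Φ (0, t)) (w t)) :
    ∫ x, fderiv ℝ (fun p => lagDensity g e s₀ Φ p x) (0, t) (1, 0) ∂riemVol g =
      (∫ x, fderiv ℝ (fun p => famInner g Φ (1, 0) (0, 1) p x) (0, t) (0, 1) ∂riemVol g) -
        virtualWork g Φ w t := by
  have hS : IsOpen (Ioo (-δ) δ ×ˢ J) := isOpen_Ioo.prod hJ
  have h0 : (0 : ℝ) ∈ Ioo (-δ) δ := by constructor <;> linarith
  have hp : ((0 : ℝ), t) ∈ Ioo (-δ) δ ×ˢ J := ⟨h0, ht⟩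
  have hk : HasDerivAt (fun s : ℝ => (s, t)) ((1 : ℝ), (0 : ℝ)) 0 :=
    (hasDerivAt_id 0).prodMk (hasDerivAt_const 0 t)
  have hkc : ContDiff ℝ ∞ (fun s : ℝ => (s, t)) := contDiff_id.prodMk contDiff_const
  have hkm : MapsTo (fun s : ℝ => (s, t)) (Ioo (-δ) δ) (Ioo (-δ) δ ×ˢ J) := fun s hs => ⟨hs, ht⟩
  have hK := hΦ.famInner hS g (0, 1) (0, 1)
  have hB := hΦ.famInner hS g (1, 0) (0, 1)
  have hΛ := smoothFunOn_lagDensity g he s₀ hS hΦ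
  have hψ := hΦ.comp hkc hkm
  have hE := smoothFunOn_energy g he s₀ hS hΦ
  -- the derivative of the potential energy
  have dU := hw δ hδ (fun s => Φ (s, t)) hψ rfl
  have dU' := hasDerivAt_integral_family g isOpen_Ioo (hE.comp hkc hkm) h0
  have eU : ∫ x, fderiv ℝ (fun p => energyDensity e (density g (Φ p) x, push g (Φ p) s₀ x))
      (0, t) (1, 0) ∂riemVol g = ∫ x, metricAt g (Φ (0, t) x) (w t (Φ (0, t) x))
        (famVel Φ (0, t) (1, 0) x) ∂riemVol g := by
    refine Eq.trans (integral_congr_ae (Filter.Eventually.of_forall fun x => ?_))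
      ((dU'.unique dU).trans (integral_congr_ae (Filter.Eventually.of_forall fun x => ?_)))
    · exact (hE.hasDerivAt_comp hS hk hp x).deriv.symm
    · exact congrArg (metricAt g (Φ (0, t) x) (w t (Φ (0, t) x))) (hΦ.lagVel_comp hS hk hp x)
  have c1 := integrable_sfun g ((hK.fderiv hS (1, 0)).sfun hp)
  have c2 := integrable_sfun g ((hE.fderiv hS (1, 0)).sfun hp)
  have c3 := integrable_sfun g ((hB.fderiv hS (0, 1)).sfun hp)
  have c4 : Integrable (fun x => metricAt g (Φ (0, t) x) (w t (Φ (0, t) x))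
      (famVel Φ (0, t) (1, 0) x)) (riemVol g) := by
    have h1 := (innerFun g (w t) ((hΦ.smoothFieldOn_famEul hS (1, 0)).toVField hp)).contMDiff.continuous
    refine integrable_riemVol g ((h1.comp (Φ (0, t)).continuous).congr fun x => ?_)
    exact congrArg (metricAt g (Φ (0, t) x) (w t (Φ (0, t) x))) (famEul_apply Φ (0, t) (1, 0) x)
  -- the first variation of the kinetic energy, pointwise
  have hsplit : ∀ x, metricAt g (Φ (0, t) x)
      (curveAccel g (fun s => Φ (0, s) x) t + w t (Φ (0, t) x)) (famVel Φ (0, t) (1, 0) x) =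
      (fderiv ℝ (fun p => famInner g Φ (1, 0) (0, 1) p x) (0, t) (0, 1) -
        1 / 2 * fderiv ℝ (fun p => famInner g Φ (0, 1) (0, 1) p x) (0, t) (1, 0)) +
      metricAt g (Φ (0, t) x) (w t (Φ (0, t) x)) (famVel Φ (0, t) (1, 0) x) := by
    intro x
    have h1 := fderiv_famInner g hS hΦ hp x
    have alg : ∀ {y : M} {A W V : Vec n} {a b : ℝ}, a / 2 = b - metricAt g y V A →
        metricAt g y (A + W) V = (b - 1 / 2 * a) + metricAt g y W V := by
      intro y A W V a b h
      rw [map_add, _root_.add_apply, metricAt_symm g y A V]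
      linarith
    exact alg h1
  have hV : virtualWork g Φ w t =
      ((∫ x, fderiv ℝ (fun p => famInner g Φ (1, 0) (0, 1) p x) (0, t) (0, 1) ∂riemVol g) -
        1 / 2 * ∫ x, fderiv ℝ (fun p => famInner g Φ (0, 1) (0, 1) p x) (0, t) (1, 0) ∂riemVol g) +
      ∫ x, metricAt g (Φ (0, t) x) (w t (Φ (0, t) x)) (famVel Φ (0, t) (1, 0) x) ∂riemVol g := by
    have c5 := c3.sub (c1.const_mul (1 / 2))
    rw [← integral_const_mul, ← integral_sub c3 (c1.const_mul (1 / 2))]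
    exact (integral_congr_ae (Filter.Eventually.of_forall hsplit)).trans (integral_add c5 c4)
  have hL : ∫ x, fderiv ℝ (fun p => lagDensity g e s₀ Φ p x) (0, t) (1, 0) ∂riemVol g =
      1 / 2 * (∫ x, fderiv ℝ (fun p => famInner g Φ (0, 1) (0, 1) p x) (0, t) (1, 0) ∂riemVol g) -
      ∫ x, fderiv ℝ (fun p => energyDensity e (density g (Φ p) x, push g (Φ p) s₀ x))
        (0, t) (1, 0) ∂riemVol g := by
    rw [← integral_const_mul, ← integral_sub (c1.const_mul (1 / 2)) c2]
    refine integral_congr_ae (Filter.Eventually.of_forall fun x => ?_)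
    have d1 := ((hK.contDiffAt hS hp x).differentiableAt (by simp)).hasFDerivAt
    have d2 := ((hE.contDiffAt hS hp x).differentiableAt (by simp)).hasFDerivAt
    exact congrArg (fun L : ℝ × ℝ →L[ℝ] ℝ => L (1, 0)) ((d1.const_mul (1 / 2)).sub d2).fderiv
  rw [hL, hV, eU]
  ring

lemma continuousOn_virtualWork (g : RMetric n M)
    (he : ContDiffOn ℝ ∞ (fun p : ℝ × ℝ => e p.1 p.2) (Ioi 0 ×ˢ univ)) (s₀ : SFun n M)
    {J : Set ℝ} (hJ : IsOpen J) {δ : ℝ} (hδ : 0 < δ) {Φ : ℝ × ℝ → Diff n M}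
    (hΦ : SmoothDiffOn (Ioo (-δ) δ ×ˢ J) Φ) {w : ℝ → VField n M}
    (hw : ∀ t ∈ J, HasL2Gradient g (potential g e s₀) (Φ (0, t)) (w t)) :
    ContinuousOn (virtualWork g Φ w) J := by
  have hS : IsOpen (Ioo (-δ) δ ×ˢ J) := isOpen_Ioo.prod hJ
  have h0 : (0 : ℝ) ∈ Ioo (-δ) δ := by constructor <;> linarith
  have hm : MapsTo (fun t : ℝ => ((0 : ℝ), t)) J (Ioo (-δ) δ ×ˢ J) := fun t ht => ⟨h0, ht⟩
  have hc : ContinuousOn (fun t : ℝ => ((0 : ℝ), t)) J := by fun_prop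
  -- no continuity of `w` in time is known; the work is expressed by the other two terms of the first
  -- variation
  have h1 := (continuousOn_integral_family g
    ((hΦ.famInner hS g (1, 0) (0, 1)).fderiv hS (0, 1))).comp hc hm
  have h2 := (continuousOn_integral_family g
    ((smoothFunOn_lagDensity g he s₀ hS hΦ).fderiv hS (1, 0))).comp hc hm
  refine (h1.sub h2).congr fun t ht => ?_
  have h3 := integral_fderiv_lagDensity g he s₀ hJ hδ hΦ ht (hw t ht)
  have alg : ∀ {a b c : ℝ}, a = b - c → c = b - a := by
    intro a b c h
    linarith
  exact alg h3

/-- The first variation of the action: integration by parts in time leaves no boundary terms,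
because the endpoints are fixed. -/
lemma hasDerivAt_action (g : RMetric n M)
    (he : ContDiffOn ℝ ∞ (fun p : ℝ × ℝ => e p.1 p.2) (Ioi 0 ×ˢ univ)) (s₀ : SFun n M)
    {J : Set ℝ} (hJ : IsOpen J) {δ : ℝ} (hδ : 0 < δ) {Φ : ℝ × ℝ → Diff n M}
    (hΦ : SmoothDiffOn (Ioo (-δ) δ ×ˢ J) Φ) {w : ℝ → VField n M}
    (hw : ∀ t ∈ J, HasL2Gradient g (potential g e s₀) (Φ (0, t)) (w t)) {t₀ t₁ : ℝ} (h01 : t₀ ≤ t₁)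
    (hI : Icc t₀ t₁ ⊆ J) (hfix₀ : ∀ ε ∈ Ioo (-δ) δ, Φ (ε, t₀) = Φ (0, t₀))
    (hfix₁ : ∀ ε ∈ Ioo (-δ) δ, Φ (ε, t₁) = Φ (0, t₁)) :
    HasDerivAt (fun ε => ∫ t in t₀..t₁, lagrangian g e s₀ (Φ (ε, t)) (lagVel (fun s => Φ (ε, s)) t))
      (-∫ t in t₀..t₁, virtualWork g Φ w t) 0 := by
  have hS : IsOpen (Ioo (-δ) δ ×ˢ J) := isOpen_Ioo.prod hJ
  have h0 : (0 : ℝ) ∈ Ioo (-δ) δ := by constructor <;> linarith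
  have hΛ := smoothFunOn_lagDensity g he s₀ hS hΦ
  have hB := hΦ.famInner hS g (1, 0) (0, 1)
  have hsub : Ioo (-δ) δ ×ˢ Icc t₀ t₁ ⊆ Ioo (-δ) δ ×ˢ J := prod_mono_right hI
  have hd : ∀ ε ∈ Ioo (-δ) δ, ∀ t ∈ Icc t₀ t₁,
      HasDerivAt (fun s => ∫ x, lagDensity g e s₀ Φ (s, t) x ∂riemVol g)
        (∫ x, fderiv ℝ (fun p => lagDensity g e s₀ Φ p x) (ε, t) (1, 0) ∂riemVol g) ε := by
    intro ε hε t ht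
    have hk : HasDerivAt (fun s : ℝ => (s, t)) ((1 : ℝ), (0 : ℝ)) ε :=
      (hasDerivAt_id ε).prodMk (hasDerivAt_const ε t)
    have h1 := hasDerivAt_integral_family g isOpen_Ioo (hΛ.comp (k := fun s : ℝ => (s, t))
      (contDiff_id.prodMk contDiff_const) fun s hs => ⟨hs, hI ht⟩) hε
    refine h1.congr_deriv (integral_congr_ae (Filter.Eventually.of_forall fun x => ?_))
    exact (hΛ.hasDerivAt_comp hS hk ⟨hε, hI ht⟩ x).deriv
  have hA := hasDerivAt_setIntegral_of_continuousOn (ν := volume) (isCompact_Icc (a := t₀) (b := t₁))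
    measurableSet_Icc measure_Icc_lt_top isOpen_Ioo
    (f := fun ε t => ∫ x, lagDensity g e s₀ Φ (ε, t) x ∂riemVol g)
    (f' := fun ε t => ∫ x, fderiv ℝ (fun p => lagDensity g e s₀ Φ p x) (ε, t) (1, 0) ∂riemVol g)
    ((continuousOn_integral_family g hΛ).mono hsub)
    ((continuousOn_integral_family g (hΛ.fderiv hS (1, 0))).mono hsub) hd h0
  have hIcc : ∀ f : ℝ → ℝ, ∫ t in Icc t₀ t₁, f t = ∫ t in t₀..t₁, f t := fun f => by
    rw [integral_Icc_eq_integral_Ioc, ← intervalIntegral.integral_of_le h01]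
  rw [hIcc] at hA
  refine (hA.congr_deriv ?_).congr_of_eventuallyEq ?_
  · -- integration by parts in time
    have hm : MapsTo (fun t : ℝ => ((0 : ℝ), t)) J (Ioo (-δ) δ ×ˢ J) := fun t ht => ⟨h0, ht⟩
    have hBd : ∀ t ∈ J, HasDerivAt (fun t => ∫ x, famInner g Φ (1, 0) (0, 1) (0, t) x ∂riemVol g)
        (∫ x, fderiv ℝ (fun p => famInner g Φ (1, 0) (0, 1) p x) (0, t) (0, 1) ∂riemVol g) t := by
      intro t ht
      have hk : HasDerivAt (fun s : ℝ => ((0 : ℝ), s)) ((0 : ℝ), (1 : ℝ)) t :=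
        (hasDerivAt_const t 0).prodMk (hasDerivAt_id t)
      have h1 := hasDerivAt_integral_family g hJ (hB.comp (k := fun s : ℝ => ((0 : ℝ), s))
        (contDiff_const.prodMk contDiff_id) hm) ht
      refine h1.congr_deriv (integral_congr_ae (Filter.Eventually.of_forall fun x => ?_))
      exact (hB.hasDerivAt_comp hS hk ⟨h0, ht⟩ x).deriv
    have hc1 : ContinuousOn (fun t => ∫ x, fderiv ℝ (fun p => famInner g Φ (1, 0) (0, 1) p x)
        (0, t) (0, 1) ∂riemVol g) J :=
      (continuousOn_integral_family g (hB.fderiv hS (0, 1))).comp (f := fun t : ℝ => ((0 : ℝ), t))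
        (by fun_prop) hm
    have hc2 := continuousOn_virtualWork g he s₀ hJ hδ hΦ hw
    have hu : uIcc t₀ t₁ ⊆ J := by rwa [uIcc_of_le h01]
    have i1 := (hc1.mono hu).intervalIntegrable (μ := volume)
    have i2 := (hc2.mono hu).intervalIntegrable (μ := volume)
    have hFTC := intervalIntegral.integral_eq_sub_of_hasDerivAt (fun t ht => hBd t (hu ht)) i1
    -- the variation vanishes at the endpoints
    have hend : ∀ t ∈ J, (∀ ε ∈ Ioo (-δ) δ, Φ (ε, t) = Φ (0, t)) →
        ∫ x, famInner g Φ (1, 0) (0, 1) (0, t) x ∂riemVol g = 0 := by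
      intro t ht hfix
      refine (integral_congr_ae (Filter.Eventually.of_forall fun x => ?_)).trans (integral_zero M ℝ)
      have hk : HasDerivAt (fun s : ℝ => (s, t)) ((1 : ℝ), (0 : ℝ)) 0 :=
        (hasDerivAt_id 0).prodMk (hasDerivAt_const 0 t)
      have h1 : famVel Φ (0, t) (1, 0) x = 0 := by
        refine (hΦ.lagVel_comp hS hk ⟨h0, ht⟩ x).symm.trans ?_
        have h2 : (fun s => Φ (s, t) x) =ᶠ[𝓝 0] fun _ => Φ (0, t) x := by
          filter_upwards [isOpen_Ioo.mem_nhds h0] with s hs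
          rw [hfix s hs]
        have h3 : (mfderiv 𝓘(ℝ, ℝ) (𝓡 n) (fun s => Φ (s, t) x) 0 : ℝ →L[ℝ] Vec n) = 0 :=
          h2.mfderiv_eq.trans (mfderiv_const (c := Φ (0, t) x))
        exact congrArg (fun L : ℝ →L[ℝ] Vec n => L 1) h3
      have alg : ∀ {y : M} {A B : Vec n}, A = 0 → metricAt g y A B = 0 := by
        rintro y A B rfl
        simp
      exact alg h1
    rw [hend t₁ (hI (right_mem_Icc.2 h01)) hfix₁, hend t₀ (hI (left_mem_Icc.2 h01)) hfix₀,
      sub_zero] at hFTC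
    have hsplit := intervalIntegral.integral_sub i1 i2
    rw [hFTC, zero_sub] at hsplit
    refine Eq.trans (intervalIntegral.integral_congr fun t ht => ?_) hsplit
    exact integral_fderiv_lagDensity g he s₀ hJ hδ hΦ (hu ht) (hw t (hu ht))
  · filter_upwards [isOpen_Ioo.mem_nhds h0] with ε hε
    rw [hIcc]
    refine intervalIntegral.integral_congr fun t ht => ?_
    rw [uIcc_of_le h01] at ht
    exact lagrangian_eq_integral g he s₀ hS hΦ ⟨hε, hI ht⟩

/-- Newton's equations make the integrand of the first variation vanish. -/
lemma IsNewtonCurve.isCriticalCurve {g : RMetric n M}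
    (he : ContDiffOn ℝ ∞ (fun p : ℝ × ℝ => e p.1 p.2) (Ioi 0 ×ˢ univ)) {s₀ : SFun n M}
    {J : Set ℝ} (hJ : IsOpen J) {φ : ℝ → Diff n M} (hN : IsNewtonCurve g e s₀ J φ) :
    IsCriticalCurve g e s₀ J φ := by
  intro t₀ t₁ h01 hI δ hδ Φ hΦ hΦφ hfix
  have h0 : (0 : ℝ) ∈ Ioo (-δ) δ := by constructor <;> linarith
  choose! w hw using hN
  have hw' : ∀ t ∈ J, HasL2Gradient g (potential g e s₀) (Φ 0 t) (w t) := fun t ht => by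
    rw [hΦφ t ht]
    exact (hw t ht).1
  have h1 := hasDerivAt_action g he s₀ hJ hδ (Φ := fun p => Φ p.1 p.2) hΦ hw' h01 hI
    (fun ε hε => (hfix ε hε).1.trans (hfix 0 h0).1.symm)
    (fun ε hε => (hfix ε hε).2.trans (hfix 0 h0).2.symm)
  refine h1.congr_deriv ?_
  rw [neg_eq_zero]
  refine (intervalIntegral.integral_congr fun t ht => ?_).trans intervalIntegral.integral_zero
  rw [uIcc_of_le h01] at ht
  have htJ := hI ht
  refine (integral_congr_ae (Filter.Eventually.of_forall fun x => ?_)).trans (integral_zero M ℝ)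
  have h2 : (curveAccel g (fun s => Φ 0 s x) t : Vec n) = curveAccel g (fun s => φ s x) t := by
    refine curveAccel_congr g ?_
    filter_upwards [hJ.mem_nhds htJ] with s hs
    rw [hΦφ s hs]
  have h3 : (curveAccel g (fun s => φ s x) t : Vec n) = -w t (φ t x) := (hw t htJ).2 x
  have h4 : (w t (Φ 0 t x) : Vec n) = w t (φ t x) := by
    have : ∀ y, y = φ t x → (w t y : Vec n) = w t (φ t x) := by
      rintro _ rfl
      rfl
    exact this _ (congrArg (fun η : Diff n M => η x) (hΦφ t htJ))
  have alg : ∀ {y : M} {a a' b b' V : Vec n}, a = a' → a' = -b' → b = b' →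
      metricAt g y (a + b) V = 0 := by
    rintro y a _ b _ V rfl rfl rfl
    rw [neg_add_cancel, map_zero]
    rfl
  exact alg h2 h3 h4

lemma SmoothDiffOn.trans_mul {J : Set ℝ} {φ θ : ℝ → Diff n M}
    (hφ : SmoothDiffOn J φ) (hθ : SmoothDiffOn univ θ) {f : ℝ → ℝ} (hf : ContDiff ℝ ∞ f) (δ : ℝ) :
    SmoothDiffOn (Ioo (-δ) δ ×ˢ J) (fun p => (φ p.2).trans (θ (p.1 * f p.2))) :=
  (hφ.comp contDiff_snd fun _ hp => hp.2).trans
    (hθ.comp (contDiff_fst.mul (hf.comp contDiff_snd)) fun _ _ => mem_univ _)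

/-- The virtual work of a variation `θ_{ε f(t)} ∘ φ_t` in Eulerian form. -/
lemma virtualWork_trans (g : RMetric n M) {J : Set ℝ} (hJ : IsOpen J) {φ θ : ℝ → Diff n M}
    (hφ : SmoothDiffOn J φ) (hθ : SmoothDiffOn univ θ) (hθ0 : ∀ x, θ 0 x = x) {f : ℝ → ℝ}
    (hf : ContDiff ℝ ∞ f) (w : ℝ → VField n M) {t : ℝ} (ht : t ∈ J) :
    virtualWork g (fun p => (φ p.2).trans (θ (p.1 * f p.2))) w t =
      f t * ∫ y, metricAt g y (deriv (fun s => eulVel φ s y) t +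
        covDeriv g (eulVel φ t) (eulVel φ t) y + w t y) (lagVel θ 0 y) * density g (φ t) y
          ∂riemVol g := by
  set Φ : ℝ × ℝ → Diff n M := fun p => (φ p.2).trans (θ (p.1 * f p.2)) with hΦdef
  have hΦ := hφ.trans_mul hθ hf 1
  have hS : IsOpen (Ioo (-1 : ℝ) 1 ×ˢ J) := isOpen_Ioo.prod hJ
  have hp : ((0 : ℝ), t) ∈ Ioo (-1 : ℝ) 1 ×ˢ J := ⟨by constructor <;> norm_num, ht⟩
  rw [integral_mul_density g (φ t) (fun y => metricAt g y (deriv (fun s => eulVel φ s y) t +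
    covDeriv g (eulVel φ t) (eulVel φ t) y + w t y) (lagVel θ 0 y)), ← integral_const_mul]
  refine integral_congr_ae (Filter.Eventually.of_forall fun x => ?_)
  have hvel : famVel Φ (0, t) (1, 0) x = f t • (lagVel θ 0 (φ t x) : Vec n) := by
    have hk : HasDerivAt (fun s : ℝ => (s, t)) ((1 : ℝ), (0 : ℝ)) 0 :=
      (hasDerivAt_id 0).prodMk (hasDerivAt_const 0 t)
    refine (hΦ.lagVel_comp hS hk hp x).symm.trans ?_
    have hk2 : HasDerivAt (fun s : ℝ => s * f t) (f t) 0 := by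
      simpa using (hasDerivAt_id (0 : ℝ)).mul_const (f t)
    refine (hθ.lagVel_comp isOpen_univ hk2 (mem_univ _) (φ t x)).trans ?_
    have h1 : ∀ a : ℝ, a = 0 → famVel θ a (f t) (φ t x) = f t • famVel θ 0 1 (φ t x) := by
      rintro _ rfl
      have alg : ∀ (L : ℝ →L[ℝ] Vec n) (a : ℝ), L a = a • L 1 := fun L a => by
        rw [← map_smul, smul_eq_mul, mul_one]
      exact alg (mfderiv 𝓘(ℝ, ℝ) (𝓡 n) (fun p' => θ p' (φ t x)) 0) (f t)
    exact h1 _ (zero_mul _)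
  have hc : (fun s => Φ (0, s) x) = fun s => φ s x := by
    funext s
    show θ (0 * f s) (φ s x) = φ s x
    rw [zero_mul, hθ0]
  have h2 : ∀ (c : ℝ → M) (V : Vec n), c = (fun s => φ s x) →
      metricAt g (c t) (curveAccel g c t + w t (c t)) V =
        metricAt g (φ t x) (deriv (fun s => eulVel φ s (φ t x)) t +
          covDeriv g (eulVel φ t) (eulVel φ t) (φ t x) + w t (φ t x)) V := by
    rintro _ V rfl
    rw [hφ.curveAccel_eq g hJ ht x]
  refine (h2 _ _ hc).trans ?_
  have alg : ∀ {A V W : Vec n} {a : ℝ}, V = a • W →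
      metricAt g (φ t x) A V = a * metricAt g (φ t x) A W := by
    rintro A V W a rfl
    rw [map_smul, smul_eq_mul]
  exact alg hvel

/-- A critical curve satisfies Newton's equations: vary it by `θ_{ε f(t)} ∘ φ_t`, where `f` is a
quadratic polynomial that vanishes at the endpoints of a small time interval. -/
lemma IsCriticalCurve.isNewtonCurve {g : RMetric n M}
    (he : ContDiffOn ℝ ∞ (fun p : ℝ × ℝ => e p.1 p.2) (Ioi 0 ×ˢ univ)) {s₀ : SFun n M}
    {J : Set ℝ} (hJ : IsOpen J) {φ : ℝ → Diff n M} (hφ : SmoothDiffOn J φ)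
    (hcrit : IsCriticalCurve g e s₀ J φ) : IsNewtonCurve g e s₀ J φ := by
  have hex : ∀ t, ∃ w : VField n M, HasL2Gradient g (potential g e s₀) (φ t) w := fun t =>
    let ⟨w, hw, _⟩ := exists_hasL2Gradient_potential g he s₀ (φ t)
    ⟨w, hw⟩
  choose w hw using hex
  have hv := hφ.smoothFieldOn_eulVel hJ
  intro t ht
  refine ⟨w t, hw t, ?_⟩
  have hE : ∀ y, (deriv (fun s => eulVel φ s y) t + covDeriv g (eulVel φ t) (eulVel φ t) y +
      w t y : TangentSpace (𝓡 n) y) = 0 := by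
    refine eq_zero_of_forall_variation g (contMDiff_density g (φ t)).continuous
      (density_pos g (φ t)) (fun X => ?_) fun θ hθ hθ0 => ?_
    · have d0 : ∀ x, deriv (fun s => metricAt g x (eulVel φ s x) (X x)) t =
          metricAt g x (deriv (F := Vec n) (fun s => eulVel φ s x) t) (X x) := fun x =>
        (((metricAt g x).flip (X x)).hasFDerivAt.comp_hasDerivAt t (hv.hasDerivAt hJ ht x)).deriv
      have c1 : Continuous fun x => metricAt g x (deriv (F := Vec n) (fun s => eulVel φ s x) t)
          (X x) := ((((hv.metric hJ g (smoothFieldOn_const J X)).deriv hJ).sfun ht).continuous.congr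
          fun x => d0 x)
      have c2 := continuous_covDeriv g (hv.toVField ht) X
      have c3 := (innerFun g (w t) X).contMDiff.continuous
      refine ((c1.add c2).add c3).congr fun x => ?_
      have alg : ∀ {A B C u : Vec n}, metricAt g x A u + metricAt g x B u + metricAt g x C u =
          metricAt g x (A + B + C) u := by
        intro A B C u
        simp only [map_add, _root_.add_apply]
      exact alg
    · -- `Q` is the work done along the velocity of `θ`, as a function of time
      set Q : ℝ → ℝ := fun t => ∫ y, metricAt g y (deriv (fun s => eulVel φ s y) t +
        covDeriv g (eulVel φ t) (eulVel φ t) y + w t y) (lagVel θ 0 y) * density g (φ t) y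
          ∂riemVol g with hQ
      have hbase : ∀ (f : ℝ → ℝ) (s : ℝ), (φ s).trans (θ (0 * f s)) = φ s := by
        intro f s
        ext x
        show θ (0 * f s) (φ s x) = φ s x
        rw [zero_mul, hθ0]
      have hgrad : ∀ (f : ℝ → ℝ), ∀ s ∈ J, HasL2Gradient g (potential g e s₀)
          ((fun p : ℝ × ℝ => (φ p.2).trans (θ (p.1 * f p.2))) (0, s)) (w s) := by
        intro f s _
        show HasL2Gradient g (potential g e s₀) ((φ s).trans (θ (0 * f s))) (w s)
        rw [hbase]
        exact hw s
      have hQc : ContinuousOn Q J := by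
        have hf : ContDiff ℝ ∞ (fun _ : ℝ => (1 : ℝ)) := contDiff_const
        refine (continuousOn_virtualWork g he s₀ hJ one_pos (hφ.trans_mul hθ hf 1)
          (hgrad fun _ => 1)).congr fun s hs => ?_
        rw [virtualWork_trans g hJ hφ hθ hθ0 hf w hs, one_mul]
      by_contra hne
      have hne' : Q t ≠ 0 := hne
      -- `Q t * Q` is positive on a closed interval around `t`
      have hpos : ∀ᶠ s in 𝓝 t, 0 < Q t * Q s ∧ s ∈ J := by
        have h1 : ContinuousAt (fun s => Q t * Q s) t :=
          continuousAt_const.mul (hQc.continuousAt (hJ.mem_nhds ht))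
        exact (h1.eventually (lt_mem_nhds (mul_self_pos.2 hne'))).and (hJ.eventually_mem ht)
      obtain ⟨r, hr, hball⟩ := Metric.nhds_basis_closedBall.mem_iff.1 hpos
      rw [Real.closedBall_eq_Icc] at hball
      have hI : Icc (t - r) (t + r) ⊆ J := fun s hs => (hball hs).2
      -- of the sign of `Q t` in the interior, zero at the endpoints
      let f : ℝ → ℝ := fun s => Q t * ((s - (t - r)) * ((t + r) - s))
      have hf : ContDiff ℝ ∞ f := contDiff_const.mul
        ((contDiff_id.sub contDiff_const).mul (contDiff_const.sub contDiff_id))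
      have hΦ := hφ.trans_mul hθ hf 1
      have hlt : t - r < t + r := by linarith
      have hzero : ∀ s, f s = 0 → ∀ ε : ℝ, (φ s).trans (θ (ε * f s)) = φ s := by
        intro s hs ε
        ext x
        show θ (ε * f s) (φ s x) = φ s x
        rw [hs, mul_zero, hθ0]
      have hf0 : f (t - r) = 0 := by simp [f]
      have hf1 : f (t + r) = 0 := by simp [f]
      have h1 := hcrit (t - r) (t + r) hlt.le hI 1 one_pos
        (fun ε s => (φ s).trans (θ (ε * f s))) hΦ (fun s _ => hbase f s)
        fun ε _ => ⟨hzero _ hf0 ε, hzero _ hf1 ε⟩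
      have h2 := hasDerivAt_action g he s₀ hJ one_pos hΦ (hgrad f) hlt.le hI
        (fun ε _ => (hzero _ hf0 ε).trans (hzero _ hf0 0).symm)
        (fun ε _ => (hzero _ hf1 ε).trans (hzero _ hf1 0).symm)
      have h3 := neg_eq_zero.1 (h2.unique h1)
      have hcont : ContinuousOn (virtualWork g (fun p => (φ p.2).trans (θ (p.1 * f p.2))) w) J :=
        continuousOn_virtualWork g he s₀ hJ one_pos hΦ (hgrad f)
      refine (intervalIntegral.intervalIntegral_pos_of_pos_on
        (hcont.mono (by rwa [uIcc_of_le hlt.le])).intervalIntegrable (fun s hs => ?_) hlt).ne' h3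
      rw [virtualWork_trans g hJ hφ hθ hθ0 hf w (hI (Ioo_subset_Icc_self hs))]
      have h4 := (hball (Ioo_subset_Icc_self hs)).1
      have h5 : 0 < s - (t - r) := sub_pos.2 hs.1
      have h6 : 0 < (t + r) - s := sub_pos.2 hs.2
      have alg : ∀ {a b c d : ℝ}, 0 < a * d → 0 < b → 0 < c → 0 < a * (b * c) * d := by
        intro a b c d h1 h2 h3
        have : a * (b * c) * d = a * d * (b * c) := by ring
        rw [this]
        positivity
      exact alg h4 h5 h6
  intro x
  rw [hφ.curveAccel_eq g hJ ht x]
  exact eq_neg_of_add_eq_zero_left (hE (φ t x))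

end Volume

/-! ### Uniqueness of transported densities -/

/-- The derivative of a time-dependent function along a curve. -/
lemma SmoothFunOn.hasDerivAt_along {J : Set ℝ} (hJ : IsOpen J) {F : ℝ → M → ℝ}
    (hF : SmoothFunOn n J F) {t : ℝ} (ht : t ∈ J) {c : ℝ → M}
    (hc : MDifferentiableAt 𝓘(ℝ, ℝ) (𝓡 n) c t) :
    HasDerivAt (fun s => F s (c s))
      (_root_.deriv (fun s => F s (c t)) t + dL (n := n) (F t) (c t) (curveVel (n := n) c t)) t := by
  have h1 := (((smoothFunOn_iff hJ).1 hF t ht (c t)).mdifferentiableAt (by simp)).hasMFDerivAt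
  have d1 := h1.comp t ((hasMFDerivAt_id t).prodMk hc.hasMFDerivAt)
    (f := fun s => (s, c s))
  have d2 := h1.comp t ((hasMFDerivAt_id t).prodMk (hasMFDerivAt_const (c t) t))
    (f := fun s => (s, c t))
  have d3 := h1.comp (c t) ((hasMFDerivAt_const t (c t)).prodMk (hasMFDerivAt_id (c t)))
    (f := fun y => (t, y))
  let D : ℝ × Vec n →L[ℝ] ℝ :=
    mfderiv (𝓘(ℝ, ℝ).prod (𝓡 n)) 𝓘(ℝ, ℝ) (fun q : ℝ × M => F q.1 q.2) (t, c t)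
  let V : Vec n := curveVel c t
  let C : ℝ →L[ℝ] Vec n := mfderiv 𝓘(ℝ, ℝ) (𝓡 n) c t
  have f1 : HasFDerivAt (fun s => F s (c s)) (D.comp ((ContinuousLinearMap.id ℝ ℝ).prod C)) t :=
    d1.hasFDerivAt
  have f2 : HasFDerivAt (fun s => F s (c t))
      (D.comp ((ContinuousLinearMap.id ℝ ℝ).prod (0 : ℝ →L[ℝ] Vec n))) t := d2.hasFDerivAt
  have e1 : HasDerivAt (fun s => F s (c s)) (D (1, V)) t := f1.hasDerivAt
  have e2 : HasDerivAt (fun s => F s (c t)) (D (1, 0)) t := f2.hasDerivAt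
  have e3 : dL (F t) (c t) V = D (0, V) :=
    congrArg (fun L : Vec n →L[ℝ] ℝ => L V) d3.mfderiv
  have e4 : D (1, V) = D (1, 0) + D (0, V) := by
    rw [← map_add, Prod.mk_add_mk, add_zero, zero_add]
  refine e1.congr_deriv ?_
  rw [e2.deriv, e4, ← e3]

section Volume

variable [CompactSpace M] [T2Space M] [MeasurableSpace M] [BorelSpace M] {e : ℝ → ℝ → ℝ}

/-- A density that satisfies the continuity equation is transported by the flow: its integrals
against functions transported by the flow are constant in time. -/
lemma integral_transport_eq (g : RMetric n M) {J : Set ℝ} (hJ : IsOpen J) (hJc : J.OrdConnected)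
    {φ : ℝ → Diff n M} (hφ : SmoothDiffOn J φ) {τ : ℝ → M → ℝ} (hτ : SmoothFunOn n J τ)
    (hcont : ∀ t ∈ J, ∀ x, deriv (fun s => τ s x) t +
      divergence g (fun y => τ t y • eulVel φ t y) x = 0) (f : SFun n M) {t t₀ : ℝ} (ht : t ∈ J)
    (ht₀ : t₀ ∈ J) :
    ∫ y, f ((φ t).symm y) * τ t y ∂riemVol g = ∫ y, f ((φ t₀).symm y) * τ t₀ y ∂riemVol g := by
  have hF : SmoothFunOn n J (fun t y => f ((φ t).symm y)) := f.contMDiff.comp_contMDiffOn hφ.2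
  have hv := hφ.smoothFieldOn_eulVel hJ
  -- a function transported by the flow has zero material derivative
  have htr : ∀ t ∈ J, ∀ y, deriv (fun s => f ((φ s).symm y)) t =
      -dL (fun y => f ((φ t).symm y)) y (eulVel φ t y) := by
    intro t ht y
    obtain ⟨x, rfl⟩ := (φ t).surjective y
    have h1 := hF.hasDerivAt_along hJ ht (c := fun s => φ s x)
      ((hφ.contMDiffAt_slice hJ ht x).mdifferentiableAt (by simp))
    have h2 : (fun s => f ((φ s).symm (φ s x))) = fun _ => f x := by
      funext s
      rw [(φ s).symm_apply_apply]
    rw [h2] at h1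
    have h3 := h1.unique (hasDerivAt_const t (f x))
    have h4 : dL (fun y => f ((φ t).symm y)) (φ t x) (eulVel φ t (φ t x)) =
        dL (fun y => f ((φ t).symm y)) (φ t x) (curveVel (fun s => φ s x) t) :=
      congrArg (dL (fun y => f ((φ t).symm y)) (φ t x)) (eulVel_apply φ t x)
    exact (eq_neg_of_add_eq_zero_left h3).trans (congrArg Neg.neg h4).symm
  have hd : ∀ t ∈ J, HasDerivAt (fun s => ∫ y, f ((φ s).symm y) * τ s y ∂riemVol g) 0 t := by
    intro t ht
    refine (hasDerivAt_integral_family g hJ (hF.mul hτ) ht).congr_deriv ?_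
    let ft := hF.toSFun ht
    let W : VField n M := smulField (hτ.toSFun ht) (hv.toVField ht)
    have i1 := integrable_riemVol g (continuous_dL ft W)
    have i2 := integrable_riemVol g (ft.contMDiff.continuous.mul (continuous_divergence g W))
    have h1 : ∀ y, deriv (fun s => f ((φ s).symm y) * τ s y) t =
        -dL ft y (W y) - ft y * divergence g W y := by
      intro y
      have h2 := ((hF.hasDerivAt hJ ht y).mul (hτ.hasDerivAt hJ ht y)).deriv
      have h3 := htr t ht y
      have h4 : dL ft y (W y) = τ t y * dL ft y (eulVel φ t y) := (dL ft y).map_smul _ _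
      have h5 := hcont t ht y
      have alg : ∀ {D F' τ' a b c L k : ℝ}, D = F' * a + b * τ' → F' = -L → c = a * L →
          τ' + k = 0 → D = -c - b * k := by
        intro D F' τ' a b c L k h1 h2 h3 h4
        rw [h1, h2, h3, eq_neg_of_add_eq_zero_left h4]
        ring
      exact alg h2 h3 h4 h5
    have h6 := integral_mul_divergence g W ft
    refine (integral_congr_ae (Filter.Eventually.of_forall h1)).trans ?_
    refine (integral_sub i1.neg i2).trans ?_
    have h7 : ∫ y, (-fun y => dL ft y (W y)) y ∂riemVol g = -∫ y, dL ft y (W y) ∂riemVol g :=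
      integral_neg _
    rw [h7]
    exact sub_eq_zero.2 h6.symm
  exact hJ.is_const_of_deriv_eq_zero hJc.isPreconnected
    (fun s hs => (hd s hs).differentiableAt.differentiableWithinAt) (fun s hs => (hd s hs).deriv)
    ht ht₀

/-- Solutions of the continuity equation are determined by their values at one time. -/
lemma eq_push_of_continuity (g : RMetric n M) {J : Set ℝ} (hJ : IsOpen J) (hJc : J.OrdConnected)
    {φ : ℝ → Diff n M} (hφ : SmoothDiffOn J φ) {τ : ℝ → M → ℝ} (hτ : SmoothFunOn n J τ)
    (hcont : ∀ t ∈ J, ∀ x, deriv (fun s => τ s x) t +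
      divergence g (fun y => τ t y • eulVel φ t y) x = 0) (s₀ : SFun n M) {t₀ : ℝ} (ht₀ : t₀ ∈ J)
    (h0 : τ t₀ = push g (φ t₀) s₀) {t : ℝ} (ht : t ∈ J) : τ t = push g (φ t) s₀ := by
  have hp := hφ.push hJ g s₀.contMDiff
  have h1 : ∀ f : SFun n M, ∫ y, f y * τ t y ∂riemVol g =
      ∫ y, f y * push g (φ t) s₀ y ∂riemVol g := by
    intro f
    let f' : SFun n M := ⟨fun x => f (φ t x), f.contMDiff.comp (φ t).contMDiff⟩
    -- both `τ` and the push-forward satisfy the continuity equation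
    have a1 := integral_transport_eq g hJ hJc hφ hτ hcont f' ht ht₀
    have a2 := integral_transport_eq g hJ hJc hφ hp
      (fun t ht x => deriv_push_add_divergence g hJ hφ s₀ ht x) f' ht ht₀
    rw [h0, ← a2] at a1
    have h2 : ∀ y, f' ((φ t).symm y) = f y := fun y => congrArg f ((φ t).apply_symm_apply y)
    simpa only [h2] using a1
  funext x
  refine sub_eq_zero.1 (eq_zero_of_forall_integral_mul g (F := fun x => τ t x - push g (φ t) s₀ x)
    ((hτ.sfun ht).continuous.sub (hp.sfun ht).continuous) (fun f => ?_) x)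
  have j1 := integrable_riemVol g (f.contMDiff.continuous.mul (hτ.sfun ht).continuous)
  have j2 := integrable_riemVol g (f.contMDiff.continuous.mul (hp.sfun ht).continuous)
  simp only [mul_sub]
  exact (integral_sub j1 j2).trans (sub_eq_zero.2 (h1 f))

lemma IsEulerSolution.congr {g : RMetric n M} {P : ℝ → ℝ → ℝ} {J : Set ℝ} (hJ : IsOpen J)
    {v v' : ℝ → (x : M) → TangentSpace (𝓡 n) x} {ρ ρ' σ σ' : ℝ → M → ℝ}
    (h : IsEulerSolution g P J v ρ σ) (hv : ∀ t ∈ J, v' t = v t) (hρ : ∀ t ∈ J, ρ' t = ρ t)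
    (hσ : ∀ t ∈ J, σ' t = σ t) : IsEulerSolution g P J v' ρ' σ' := by
  obtain ⟨h1, h2, h3, h4⟩ := h
  refine ⟨ContMDiffOn.congr h1 fun q hq => by rw [hv q.1 hq.1],
    ContMDiffOn.congr h2 fun q hq => by rw [hρ q.1 hq.1],
    ContMDiffOn.congr h3 fun q hq => by rw [hσ q.1 hq.1], fun t ht x => ?_⟩
  have e1 : (fun s => v' s x) =ᶠ[𝓝 t] fun s => v s x := by
    filter_upwards [hJ.mem_nhds ht] with s hs
    rw [hv s hs]
  have e2 : (fun s => ρ' s x) =ᶠ[𝓝 t] fun s => ρ s x := by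
    filter_upwards [hJ.mem_nhds ht] with s hs
    rw [hρ s hs]
  have e3 : (fun s => σ' s x) =ᶠ[𝓝 t] fun s => σ s x := by
    filter_upwards [hJ.mem_nhds ht] with s hs
    rw [hσ s hs]
  have e4 := Filter.EventuallyEq.deriv_eq (F := Vec n) e1
  obtain ⟨E1, E2, E3⟩ := h4 t ht x
  rw [e2.deriv_eq, e3.deriv_eq, hv t ht, hρ t ht, hσ t ht]
  have alg : ∀ {a a' b c : Vec n}, a = a' → a' + b + c = 0 → a + b + c = 0 := by
    rintro a _ b c rfl h
    exact h
  exact ⟨alg e4 E1, E2, E3⟩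

/-- The solution of the Euler system that starts at the densities of the flow comes from Newton's
equations. -/
lemma IsEulerSolution.densities_eq_and_isNewtonCurve {g : RMetric n M}
    (he : ContDiffOn ℝ ∞ (fun p : ℝ × ℝ => e p.1 p.2) (Ioi 0 ×ˢ univ)) {s₀ : SFun n M}
    {J : Set ℝ} (hJ : IsOpen J) (hJc : J.OrdConnected) {v : ℝ → (x : M) → TangentSpace (𝓡 n) x}
    {ρ σ : ℝ → M → ℝ} (h : IsEulerSolution g (pressure e) J v ρ σ) {φ : ℝ → Diff n M}
    (hφ : SmoothDiffOn J φ) (hvel : ∀ t ∈ J, ∀ x, lagVel φ t x = v t (φ t x)) {t₀ : ℝ}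
    (ht₀ : t₀ ∈ J) (hρ₀ : ρ t₀ = density g (φ t₀)) (hσ₀ : σ t₀ = push g (φ t₀) s₀) :
    (∀ t ∈ J, ρ t = density g (φ t) ∧ σ t = push g (φ t) s₀) ∧ IsNewtonCurve g e s₀ J φ := by
  have hv : ∀ t ∈ J, eulVel φ t = v t := by
    intro t ht
    funext y
    obtain ⟨x, rfl⟩ := (φ t).surjective y
    exact (eulVel_apply φ t x).trans (hvel t ht x)
  have h' := h.congr (v' := eulVel φ) hJ hv (fun _ _ => rfl) fun _ _ => rfl
  have hρ : ∀ t ∈ J, ρ t = density g (φ t) := fun t ht =>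
    eq_push_of_continuity g hJ hJc hφ h.2.1 (fun t ht x => (h'.2.2.2 t ht x).2.1)
      (ContMDiffMap.const 1) ht₀ hρ₀ ht
  have hσ : ∀ t ∈ J, σ t = push g (φ t) s₀ := fun t ht =>
    eq_push_of_continuity g hJ hJc hφ h.2.2.1 (fun t ht x => (h'.2.2.2 t ht x).2.2) s₀ ht₀ hσ₀ ht
  exact ⟨fun t ht => ⟨hρ t ht, hσ t ht⟩, (isNewtonCurve_iff_isEulerSolution g he s₀ hJ hφ).2
    (h'.congr hJ (fun _ _ => rfl) (fun t ht => (hρ t ht).symm) fun t ht => (hσ t ht).symm)⟩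

end Volume

end

end FullEuler

open FullEuler in
theorem mainTheorem1 {n : ℕ} {M : Type*} [TopologicalSpace M]
    [ChartedSpace (EuclideanSpace ℝ (Fin n)) M] [IsManifold (𝓡 n) ∞ M] [CompactSpace M]
    [T2Space M] [MeasurableSpace M] [BorelSpace M]
    (g : RMetric n M) (e : ℝ → ℝ → ℝ)
    (he : ContDiffOn ℝ ∞ (fun p : ℝ × ℝ => e p.1 p.2) (Ioi 0 ×ˢ univ)) (s₀ : SFun n M) :
    -- the group `𝒩` is a group of symmetries of the Lagrangian
    ((Diffeomorph.refl (𝓡 n) M ∞ ∈ symmetryGroup g s₀ ∧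
        (∀ η ∈ symmetryGroup g s₀, η.symm ∈ symmetryGroup g s₀) ∧
        (∀ η ∈ symmetryGroup g s₀, ∀ ζ ∈ symmetryGroup g s₀, η.trans ζ ∈ symmetryGroup g s₀)) ∧
      ∀ η ∈ symmetryGroup g s₀, ∀ (φ : Diff n M) (ξ : (x : M) → TangentSpace (𝓡 n) (φ x)),
        lagrangian g e s₀ (η.trans φ) (fun x => ξ (η x)) = lagrangian g e s₀ φ ξ) ∧
    -- `(φ, m) ↦ (m, ρ, σ)` embeds the quotient of `T^* Diff(M)` by `𝒩` into `𝔰₍₂₎^*`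
    ((∀ (φ : Diff n M) (α : Covec n M), SmoothForm α →
        SDual.Smooth (embed g s₀ φ α) ∧ ∀ x, 0 < (embed g s₀ φ α).ρ x) ∧
      ∀ (φ ψ : Diff n M) (α β : Covec n M), SmoothForm α → SmoothForm β →
        (embed g s₀ φ α = embed g s₀ ψ β ↔
          ∃ η ∈ symmetryGroup g s₀, ψ = η.trans φ ∧ β = α)) ∧
    -- the embedding is a Poisson map
    (∀ (φ : Diff n M) (α : Covec n M), SmoothForm α → ∀ (F G : SDual n M → ℝ) (dF dG : SAlg n M),
      HasVarDeriv g F (embed g s₀ φ α) dF → HasVarDeriv g G (embed g s₀ φ α) dG →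
      ∃ DF DG : TCovec n M, SmoothForm DF.ν ∧ SmoothForm DG.ν ∧
        HasCotDeriv g (fun ψ β => F (embed g s₀ ψ β)) φ α DF ∧
        HasCotDeriv g (fun ψ β => G (embed g s₀ ψ β)) φ α DG ∧
        canonicalBracket g α DF DG = liePoisson g (embed g s₀ φ α) dF dG) ∧
    -- the Legendre transform of `L` is `φ̇ = w ∘ φ ↦ m = ρ w^♭ ⊗ μ`, with Hamiltonian `H ∘ embed`
    (∀ (φ : Diff n M) (w : VField n M),
      (∀ u : VField n M,
        HasDerivAt (fun ε : ℝ => lagrangian g e s₀ φ (fun x => w (φ x) + ε • u (φ x)))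
          (∫ x, legendre g (density g φ) w x (u x) ∂riemVol g) 0) ∧
      hamiltonian g e (embed g s₀ φ (legendre g (density g φ) w)) =
        (∫ x, legendre g (density g φ) w x (w x) ∂riemVol g)
          - lagrangian g e s₀ φ (fun x => w (φ x))) ∧
    -- the dynamics, on an open time interval `J`
    ∀ J : Set ℝ, IsOpen J → J.OrdConnected →
      -- the Lie-Poisson system on `𝔰₍₂₎^*` is the fully compressible Euler system
      (∀ (v : ℝ → (x : M) → TangentSpace (𝓡 n) x) (ρ σ : ℝ → M → ℝ),
        (∀ t ∈ J, ∀ x, 0 < ρ t x) →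
        (IsLiePoissonSolution g (hamiltonian g e) J (fun t => ⟨legendre g (ρ t) (v t), ρ t, σ t⟩) ↔
          IsEulerSolution g (pressure e) J v ρ σ)) ∧
      -- Newton's equations, the Lie-Poisson system and the Euler system are equivalent
      (∀ φ : ℝ → Diff n M, SmoothDiffOn J φ →
        List.TFAE [
          IsCriticalCurve g e s₀ J φ,
          IsNewtonCurve g e s₀ J φ,
          IsLiePoissonSolution g (hamiltonian g e) J
            (fun t => embed g s₀ (φ t) (legendre g (density g (φ t)) (eulVel φ t))),
          IsEulerSolution g (pressure e) J (eulVel φ) (fun t => density g (φ t))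
            (fun t => push g (φ t) s₀)]) ∧
      -- solutions of the Euler system with the right initial data come from Newton's equations
      (∀ (v : ℝ → (x : M) → TangentSpace (𝓡 n) x) (ρ σ : ℝ → M → ℝ),
        IsEulerSolution g (pressure e) J v ρ σ →
        ∀ φ : ℝ → Diff n M, SmoothDiffOn J φ → (∀ t ∈ J, ∀ x, lagVel φ t x = v t (φ t x)) →
        ∀ t₀ ∈ J, ρ t₀ = density g (φ t₀) → σ t₀ = push g (φ t₀) s₀ →
          (∀ t ∈ J, ρ t = density g (φ t) ∧ σ t = push g (φ t) s₀) ∧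
            IsNewtonCurve g e s₀ J φ) := by
  refine ⟨⟨⟨refl_mem_symmetryGroup g s₀, fun η hη => symm_mem_symmetryGroup g s₀ hη,
      fun η hη ζ hζ => trans_mem_symmetryGroup g s₀ hη hζ⟩,
      fun η hη φ ξ => lagrangian_trans g e s₀ hη φ ξ⟩,
    ⟨fun φ α hα => ⟨smooth_embed g s₀ φ hα, density_pos g φ⟩,
      fun φ ψ α β _ _ => embed_eq_iff g s₀ φ ψ α β⟩,
    fun φ α hα F G dF dG hF hG => ?_,
    fun φ w => ⟨fun u => hasDerivAt_lagrangian g e s₀ φ w u,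
      hamiltonian_embed_legendre g e s₀ φ w⟩,
    fun J hJ hJc => ⟨fun v ρ σ h0 => isLiePoissonSolution_iff_isEulerSolution g he hJ h0,
      fun φ hφ => ?_, fun v ρ σ hE φ hφ hvel t₀ ht₀ hρ₀ hσ₀ =>
        hE.densities_eq_and_isNewtonCurve he hJ hJc hφ hvel ht₀ hρ₀ hσ₀⟩⟩
  · have hs := smooth_embed g s₀ φ hα
    exact ⟨cotDeriv hs dF, cotDeriv hs dG, smoothForm_cotDeriv hs dF, smoothForm_cotDeriv hs dG,
      hasCotDeriv_comp_embed g s₀ φ hα hF, hasCotDeriv_comp_embed g s₀ φ hα hG,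
      canonicalBracket_cotDeriv g hs dF dG⟩
  · tfae_have 1 → 2 := IsCriticalCurve.isNewtonCurve he hJ hφ
    tfae_have 2 → 1 := IsNewtonCurve.isCriticalCurve he hJ
    tfae_have 2 ↔ 4 := isNewtonCurve_iff_isEulerSolution g he s₀ hJ hφ
    tfae_have 3 ↔ 4 :=
      isLiePoissonSolution_iff_isEulerSolution g he hJ fun t _ => density_pos g (φ t)
    tfae_finish
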